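/- Fix integers $p>q>0$. **Rips words.** Let $\mathcal X$ be a set of $14p$ words and $\mathcal Y$ a set of $30$ words such that: * the words in $\mathcal X\cup\mathcal Y$ are distinct and have length at least $100$; the words in $\mathcal X$ are pairwise disjoint subwords of the infinite word $x_1x_2\,x_1x_2^2\,x_1x_2^3\cdots$, and those in $\mathcal Y$ are pairwise disjoint subwords of $y_1y_2\,y_1y_2^2\,y_1y_2^3\cdots$; * conditions (i)–(iv) below hold. **Defining relations.** In the following list of $5p+11$ relations every occurrence of $X_*$ (respectively $Y_*$) stands for an element of $\mathcal X$ (respectively $\mathcal Y$), each element being used exactly once. For $j\in\{0,\dots,p\}$ let $Z_*$ stand for $X_*$ if $j\ne0$ and for $Y_*$ if $j=0$, let $b_{p+1}:=1$, and let $\epsilon_j:=a_2$ if $j=q-1$ and $\epsilon_j:=1$ otherwise. $$b_j^{-1}(a_1b_{j+1})b_j=a_1\epsilon_j\,Z_*t^{-1}Z_*tZ_*,\quad b_j^{-1}a_2b_j=a_2\,Z_*t^{-1}Z_*tZ_*,\quad b_j^{-1}tb_j=Z_*tZ_*,\quad b_j^{-1}x_kb_j=Z_*t^{-1}Z_*tZ_*\qquad(0\le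 j\le p,\ k=1,2),$$ $$a_i^{-1}ta_i=Y_*tY_*,\qquad a_i^{-1}y_ka_i=Y_*t^{-1}Y_*tY_*\qquad(i,k=1,2).$$ Write each relation as $s^{-1}us=v$, with $s$ one of the letters $b_j,a_i$, and call $u$ its initial word and $v$ its terminal word. Let $\mathcal R$ be the set of the words $s^{-1}usv^{-1}$, and let $S$ be the set of all terminal words $v$. Let $\mathcal U$ be the set of all $u'$ and $v'$ such that $u'$, $v'$ are words without the letter $t$ and $t^{-1}u't\,v'^{-1}$ is a cyclic conjugate of a word in $\mathcal R^{\pm1}$. **Small cancellation.** For a set $A$ of words let $\mathcal C(A)$ be the set of all cyclic conjugates of words in $A^{\pm1}$. A piece (for $A$) is a common prefix of two distinct words in $\mathcal C(A)$. The conditions are: * (i) every piece for $\mathcal R$ has length strictly less than a sixth of the length of the shortest word in $\mathcal R$; * (ii) no element of $\mathcal C(S)$ is a concatenation of fewer than $3$ pieces for $S$; * (iii) every piece for $\mathcal X\cup\mathcal Y$ has length strictly less than a quarter of the length of each element of $\mathcal C(\mathcal X\cup\mathcal Y)$ in which it occurs; * (iv) no element of $\mathcal C(\mathcal U)$ is a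 concatenation of fewer than $5$ pieces for $\mathcal U$. **Groups.** Let $F$ be the free group on $t,x_1,x_2,y_1,y_2$. For $i=-1,0,\dots,p$ let $G_i$ be the group generated by $t,x_1,x_2,y_1,y_2,a_1,a_2,b_{p-i},\dots,b_p$ (no $b$-letters if $i=-1$) subject to all relators in $\mathcal R$ in which only these letters appear, and let $G=G_p$. For a group $K$, subgroups $I_m,T_m\le K$ and isomorphisms $\varphi_m\colon I_m\to T_m$, the HNN-extension of $K$ with stable letters $s_m$ conjugating the initial groups $I_m$ to the terminal groups $T_m$ is the quotient of the free product of $K$ and the free group on the $s_m$ by the relations $s_m^{-1}gs_m=\varphi_m(g)$, $g\in I_m$. **Proposition.** 1. $t,y_1,y_2$ freely generate a subgroup of $F$ of rank $3$, and so do, for $i=1$ and for $i=2$, the terminal words of the relations $a_i^{-1}ta_i=Y_*tY_*$, $a_i^{-1}y_1a_i=Y_*t^{-1}Y_*tY_*$, $a_i^{-1}y_2a_i=Y_*t^{-1}Y_*tY_*$. The group $G_{-1}$ is the double HNN-extension of $F$ with stable letters $a_1,a_2$, where $a_i$ conjugates $\langle t,y_1,y_2\rangle$ to the subgroup generated by those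 three terminal words, in the order listed. 2. For $0\le i\le p$ let $K_i=\langle a_1b_{p-i+1},a_2,t,x_1,x_2\rangle\le G_{i-1}$ (so $K_0=\langle a_1,a_2,t,x_1,x_2\rangle$), and let $L_i\le G_{i-1}$ be generated by the terminal words of the five relations with conjugating letter $b_{p-i}$. Then the five listed generators of $K_i$ are a basis of a free group of rank $5$, so are those of $L_i$, and $G_i$ is the HNN-extension of $G_{i-1}$ with stable letter $b_{p-i}$ conjugating $K_i$ to $L_i$ (the generators of $K_i$ to the corresponding ones of $L_i$). In both parts the identification is compatible with the generators: each generator of the vertex group is sent to the generator of the same name, and each stable letter to the generator of that name. **Corollary.** The subgroup $H=\langle t,y_1,y_2\rangle$ of $G$ is free of rank $3$, with basis $t,y_1,y_2$. -/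

import Mathlib

namespace NoisyHNN

/-! ### Words, pieces and small cancellation

Words over an alphabet `α` are lists of pairs `(l, ε)`, where `(l, true)` is the letter `l` and
`(l, false)` is its formal inverse, as in Mathlib's `FreeGroup`. -/

section Words

variable {α : Type*}

/-- The positive word spelled by a list of letters. -/
def pos (l : List α) : List (α × Bool) := l.map fun c => (c, true)

/-- `𝒞(S)`: all cyclic conjugates of words in `S ∪ S⁻¹`. -/
def cyclicClosure (S : Set (List (α × Bool))) : Set (List (α × Bool)) :=
  {w | ∃ s ∈ S, w ~r s ∨ w ~r FreeGroup.invRev s}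

/-- A piece is a common prefix of two distinct words of `𝒞(S)`. -/
def IsPiece (S : Set (List (α × Bool))) (π : List (α × Bool)) : Prop :=
  ∃ w₁ ∈ cyclicClosure S, ∃ w₂ ∈ cyclicClosure S, w₁ ≠ w₂ ∧ π <+: w₁ ∧ π <+: w₂

/-- The condition `C(n)`: no element of `𝒞(S)` is a concatenation of fewer than `n` pieces. -/
def ConditionC (n : ℕ) (S : Set (List (α × Bool))) : Prop :=
  ∀ w ∈ cyclicClosure S, ∀ L : List (List (α × Bool)),
    (∀ π ∈ L, IsPiece S π) → L.flatten = w → n ≤ L.length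

/-- The condition `C'(1/n)`: every piece is shorter than `1/n` times the length of each element of
`𝒞(S)` in which it occurs. -/
def ConditionC' (n : ℕ) (S : Set (List (α × Bool))) : Prop :=
  ∀ π, IsPiece S π → ∀ w ∈ cyclicClosure S, π <:+: w → n * π.length < w.length

/-- The uniform condition `C'(1/n)`: every piece is shorter than `1/n` times the length of each
(in particular, of a shortest) word of `S`. -/
def UniformConditionC' (n : ℕ) (S : Set (List (α × Bool))) : Prop :=
  ∀ π, IsPiece S π → ∀ w ∈ S, n * π.length < w.length

/-- The initial segment `c₀ c₁ c₀ c₁² ⋯ c₀ c₁ᴺ` of the infinite Rips word `c₀ c₁ c₀ c₁² c₀ c₁³ ⋯`. -/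
def ripsPrefix (c : Fin 2 → α) (N : ℕ) : List α :=
  (List.range N).flatMap fun m => c 0 :: List.replicate (m + 1) (c 1)

/-- The subword of the infinite Rips word consisting of the `len` letters at the positions
`start, …, start + len - 1` (the initial segment used is always long enough). -/
def ripsSubword (c : Fin 2 → α) (start len : ℕ) : List α :=
  ((ripsPrefix c (start + len)).drop start).take len

end Words

/-! ### The presentation -/

/-- The letters; `a 0, a 1` stand for `a₁, a₂`, and similarly for the `x`s and the `y`s.
Only `b 0, …, b p` will be used. -/
inductive Letter : Type
  | a (i : Fin 2)
  | b (j : ℕ)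
  | t
  | x (k : Fin 2)
  | y (k : Fin 2)

/-- Words on the letters and their inverses. -/
abbrev Word := List (Letter × Bool)

/-- Names of the defining relators `r_{1,j}`, `r_{2,j}`, `r_{3,j}`, `r_{3,j,k}` (`0 ≤ j ≤ p`) and
`r_{4,i}`, `r_{4,i,k}`. Each of them says that a letter `s` conjugates an initial word `u` to a
terminal word `v`, that is, `s⁻¹ u s = v`. -/
inductive Rel (p : ℕ) : Type
  | r1 (j : Fin (p + 1))
  | r2 (j : Fin (p + 1))
  | r3t (j : Fin (p + 1))
  | r3x (j : Fin (p + 1)) (k : Fin 2)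
  | r4t (i : Fin 2)
  | r4y (i : Fin 2) (k : Fin 2)

namespace Rel

variable {p : ℕ}

/-- The conjugating letter. -/
def stable : Rel p → Letter
  | r1 j => .b j
  | r2 j => .b j
  | r3t j => .b j
  | r3x j _ => .b j
  | r4t i => .a i
  | r4y i _ => .a i

/-- The initial word: `a₁ b_{j+1}` (or `a₁`, if `j = p`), `a₂`, `t`, `x_k`, `t`, `y_k`. -/
def initial : Rel p → Word
  | r1 j => if (j : ℕ) = p then pos [.a 0] else pos [.a 0, .b (j + 1)]
  | r2 _ => pos [.a 1]
  | r3t _ => pos [.t]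
  | r3x _ k => pos [.x k]
  | r4t _ => pos [.t]
  | r4y _ k => pos [.y k]

/-- The part of the terminal word before its noise: `a₁ a₂` for `r_{1,q-1}`, `a₁` for the other
`r_{1,j}`, `a₂` for `r_{2,j}`, and nothing otherwise. -/
def head (q : ℕ) : Rel p → Word
  | r1 j => if (j : ℕ) + 1 = q then pos [.a 0, .a 1] else pos [.a 0]
  | r2 _ => pos [.a 1]
  | _ => []

/-- The relators whose initial word is `t`; they contain two Rips words, the others three. -/
def IsT : Rel p → Bool
  | r3t _ => true
  | r4t _ => true
  | _ => false

/-- The Rips words in the relators with conjugating letter `b_j`, `j ≠ 0`, are on `x₁, x₂`. -/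
def IsX : Rel p → Bool
  | r1 j => (j : ℕ) ≠ 0
  | r2 j => (j : ℕ) ≠ 0
  | r3t j => (j : ℕ) ≠ 0
  | r3x j _ => (j : ℕ) ≠ 0
  | r4t _ => false
  | r4y _ _ => false

/-- The two letters on which the Rips words in a relator are written. -/
def noiseLetters (ρ : Rel p) : Fin 2 → Letter := if ρ.IsX then .x else .y

/-- The places in the relator where Rips words stand: all of `0, 1, 2`, but for the relators with
only two Rips words just `0` and `2`. -/
def IsSlot (ρ : Rel p) (s : Fin 3) : Prop := ρ.IsT = true → s ≠ 1

/-- The relators with conjugating letter `b_j`, in the order of their initial words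
`a₁ b_{j+1}` (or `a₁`), `a₂`, `t`, `x₁`, `x₂`. -/
def bRow (j : Fin (p + 1)) : Fin 5 → Rel p := ![r1 j, r2 j, r3t j, r3x j 0, r3x j 1]

/-- The relators with conjugating letter `a_i`, in the order of their initial words
`t`, `y₁`, `y₂`. -/
def aRow (i : Fin 2) : Fin 3 → Rel p := ![r4t i, r4y i 0, r4y i 1]

end Rel

/-- A choice of Rips words, given by their positions in the two infinite Rips words. The word at a
place of a relator is used nowhere else. Values at places that do not exist are irrelevant. -/
structure RipsWords (p : ℕ) where
  /-- First position of the word. -/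
  start : Rel p → Fin 3 → ℕ
  /-- Length of the word. -/
  len : Rel p → Fin 3 → ℕ

namespace RipsWords

variable {p : ℕ} (R : RipsWords p)

/-- The Rips word at the place `s` of the relator `ρ`. -/
def word (ρ : Rel p) (s : Fin 3) : Word :=
  pos (ripsSubword ρ.noiseLetters (R.start ρ s) (R.len ρ s))

/-- The noise `Z₀ t Z₂` or `Z₀ t⁻¹ Z₁ t Z₂` of a relator, where the `Z`s are its Rips words. -/
def noise (ρ : Rel p) : Word :=
  if ρ.IsT then R.word ρ 0 ++ [(.t, true)] ++ R.word ρ 2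
  else R.word ρ 0 ++ [(.t, false)] ++ R.word ρ 1 ++ [(.t, true)] ++ R.word ρ 2

/-- The terminal word of a relator. -/
def terminal (q : ℕ) (ρ : Rel p) : Word := ρ.head q ++ R.noise ρ

/-- The defining relator `s⁻¹ u s v⁻¹`. -/
def relator (q : ℕ) (ρ : Rel p) : Word :=
  [(ρ.stable, false)] ++ ρ.initial ++ [(ρ.stable, true)] ++ FreeGroup.invRev (R.terminal q ρ)

/-- The set `ℛ` of defining relators. -/
def relators (q : ℕ) : Set Word := {w | ∃ ρ, w = R.relator q ρ}

/-- The set `𝒳 ∪ 𝒴` of all Rips words. -/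
def words : Set Word := {w | ∃ ρ s, ρ.IsSlot s ∧ w = R.word ρ s}

/-- The set of all terminal words. -/
def terminals (q : ℕ) : Set Word := {w | ∃ ρ, w = R.terminal q ρ}

/-- The set `𝒰` of all words `u`, `v` without `t` such that the relation `t⁻¹ u t = v` is a
defining one (up to cyclic conjugation and inversion). -/
def tSides (q : ℕ) : Set Word :=
  {w | ∃ u v : Word, (∀ c ∈ u, c.1 ≠ Letter.t) ∧ (∀ c ∈ v, c.1 ≠ Letter.t) ∧
    [(Letter.t, false)] ++ u ++ [(Letter.t, true)] ++ FreeGroup.invRev v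
      ∈ cyclicClosure (R.relators q) ∧
    (w = u ∨ w = v)}

/-- The requirements on the choice of the Rips words: they are distinct and pairwise disjoint
subwords of the infinite Rips words, have length at least 100, and satisfy four small cancellation
conditions. (All words in the sets concerned are automatically cyclically reduced.) -/
structure Admissible (q : ℕ) : Prop where
  disjoint : ∀ ρ s ρ' s', ρ.IsSlot s → ρ'.IsSlot s' → (ρ, s) ≠ (ρ', s') → ρ.IsX = ρ'.IsX →
    R.start ρ s + R.len ρ s ≤ R.start ρ' s' ∨ R.start ρ' s' + R.len ρ' s' ≤ R.start ρ s
  distinct : ∀ ρ s ρ' s', ρ.IsSlot s → ρ'.IsSlot s' → R.word ρ s = R.word ρ' s' →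
    (ρ, s) = (ρ', s')
  long : ∀ ρ s, ρ.IsSlot s → 100 ≤ R.len ρ s
  relators_uniformC' : UniformConditionC' 6 (R.relators q)
  terminals_C : ConditionC 3 (R.terminals q)
  words_C' : ConditionC' 4 R.words
  tSides_C : ConditionC 5 (R.tSides q)

end RipsWords

/-! ### The groups -/

/-- The letters `t, x₁, x₂, y₁, y₂`. -/
def baseAlphabet : Set Letter := {.t, .x 0, .x 1, .y 0, .y 1}

/-- The letters `t, x₁, x₂, y₁, y₂, a₁, a₂` together with the last `n` of the letters
`b_0, …, b_p`. -/
def alphabet (p n : ℕ) : Set Letter :=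
  {l | ∀ j, l = .b j → j ≤ p ∧ p < j + n}

/-- The free group `F` on `t, x₁, x₂, y₁, y₂`. -/
abbrev BaseGroup := FreeGroup baseAlphabet

/-- The group `G_{n-1}`: its generators are `t, x₁, x₂, y₁, y₂, a₁, a₂` and the last `n` of
`b_0, …, b_p`, and its relators are all those defining relators in which only these letters
appear. Thus `n = 0` gives `G_{-1}` and `n = p + 1` gives `G = G_p`. -/
abbrev Stage {p : ℕ} (q : ℕ) (R : RipsWords p) (n : ℕ) : Type :=
  PresentedGroup {r : FreeGroup (alphabet p n) |
    ∃ ρ : Rel p, FreeGroup.map Subtype.val r = FreeGroup.mk (R.relator q ρ)}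

open Classical in
/-- The element of a group represented by a word on an alphabet `A`, where the letters in `A` are
interpreted by `f`. (Only used for words on `A`; letters outside `A` are ignored.) -/
noncomputable def evalOn {G : Type*} [Group G] {A : Set Letter} (f : A → G) (w : Word) : G :=
  FreeGroup.lift (fun l : Letter => if h : l ∈ A then f ⟨l, h⟩ else 1) (FreeGroup.mk w)

/-- The element of `F` represented by a word on `t, x₁, x₂, y₁, y₂`. -/
noncomputable def baseElt (w : Word) : BaseGroup := evalOn FreeGroup.of w

/-- The element of `G_{n-1}` represented by a word on its generators. -/
noncomputable def stageElt {p : ℕ} (q : ℕ) (R : RipsWords p) (n : ℕ) (w : Word) : Stage q R n :=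
  evalOn PresentedGroup.of w

/-- The subgroup generated by a finite sequence of elements. -/
def gen {G : Type*} [Group G] {n : ℕ} (g : Fin n → G) : Subgroup G :=
  Subgroup.closure (Set.range g)

/-- The `k`-th generator, as an element of the subgroup generated. -/
def genElt {G : Type*} [Group G] {n : ℕ} (g : Fin n → G) (k : Fin n) : gen g :=
  ⟨g k, Subgroup.subset_closure ⟨k, rfl⟩⟩

/-- The elements `g 0, …, g (n-1)` freely generate a free subgroup (of rank `n`). -/
def FreelyGenerate {G : Type*} [Group G] {n : ℕ} (g : Fin n → G) : Prop :=
  Function.Injective (FreeGroup.lift g)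

/-! ### Multiple HNN-extensions -/

section MultiHNN

variable {ι K : Type*} [Group K] (I T : ι → Subgroup K) (φ : ∀ i, I i ≃* T i)

/-- The multiple HNN-extension with vertex group `K` and stable letters `s_i`, `i : ι`, where `s_i`
conjugates the initial group `I i` to the terminal group `T i` via `φ i`: the quotient of the free
product of `K` and the free group on the `s_i` by the relations `s_i⁻¹ g s_i = φ i g`, `g ∈ I i`. -/
abbrev MultiHNN : Type _ :=
  Monoid.Coprod K (FreeGroup ι) ⧸ Subgroup.normalClosure
    {r : Monoid.Coprod K (FreeGroup ι) | ∃ (i : ι) (g : I i),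
      r = (Monoid.Coprod.inr (FreeGroup.of i))⁻¹ * Monoid.Coprod.inl (g : K) *
        Monoid.Coprod.inr (FreeGroup.of i) * (Monoid.Coprod.inl (φ i g : K))⁻¹}

/-- The canonical map of the vertex group to the multiple HNN-extension. -/
def MultiHNN.of : K →* MultiHNN I T φ :=
  (QuotientGroup.mk' _).comp Monoid.Coprod.inl

/-- The stable letters. -/
def MultiHNN.stable (i : ι) : MultiHNN I T φ :=
  QuotientGroup.mk' _ (Monoid.Coprod.inr (FreeGroup.of i))

end MultiHNN

/-! ### The associated subgroups -/

section Table

variable {p : ℕ} (q : ℕ) (R : RipsWords p)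

/-- The generators `t, y₁, y₂` of the initial group in `F` of both `a₁` and `a₂`. -/
noncomputable def baseInitial : Fin 3 → BaseGroup :=
  fun k => baseElt (pos [(![.t, .y 0, .y 1] : Fin 3 → Letter) k])

/-- The generators `Y t Y, Y t⁻¹ Y t Y, Y t⁻¹ Y t Y` of the terminal group in `F` of `a_i`. -/
noncomputable def baseTerminal (i : Fin 2) : Fin 3 → BaseGroup :=
  fun k => baseElt (R.terminal q (Rel.aRow i k))

/-- The generators `a₁ b_{p-i+1}` (or `a₁`, if `i = 0`), `a₂, t, x₁, x₂` of the subgroup `K_i`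
of `G_{i-1}`. -/
noncomputable def genK (i : Fin (p + 1)) : Fin 5 → Stage q R i :=
  fun k => stageElt q R i (Rel.bRow i.rev k).initial

/-- The generators of the subgroup `L_i` of `G_{i-1}`: the terminal words of the relators with
conjugating letter `b_{p-i}`. -/
noncomputable def genL (i : Fin (p + 1)) : Fin 5 → Stage q R i :=
  fun k => stageElt q R i (R.terminal q (Rel.bRow i.rev k))

/-- The generators `t, y₁, y₂` of the subgroup `H` of `G = G_p`. -/
noncomputable def genH : Fin 3 → Stage q R (p + 1) :=
  fun k => stageElt q R (p + 1) (pos [(![.t, .y 0, .y 1] : Fin 3 → Letter) k])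

end Table

end NoisyHNN

open NoisyHNN

/-! Each presentation arises from the preceding one by adding stable letters and the relations of an
HNN-extension on generators. Such relations define an HNN-extension as soon as both families of
generators are free, since then their correspondence extends to an isomorphism. So the content is
the freeness of the associated subgroups. In `F` it follows from small cancellation among the Rips
words. The difficulty is the freeness of `K_i` and `L_i`.

For these, the relators without `b₀` are read with `t` as the stable letter: `s⁻¹us = hZt⁻¹Z'tZ''`
becomes `t (Z⁻¹h⁻¹s⁻¹usZ''⁻¹) t⁻¹ = Z'`, and `s⁻¹ts = ZtZ''` becomes `t (sZ''⁻¹) t⁻¹ = sZ`. Less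
than half of a Rips word cancels on either side (`SmallNoise.reduce_subst`), so the words in
brackets are free, and so are the right-hand sides. Hence these relations define one HNN-extension
`THnn` of the free group on all letters. Every `G_{i-1}` with `i ≤ p` maps to it, and freeness can
be tested there.

Words in `THnn` are tested by partial actions of the letters. If the relations hold wherever they
can be read, Britton's lemma shows that a trivial word that can be read from `ξ` to `η` has `ξ = η`
(`Readable.eq_of_reach_one`): pinches on the path are replaced one after the other. Elements of the
associated subgroups are read through reduced words, from which noise has been cancelled; uniformity
of the action allows it to be restored (`NoCancel.run`).

For `K_i`, the letters act on pairs of a vertex `v` in the free group on `b_0, …, b_p` and an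
element `f` of the free group on all letters (`treeAction`). Here `b_m` strips `b_m` from `v`, the
letters `a₂, t, x₁, x₂` multiply `f` by their conjugates along positive `v`, and `a₁` moves vertices
by the automorphism `b_m ↦ b_{m+1}b_m`, as `r_{1,m}` demands. At the vertex `1` the five generators
multiply `f` by five different letters, so they are free. For `L_i` with `i < p` the terminal words
act at `1` as right multiplication by themselves, and their freeness in the free group on all
letters suffices.

The terminal words of `b₀` contain `y`s, which act nowhere. But the Rips words of these relators,
with the letters outside all Rips words, are free and generate a subgroup that meets both associated
subgroups of `THnn` trivially; together with `t` they still generate a free group. The terminal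
words of `b₀` are free in it, as each is retracted to its first Rips word.

For the corollary, `t, y₁, y₂` remain free in `G_{-1}`, and vertex groups embed in HNN-extensions.
-/

namespace NoisyHNN

open FreeGroup (invRev IsReduced)

/-! ### Partial actions -/

/-- Every letter acts on `Ξ` as a partial bijection, given by its graph. -/
structure PartialAction (α Ξ : Type*) where
  /-- The graph of a letter. -/
  step : α → Ξ → Ξ → Prop
  right_unique : ∀ {a ξ η η'}, step a ξ η → step a ξ η' → η = η'
  left_unique : ∀ {a ξ ξ' η}, step a ξ η → step a ξ' η → ξ = ξ'

namespace PartialAction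

variable {α Ξ : Type*} (𝒜 : PartialAction α Ξ)

/-- The graph of a letter or its inverse. -/
def signedStep (c : α × Bool) (ξ η : Ξ) : Prop :=
  if c.2 then 𝒜.step c.1 ξ η else 𝒜.step c.1 η ξ

/-- The graph of a word, which acts from the right. -/
def run : List (α × Bool) → Ξ → Ξ → Prop
  | [], ξ, η => ξ = η
  | c :: w, ξ, η => ∃ ζ, 𝒜.signedStep c ξ ζ ∧ run w ζ η

theorem signedStep_not (a : α) (b : Bool) (ξ η : Ξ) :
    𝒜.signedStep (a, !b) ξ η ↔ 𝒜.signedStep (a, b) η ξ := by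
  cases b <;> simp [signedStep]

theorem signedStep_right_unique {c : α × Bool} {ξ η η' : Ξ} (h : 𝒜.signedStep c ξ η)
    (h' : 𝒜.signedStep c ξ η') : η = η' := by
  obtain ⟨a, b⟩ := c
  cases b
  · exact 𝒜.left_unique (by simpa [signedStep] using h) (by simpa [signedStep] using h')
  · exact 𝒜.right_unique (by simpa [signedStep] using h) (by simpa [signedStep] using h')

@[simp] theorem run_nil (ξ η : Ξ) : 𝒜.run [] ξ η ↔ ξ = η := Iff.rfl

theorem run_cons (c : α × Bool) (w : List (α × Bool)) (ξ η : Ξ) :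
    𝒜.run (c :: w) ξ η ↔ ∃ ζ, 𝒜.signedStep c ξ ζ ∧ 𝒜.run w ζ η := Iff.rfl

theorem run_singleton (c : α × Bool) (ξ η : Ξ) : 𝒜.run [c] ξ η ↔ 𝒜.signedStep c ξ η := by
  simp [run_cons]

theorem run_append (u v : List (α × Bool)) (ξ η : Ξ) :
    𝒜.run (u ++ v) ξ η ↔ ∃ ζ, 𝒜.run u ξ ζ ∧ 𝒜.run v ζ η := by
  induction u generalizing ξ with
  | nil => simp
  | cons c u ih =>
    simp only [List.cons_append, run_cons, ih]
    constructor
    · rintro ⟨ζ, h, ζ', h', h''⟩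
      exact ⟨ζ', ⟨ζ, h, h'⟩, h''⟩
    · rintro ⟨ζ', ⟨ζ, h, h'⟩, h''⟩
      exact ⟨ζ, h, ζ', h', h''⟩

theorem run_invRev (w : List (α × Bool)) (ξ η : Ξ) :
    𝒜.run (invRev w) ξ η ↔ 𝒜.run w η ξ := by
  induction w generalizing ξ η with
  | nil => simp [eq_comm]
  | cons c w ih =>
    obtain ⟨a, b⟩ := c
    rw [FreeGroup.invRev_cons, run_append]
    simp only [run_cons 𝒜 (a, b)]
    have : invRev [(a, b)] = [(a, !b)] := rfl
    simp only [this, run_singleton, signedStep_not, ih]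
    exact ⟨fun ⟨ζ, h, h'⟩ => ⟨ζ, h', h⟩, fun ⟨ζ, h, h'⟩ => ⟨ζ, h', h⟩⟩

theorem run_right_unique {w : List (α × Bool)} {ξ η η' : Ξ} (h : 𝒜.run w ξ η)
    (h' : 𝒜.run w ξ η') : η = η' := by
  induction w generalizing ξ with
  | nil => exact h.symm.trans h'
  | cons c w ih =>
    obtain ⟨ζ, h1, h2⟩ := h
    obtain ⟨ζ', h1', h2'⟩ := h'
    obtain rfl := 𝒜.signedStep_right_unique h1 h1'
    exact ih h2 h2'

/-- A letter followed by its inverse leads back to the point of departure, since letters are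
injective where defined. The converse fails in general: the cancelled letters may be undefined
there. -/
theorem run_of_red {u v : List (α × Bool)} (h : FreeGroup.Red u v) {ξ η : Ξ}
    (hu : 𝒜.run u ξ η) : 𝒜.run v ξ η := by
  induction h with
  | refl => exact hu
  | tail _ hs ih =>
    obtain @⟨L₁, L₂, x, b⟩ := hs
    obtain ⟨ζ, h₁, ζ', h₂, ζ'', h₃, h₄⟩ := (𝒜.run_append _ _ _ _).1 ih
    rw [signedStep_not] at h₃
    have h₅ : ζ'' = ζ := by
      refine 𝒜.signedStep_right_unique (c := (x, !b)) ?_ ?_ (ξ := ζ')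
      · rwa [signedStep_not]
      · rwa [signedStep_not]
    subst h₅
    exact (𝒜.run_append _ _ _ _).2 ⟨_, h₁, h₄⟩

theorem run_reduce [DecidableEq α] {w : List (α × Bool)} {ξ η : Ξ} (h : 𝒜.run w ξ η) :
    𝒜.run (FreeGroup.reduce w) ξ η :=
  𝒜.run_of_red FreeGroup.reduce.red h

end PartialAction

/-! ### Words in letters and noise words -/

section Noise

variable {α σ : Type*} (N : σ → List α)

/-- Words in which letters and names of noise words (slots) stand next to each other. -/
abbrev BlockWord (α σ : Type*) := List ((α ⊕ σ) × Bool)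

/-- The word denoted by a letter or slot. -/
def blockWord : (α ⊕ σ) × Bool → List (α × Bool)
  | (.inl a, e) => [(a, e)]
  | (.inr s, true) => pos (N s)
  | (.inr s, false) => invRev (pos (N s))

/-- Substitution of the noise words for the slots. -/
def subst (w : BlockWord α σ) : List (α × Bool) := w.flatMap (blockWord N)

/-- Different noise words do not have a common initial or terminal segment of half the length. -/
structure SmallNoise : Prop where
  ne_nil : ∀ s, N s ≠ []
  prefix_lt : ∀ s s', s ≠ s' → ∀ π, π <+: N s → π <+: N s' → 2 * π.length < (N s).length
  suffix_lt : ∀ s s', s ≠ s' → ∀ π, π <:+ N s → π <:+ N s' → 2 * π.length < (N s).length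

/-- No cancellation between blocks, and slots are not adjacent to letters of the noise words. -/
def BlockRel (x y : (α ⊕ σ) × Bool) : Prop :=
  (x.1 = y.1 → x.2 = y.2) ∧ (∀ a s, x.1 = .inl a → y.1 = .inr s → a ∉ N s) ∧
    ∀ a s, x.1 = .inr s → y.1 = .inl a → a ∉ N s

/-- In a uniform partial action the letters of a noise word are defined at the same places. -/
def PartialAction.Uniform {Ξ : Type*} (𝒜 : PartialAction α Ξ) : Prop :=
  ∀ s, ∀ a ∈ N s, ∀ a' ∈ N s, ∀ e e' ξ η, 𝒜.signedStep (a, e) ξ η → ∃ ζ, 𝒜.signedStep (a', e') η ζ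

theorem mem_pos {l : List α} {c : α × Bool} : c ∈ pos l ↔ c.1 ∈ l ∧ c.2 = true := by
  obtain ⟨a, b⟩ := c
  simp [pos, eq_comm]

theorem mem_invRev_pos {l : List α} {c : α × Bool} :
    c ∈ invRev (pos l) ↔ c.1 ∈ l ∧ c.2 = false := by
  obtain ⟨a, b⟩ := c
  simp [pos, invRev, eq_comm]

theorem mem_blockWord_inr {s : σ} {e : Bool} {c : α × Bool} :
    c ∈ blockWord N (.inr s, e) ↔ c.1 ∈ N s ∧ c.2 = e := by
  cases e
  · exact mem_invRev_pos
  · exact mem_pos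

theorem isReduced_of_sign {w : List (α × Bool)} {e : Bool} (h : ∀ c ∈ w, c.2 = e) :
    IsReduced w := by
  refine (List.pairwise_of_forall_mem_list (r := fun a b : α × Bool => a.1 = b.1 → a.2 = b.2)
    fun a ha b hb _ => ?_).isChain
  rw [h a ha, h b hb]

theorem isReduced_blockWord (c : (α ⊕ σ) × Bool) : IsReduced (blockWord N c) := by
  obtain ⟨a | s, e⟩ := c
  · exact IsReduced.singleton
  · exact isReduced_of_sign fun c hc => ((mem_blockWord_inr N).1 hc).2

theorem subst_append (u v : BlockWord α σ) : subst N (u ++ v) = subst N u ++ subst N v := by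
  simp [subst]

theorem subst_singleton (c : (α ⊕ σ) × Bool) : subst N [c] = blockWord N c := by simp [subst]

theorem blockWord_not (x : α ⊕ σ) (e : Bool) :
    blockWord N (x, !e) = invRev (blockWord N (x, e)) := by
  cases x <;> cases e
  · rfl
  · rfl
  · exact (FreeGroup.invRev_invRev).symm
  · rfl

theorem subst_invRev (w : BlockWord α σ) : subst N (invRev w) = invRev (subst N w) := by
  induction w with
  | nil => rfl
  | cons c w ih =>
    rw [FreeGroup.invRev_cons, subst_append, ih, ← List.singleton_append (l := w), subst_append,
      FreeGroup.invRev_append, subst_singleton]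
    obtain ⟨x, e⟩ := c
    rw [← blockWord_not, ← subst_singleton]
    rfl

theorem invRev_singleton (a : α) (e : Bool) : invRev [(a, e)] = [(a, !e)] := rfl

/-- Cancel letter by letter at the junction; `κ` is the whole of what disappears from `A`. -/
theorem exists_cancel (A B : List (α × Bool)) (hA : IsReduced A) (hB : IsReduced B) :
    ∃ A₁ κ B₁, A = A₁ ++ κ ∧ B = invRev κ ++ B₁ ∧ IsReduced (A₁ ++ B₁) := by
  induction B generalizing A with
  | nil => exact ⟨A, [], [], by simp, by simp, by simpa⟩
  | cons c B ih =>
    rcases List.eq_nil_or_concat' A with rfl | ⟨A, d, rfl⟩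
    · exact ⟨[], [], c :: B, by simp, by simp, by simpa⟩
    by_cases h : d.1 = c.1 → d.2 = c.2
    · refine ⟨A ++ [d], [], c :: B, by simp, by simp, List.isChain_append.2 ⟨hA, hB, ?_⟩⟩
      simpa using h
    · obtain ⟨A₁, κ, B₁, rfl, rfl, h'⟩ := ih A (hA.infix (List.prefix_append _ _).isInfix)
        (hB.infix (List.suffix_cons _ _).isInfix)
      refine ⟨A₁, κ ++ [d], B₁, by simp, ?_, h'⟩
      obtain ⟨a, e⟩ := d
      obtain ⟨a', e'⟩ := c
      simp only [Classical.not_imp] at h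
      obtain ⟨rfl, h⟩ := h
      rw [FreeGroup.invRev_append, invRev_singleton]
      have : e' = !e := by cases e <;> cases e' <;> simp_all
      simp [this]

variable {N}

theorem invRev_eq_nil {w : List (α × Bool)} : invRev w = [] ↔ w = [] := by
  simp [invRev]

theorem prefix_invRev_iff {u v : List (α × Bool)} : invRev u <+: invRev v ↔ u <:+ v := by
  simp only [invRev, List.reverse_prefix]
  constructor
  · rintro ⟨t, ht⟩
    refine ⟨invRev (invRev (t.map fun g => (g.1, !g.2))), ?_⟩
    rw [FreeGroup.invRev_invRev]
    have := congrArg (List.map fun g : α × Bool => (g.1, !g.2)) ht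
    simpa [Function.comp_def] using this
  · rintro ⟨t, rfl⟩
    simp

theorem pos_prefix_iff {u : List (α × Bool)} {l : List α} :
    u <+: pos l ↔ ∃ m, u = pos m ∧ m <+: l := by
  constructor
  · intro h
    rw [List.prefix_iff_eq_take] at h
    refine ⟨l.take u.length, ?_, List.take_prefix _ _⟩
    rw [pos, List.map_take]; exact h
  · rintro ⟨m, rfl, h⟩
    exact h.map _

theorem pos_suffix_iff {u : List (α × Bool)} {l : List α} :
    u <:+ pos l ↔ ∃ m, u = pos m ∧ m <:+ l := by
  constructor
  · intro h
    rw [List.suffix_iff_eq_drop] at h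
    refine ⟨l.drop ((pos l).length - u.length), ?_, List.drop_suffix _ _⟩
    rw [pos, List.map_drop]; exact h
  · rintro ⟨m, rfl, h⟩
    exact h.map _

theorem pos_injective : Function.Injective (pos : List α → _) :=
  List.map_injective_iff.2 fun _ _ h => congrArg Prod.fst h

/-- Between admissible neighbours less than half of a block cancels. -/
theorem SmallNoise.cancel_lt (hN : SmallNoise N) {x y : (α ⊕ σ) × Bool} (h : BlockRel N x y)
    {κ : List (α × Bool)} (hx : κ <:+ blockWord N x) (hy : invRev κ <+: blockWord N y) :
    2 * κ.length < (blockWord N x).length ∧ 2 * κ.length < (blockWord N y).length := by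
  have hpos : ∀ z, 0 < (blockWord N z).length := by
    rintro ⟨a | s, e⟩
    · simp [blockWord]
    · have := List.length_pos_iff.2 (hN.ne_nil s)
      cases e <;> simpa [blockWord, pos]
  rcases List.eq_nil_or_concat' κ with rfl | ⟨κ', d, rfl⟩
  · simpa using ⟨hpos x, hpos y⟩
  have hdx : d ∈ blockWord N x := hx.subset (by simp)
  have hdy : (d.1, !d.2) ∈ blockWord N y := hy.subset (by simp [invRev])
  obtain ⟨h1, h2, h3⟩ := h
  obtain ⟨x | s, e⟩ := x <;> obtain ⟨y | s', e'⟩ := y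
  · simp only [blockWord, List.mem_singleton] at hdx hdy
    subst hdx
    simp only [Prod.mk.injEq] at hdy
    simp [hdy] at h1
    cases e' <;> simp_all
  · rw [mem_blockWord_inr] at hdy
    simp only [blockWord, List.mem_singleton] at hdx
    subst hdx
    exact (h2 x s' rfl rfl hdy.1).elim
  · rw [mem_blockWord_inr] at hdx
    simp only [blockWord, List.mem_singleton, Prod.mk.injEq] at hdy
    exact (h3 y s rfl rfl (hdy.1 ▸ hdx.1)).elim
  · rw [mem_blockWord_inr] at hdx hdy
    have hne : s ≠ s' := by
      rintro rfl
      have := h1 rfl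
      simp_all
    rcases hdx with ⟨-, hdx⟩
    rcases hdy with ⟨-, hdy⟩
    generalize κ' ++ [d] = κ at *
    -- Noise words are positive, so exactly one of the two blocks is inverted. If it is the left
    -- one, `κ⁻¹` is a common initial segment of two noise words, otherwise `κ` is a common terminal
    -- segment.
    cases e
    · obtain rfl : e' = true := by simpa [hdx] using hdy.symm
      simp only [blockWord] at hx hy ⊢
      rw [← FreeGroup.invRev_invRev (L₁ := κ), ← prefix_invRev_iff, FreeGroup.invRev_invRev,
        FreeGroup.invRev_invRev] at hx
      obtain ⟨m, hm, hm1⟩ := pos_prefix_iff.1 hx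
      obtain ⟨m', hm', hm2⟩ := pos_prefix_iff.1 hy
      obtain rfl := pos_injective (hm.symm.trans hm')
      have hl : κ.length = m.length := by
        rw [← FreeGroup.invRev_length, hm]; simp [pos]
      rw [hl, FreeGroup.invRev_length]
      simp only [pos, List.length_map]
      exact ⟨hN.prefix_lt s s' hne m hm1 hm2, hN.prefix_lt s' s hne.symm m hm2 hm1⟩
    · obtain rfl : e' = false := by simp [hdx] at hdy; exact hdy
      simp only [blockWord] at hx hy ⊢
      rw [prefix_invRev_iff] at hy
      obtain ⟨m, hm, hm1⟩ := pos_suffix_iff.1 hx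
      obtain ⟨m', hm', hm2⟩ := pos_suffix_iff.1 hy
      obtain rfl := pos_injective (hm.symm.trans hm')
      have hl : κ.length = m.length := by rw [hm]; simp [pos]
      rw [hl, FreeGroup.invRev_length]
      simp only [pos, List.length_map]
      exact ⟨hN.suffix_lt s s' hne m hm1 hm2, hN.suffix_lt s' s hne.symm m hm2 hm1⟩

/-- Once a letter of a noise word has been read, any of its letters, with either sign, can be read
next, and so on. Hence the need for a nonempty `u`. -/
theorem PartialAction.Uniform.exists_run {Ξ : Type*} {𝒜 : PartialAction α Ξ} (h𝒜 : 𝒜.Uniform N)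
    {s : σ} {u v : List (α × Bool)} (hu : ∀ c ∈ u, c.1 ∈ N s) (hv : ∀ c ∈ v, c.1 ∈ N s)
    (hne : u ≠ []) {ξ η : Ξ} (h : 𝒜.run u ξ η) : ∃ ζ, 𝒜.run v η ζ := by
  obtain ⟨u, c, rfl⟩ := (List.eq_nil_or_concat' u).resolve_left hne
  obtain ⟨ζ, -, h'⟩ := (𝒜.run_append _ _ _ _).1 h
  rw [𝒜.run_singleton] at h'
  clear h
  replace hu := hu c (by simp)
  clear hne
  induction v generalizing c ζ η with
  | nil => exact ⟨η, rfl⟩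
  | cons d v ih =>
    obtain ⟨θ, hθ⟩ : ∃ θ, 𝒜.signedStep d η θ := h𝒜 s c.1 hu d.1 (hv d (by simp)) c.2 d.2 _ _ h'
    obtain ⟨ω, hω⟩ := ih (hv := fun c hc => hv c (by simp [hc])) d η hθ (hv d (by simp))
    exact ⟨ω, θ, hθ, hω⟩

open Classical in
/-- After substitution more than half of the last block survives free reduction, and
the reduced word is read by a uniform partial action only together with the unreduced one. -/
theorem SmallNoise.reduce_subst (hN : SmallNoise N) (v : BlockWord α σ) (y : (α ⊕ σ) × Bool)
    (hw : (v ++ [y]).IsChain (BlockRel N)) :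
    ∃ τ S, FreeGroup.reduce (subst N (v ++ [y])) = τ ++ S ∧ S <:+ blockWord N y ∧
      (blockWord N y).length < 2 * S.length ∧
      ∀ (Ξ : Type) (𝒜 : PartialAction α Ξ), 𝒜.Uniform N → ∀ ξ η, 𝒜.run (τ ++ S) ξ η →
        𝒜.run (subst N (v ++ [y])) ξ η := by
  induction v using List.reverseRecOn generalizing y with
  | nil =>
    refine ⟨[], blockWord N y, ?_, List.suffix_rfl, ?_, ?_⟩
    · simp [subst_singleton, (isReduced_blockWord N y).reduce_eq]
    · obtain ⟨a | s, e⟩ := y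
      · simp [blockWord]
      · have := List.length_pos_iff.2 (hN.ne_nil s)
        cases e <;> simp [blockWord, pos] <;> omega
    · simp [subst_singleton]
  | append_singleton v x ih =>
    obtain ⟨τ, S, h1, h2, h3, h4⟩ := ih x (List.isChain_append.1 hw).1
    have hxy : BlockRel N x y := (List.isChain_append.1 hw).2.2 x (by simp) y (by simp)
    have hτS : IsReduced (τ ++ S) := by
      rw [← h1]; exact IsReduced.of_reduce_eq FreeGroup.reduce.idem
    obtain ⟨S₁, κ, B, hS, hB, hred⟩ := exists_cancel S (blockWord N y)
      (hτS.infix (List.suffix_append _ _).isInfix) (isReduced_blockWord N y)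
    have hκS : κ <:+ S := hS ▸ List.suffix_append _ _
    obtain ⟨hκx, hκy⟩ := hN.cancel_lt hxy (hκS.trans h2) (hB ▸ List.prefix_append _ _)
    have hlS : S.length = S₁.length + κ.length := by rw [hS, List.length_append]
    have hly : (blockWord N y).length = κ.length + B.length := by
      rw [hB, List.length_append, FreeGroup.invRev_length]
    -- `S` is more than half of the block `x`, and `κ` is less than half of it. A nonempty `S₁`
    -- separates `τ` from `B`, so the new word is reduced.
    have hS₁ : S₁ ≠ [] := by
      rintro rfl
      simp at hlS
      omega
    rw [hS, ← List.append_assoc] at hτS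
    refine ⟨τ ++ S₁, B, ?_, hB ▸ List.suffix_append _ _, by omega, ?_⟩
    · have hr : IsReduced (τ ++ S₁ ++ B) :=
        (hτS.infix (List.prefix_append _ _).isInfix).append_overlap hred hS₁
      rw [← hr.reduce_eq, ← FreeGroup.toWord_mk, ← FreeGroup.toWord_mk, subst_append]
      congr 1
      rw [← FreeGroup.mul_mk, ← FreeGroup.reduce.self (L := subst N (v ++ [x])), h1,
        subst_singleton, hB, hS]
      simp [← FreeGroup.mul_mk, ← FreeGroup.inv_mk, mul_assoc]
    · intro Ξ 𝒜 h𝒜 ξ η hrun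
      obtain ⟨ζ, hζ1, hζ2⟩ := (𝒜.run_append _ _ _ _).1 hrun
      -- The cancelled part is reinserted: letters of the same noise word, those of `S₁`, have been
      -- read just before.
      obtain ⟨θ, hθ⟩ : ∃ θ, 𝒜.run κ ζ θ := by
        rcases eq_or_ne κ [] with rfl | hκ
        · exact ⟨ζ, rfl⟩
        -- A letter is a block of length one, and less than half of it is empty.
        have : ∃ s e, x = (.inr s, e) := by
          obtain ⟨a | s, e⟩ := x
          · have : 0 < κ.length := List.length_pos_iff.2 hκ
            have h5 : (blockWord N (.inl a, e)).length = 1 := rfl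
            omega
          · exact ⟨s, e, rfl⟩
        obtain ⟨s, e, rfl⟩ := this
        obtain ⟨ω, -, hω⟩ := (𝒜.run_append _ _ _ _).1 hζ1
        have hsub : ∀ c ∈ S, c.1 ∈ N s := fun c hc =>
          ((mem_blockWord_inr N).1 (h2.subset hc)).1
        exact h𝒜.exists_run (fun c hc => hsub c (by simp [hS, hc]))
          (fun c hc => hsub c (by simp [hS, hc])) hS₁ hω
      rw [subst_append, 𝒜.run_append]
      refine ⟨θ, h4 Ξ 𝒜 h𝒜 _ _ ?_, ?_⟩
      · rw [hS, ← List.append_assoc, 𝒜.run_append]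
        exact ⟨ζ, hζ1, hθ⟩
      · rw [subst_singleton, hB, 𝒜.run_append]
        exact ⟨ζ, (𝒜.run_invRev _ _ _).2 hθ, hζ2⟩

/-- More than half of the last block survives reduction, hence something does. -/
theorem SmallNoise.mk_subst_ne_one (hN : SmallNoise N) {w : BlockWord α σ} (hne : w ≠ [])
    (hw : w.IsChain (BlockRel N)) : FreeGroup.mk (subst N w) ≠ 1 := by
  classical
  obtain ⟨v, y, rfl⟩ := (List.eq_nil_or_concat' w).resolve_left hne
  obtain ⟨τ, S, h1, h2, h3, -⟩ := hN.reduce_subst v y hw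
  intro h
  rw [← FreeGroup.toWord_eq_nil_iff, FreeGroup.toWord_mk, h1] at h
  simp at h
  simp [h.2] at h3

-- The converse of `PartialAction.run_reduce` for chains of blocks: under a uniform action,
-- cancelled noise can be put back.
open Classical in
theorem SmallNoise.run_subst (hN : SmallNoise N) {w : BlockWord α σ}
    (hw : w.IsChain (BlockRel N)) {Ξ : Type} {𝒜 : PartialAction α Ξ} (h𝒜 : 𝒜.Uniform N) {ξ η : Ξ}
    (h : 𝒜.run (FreeGroup.reduce (subst N w)) ξ η) : 𝒜.run (subst N w) ξ η := by
  rcases List.eq_nil_or_concat' w with rfl | ⟨v, y, rfl⟩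
  · simpa [subst] using h
  obtain ⟨τ, S, h1, -, -, h4⟩ := hN.reduce_subst v y hw
  exact h4 Ξ 𝒜 h𝒜 ξ η (h1 ▸ h)

/-! ### Families of block words without cancellation -/

variable {ι : Type*}

/-- The `i`-th word of a family, or its inverse. -/
def signedWord (W : ι → List (α × Bool)) (c : ι × Bool) : List (α × Bool) :=
  if c.2 then W c.1 else invRev (W c.1)

theorem mk_signedWord (W : ι → List (α × Bool)) (w : List (ι × Bool)) :
    FreeGroup.mk (w.flatMap (signedWord W)) =
      FreeGroup.lift (fun i => FreeGroup.mk (W i)) (FreeGroup.mk w) := by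
  induction w with
  | nil => simp [← FreeGroup.one_eq_mk]
  | cons c w ih =>
    rw [List.flatMap_cons, ← FreeGroup.mul_mk, ih, ← List.singleton_append, ← FreeGroup.mul_mk,
      map_mul, FreeGroup.lift_mk]
    obtain ⟨i, e⟩ := c
    cases e <;> simp [signedWord, FreeGroup.inv_mk]

variable (N) in
/-- There is no cancellation in products of the words of the family, or of their inverses. -/
structure NoCancel (W : ι → BlockWord α σ) (first last : ι → (α ⊕ σ) × Bool) : Prop where
  chain : ∀ i, (W i).IsChain (BlockRel N)
  head : ∀ i, (W i).head? = some (first i)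
  getLast : ∀ i, (W i).getLast? = some (last i)
  first_clean : ∀ i a, (first i).1 = .inl a → ∀ s, a ∉ N s
  last_clean : ∀ i a, (last i).1 = .inl a → ∀ s, a ∉ N s
  first_inj : ∀ i j, (first i).1 = (first j).1 → i = j
  last_inj : ∀ i j, (last i).1 = (last j).1 → i = j
  sign : ∀ i j, (last i).1 = (first j).1 → (last i).2 = (first j).2

theorem BlockRel.symm_not {x y : α ⊕ σ} {e f : Bool} (h : BlockRel N (x, e) (y, f)) :
    BlockRel N (y, !f) (x, !e) := by
  refine ⟨fun h' => ?_, fun a s h1 h2 => h.2.2 a s h2 h1, fun a s h1 h2 => h.2.1 a s h2 h1⟩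
  have := h.1 h'.symm
  simp at this ⊢
  rw [this]

theorem isChain_invRev {w : BlockWord α σ} (h : w.IsChain (BlockRel N)) :
    (invRev w).IsChain (BlockRel N) := by
  rw [invRev, List.isChain_reverse, List.isChain_map]
  exact h.imp fun x y hxy => hxy.symm_not

/-- At a junction of factors with equal signs, `sign` prevents cancellation. For opposite signs,
equal end blocks would force equal indices by `first_inj` or `last_inj`, against the reducedness of
`w`. -/
theorem NoCancel.isChain {W : ι → BlockWord α σ} {first last : ι → (α ⊕ σ) × Bool}
    (h : NoCancel N W first last) {w : List (ι × Bool)} (hw : IsReduced w) :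
    (w.flatMap (signedWord W)).IsChain (BlockRel N) := by
  have hclean : ∀ x y : (α ⊕ σ) × Bool, (∀ a, x.1 = .inl a → ∀ s, a ∉ N s) →
      (∀ a, y.1 = .inl a → ∀ s, a ∉ N s) → (x.1 = y.1 → x.2 = y.2) → BlockRel N x y :=
    fun x y hx hy hxy => ⟨hxy, fun a s h1 _ => hx a h1 s, fun a s _ h2 => hy a h2 s⟩
  have hhead : ∀ c, (signedWord W c).head? =
      some (if c.2 then first c.1 else ((last c.1).1, !(last c.1).2)) := by
    rintro ⟨i, _ | _⟩
    · simp [signedWord, invRev, h.getLast]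
    · simp [signedWord, h.head]
  have hlast : ∀ c, (signedWord W c).getLast? =
      some (if c.2 then last c.1 else ((first c.1).1, !(first c.1).2)) := by
    rintro ⟨i, _ | _⟩
    · simp [signedWord, invRev, h.head]
    · simp [signedWord, h.getLast]
  rw [List.flatMap, List.isChain_flatten]
  · constructor
    · simp only [List.mem_map]
      rintro l ⟨⟨i, e⟩, -, rfl⟩
      cases e
      · exact isChain_invRev (h.chain i)
      · exact h.chain i
    · rw [List.isChain_map]
      refine List.IsChain.imp ?_ hw
      rintro ⟨i, e⟩ ⟨j, f⟩ hij x hx y hy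
      rw [hlast] at hx
      rw [hhead] at hy
      simp only [Option.mem_some_iff] at hx hy
      subst hx hy
      cases e <;> cases f
      · refine hclean _ _ (h.first_clean i) (h.last_clean j) fun h' => ?_
        have := h.sign j i h'.symm
        simp_all
      · refine hclean _ _ (h.first_clean i) (h.first_clean j) fun h' => ?_
        have := hij (h.first_inj i j h')
        simp at this
      · refine hclean _ _ (h.last_clean i) (h.last_clean j) fun h' => ?_
        have := hij (h.last_inj i j h')
        simp at this
      · exact hclean _ _ (h.last_clean i) (h.first_clean j) fun h' => h.sign i j h'
  · simp only [List.mem_map, not_exists, not_and]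
    rintro c - hc
    have := hhead c
    simp [hc] at this

theorem subst_signedWord (W : ι → BlockWord α σ) (w : List (ι × Bool)) :
    subst N (w.flatMap (signedWord W)) = w.flatMap (signedWord fun i => subst N (W i)) := by
  induction w with
  | nil => rfl
  | cons c w ih =>
    rw [List.flatMap_cons, List.flatMap_cons, subst_append, ih]
    obtain ⟨i, e⟩ := c
    cases e <;> simp [signedWord, subst_invRev]

theorem NoCancel.injective {W : ι → BlockWord α σ} {first last : ι → (α ⊕ σ) × Bool}
    (h : NoCancel N W first last) (hN : SmallNoise N) :
    Function.Injective (FreeGroup.lift fun i => FreeGroup.mk (subst N (W i))) := by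
  classical
  rw [injective_iff_map_eq_one]
  intro v hv
  by_contra hne
  refine hN.mk_subst_ne_one ?_ (h.isChain (FreeGroup.isReduced_toWord (x := v))) ?_
  · rw [← FreeGroup.toWord_eq_nil_iff] at hne
    obtain ⟨c, w, hc⟩ := List.exists_cons_of_ne_nil hne
    rw [hc, List.flatMap_cons]
    have h1 := h.head c.1
    have h2 : W c.1 ≠ [] := by
      intro h3
      simp [h3] at h1
    obtain ⟨i, e⟩ := c
    cases e <;> simp [signedWord, invRev_eq_nil, h2]
  · rw [subst_signedWord, mk_signedWord, FreeGroup.mk_toWord, hv]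

-- This makes pinches tractable: an element of the subgroup is read through its reduced word, in
-- which the factors are no longer intact, and the reading is extended to the full product of the
-- factors.
open Classical in
theorem NoCancel.run {W : ι → BlockWord α σ} {first last : ι → (α ⊕ σ) × Bool}
    (h : NoCancel N W first last) (hN : SmallNoise N) {Ξ : Type} {𝒜 : PartialAction α Ξ}
    (h𝒜 : 𝒜.Uniform N) (v : FreeGroup ι) {ξ η : Ξ}
    (hrun : 𝒜.run (FreeGroup.lift (fun i => FreeGroup.mk (subst N (W i))) v).toWord ξ η) :
    ∃ w, FreeGroup.mk w = v ∧
      𝒜.run (w.flatMap (signedWord fun i => subst N (W i))) ξ η := by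
  refine ⟨v.toWord, FreeGroup.mk_toWord, ?_⟩
  have := h.isChain (FreeGroup.isReduced_toWord (x := v))
  rw [← subst_signedWord]
  refine hN.run_subst this h𝒜 ?_
  rw [← FreeGroup.toWord_mk, subst_signedWord, mk_signedWord, FreeGroup.mk_toWord]
  exact hrun

end Noise

/-! ### Reading words of an HNN-extension along a partial action -/

section Reading

variable {G : Type*} [Group G] {A B : Subgroup G} (φ : A ≃* B) {Ξ : Type*}

/-- `Reach φ Rd T x ξ η`: some product of elements of `G` and of letters `t`, `t⁻¹` with value `x`
leads from `ξ` to `η`, where elements of `G` act by `Rd`, and `t` by `T`. -/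
inductive Reach (Rd : G → Ξ → Ξ → Prop) (T : Ξ → Ξ → Prop) :
    HNNExtension G A B φ → Ξ → Ξ → Prop
  | of {g ξ η} : Rd g ξ η → Reach Rd T (HNNExtension.of g) ξ η
  | t {ξ η} : T ξ η → Reach Rd T HNNExtension.t ξ η
  | t_inv {ξ η} : T ξ η → Reach Rd T HNNExtension.t⁻¹ η ξ
  | mul {x y ξ η ζ} : Reach Rd T x ξ η → Reach Rd T y η ζ → Reach Rd T (x * y) ξ ζ

/-- A partial action of the elements of `G` that is compatible with the HNN-extension. -/
structure Readable (Rd : G → Ξ → Ξ → Prop) (T : Ξ → Ξ → Prop) : Prop where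
  one_iff : ∀ ξ η, Rd 1 ξ η ↔ ξ = η
  mul : ∀ g h ξ η ζ, Rd g ξ η → Rd h η ζ → Rd (g * h) ξ ζ
  pinch : ∀ (a : A) ξ η ξ' η', T ξ η → Rd a η η' → T ξ' η' → Rd (φ a) ξ ξ'
  pinch_symm : ∀ (b : B) ξ η ξ' η', T ξ η → Rd b ξ ξ' → T ξ' η' → Rd (φ.symm b) η η'

variable {φ}

/-- The graph of a power `t ^ u`, `u = ± 1`. -/
def unitStep (T : Ξ → Ξ → Prop) (u : ℤˣ) (ξ η : Ξ) : Prop := if u = 1 then T ξ η else T η ξ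

/-- The graph of a word in normal form. -/
def syllableRun (Rd : G → Ξ → Ξ → Prop) (T : Ξ → Ξ → Prop) :
    G → List (ℤˣ × G) → Ξ → Ξ → Prop
  | g, [], ξ, η => Rd g ξ η
  | g, (u, h) :: L, ξ, η => ∃ ζ ζ', Rd g ξ ζ ∧ unitStep T u ζ ζ' ∧ syllableRun Rd T h L ζ' η

variable (φ) in
/-- The product of a word in normal form. -/
def syllableProd : G → List (ℤˣ × G) → HNNExtension G A B φ
  | g, [] => HNNExtension.of g
  | g, (u, h) :: L => HNNExtension.of g * (HNNExtension.t ^ (u : ℤ) * syllableProd h L)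

variable {Rd : G → Ξ → Ξ → Prop} {T : Ξ → Ξ → Prop}

theorem syllableProd_mul (g h : G) (L : List (ℤˣ × G)) :
    syllableProd φ (g * h) L = HNNExtension.of g * syllableProd φ h L := by
  cases L <;> simp [syllableProd, mul_assoc]

theorem syllableProd_eq (g : G) (L : List (ℤˣ × G)) : syllableProd φ g L = HNNExtension.of g *
    (L.map fun x => (HNNExtension.t ^ (x.1 : ℤ) * HNNExtension.of x.2)).prod := by
  induction L generalizing g with
  | nil => simp [syllableProd]
  | cons c L ih => simp [syllableProd, ih, mul_assoc]

theorem Readable.syllableRun_mul (h : Readable φ Rd T) {g k : G} {L : List (ℤˣ × G)} {ξ η ζ : Ξ}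
    (h1 : Rd g ξ η) (h2 : syllableRun Rd T k L η ζ) : syllableRun Rd T (g * k) L ξ ζ := by
  cases L with
  | nil => exact h.mul _ _ _ _ _ h1 h2
  | cons c L =>
    obtain ⟨θ, θ', h3, h4⟩ := h2
    exact ⟨θ, θ', h.mul _ _ _ _ _ h1 h3, h4⟩

theorem Readable.exists_syllableRun_append (h : Readable φ Rd T) {g g' : G}
    {L L' : List (ℤˣ × G)} {ξ η ζ : Ξ} (h1 : syllableRun Rd T g L ξ η)
    (h2 : syllableRun Rd T g' L' η ζ) : ∃ k M, syllableRun Rd T k M ξ ζ ∧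
      syllableProd φ k M = syllableProd φ g L * syllableProd φ g' L' := by
  induction L generalizing g ξ with
  | nil => exact ⟨g * g', L', h.syllableRun_mul h1 h2, syllableProd_mul _ _ _⟩
  | cons c L ih =>
    obtain ⟨θ, θ', h3, h4, h5⟩ := h1
    obtain ⟨k, M, h6, h7⟩ := ih h5
    exact ⟨g, (c.1, k) :: M, ⟨θ, θ', h3, h4, h6⟩, by simp [syllableProd, h7, mul_assoc]⟩

/-- Concatenation merges neighbouring elements of the vertex group; the resulting word need not be
reduced. -/
theorem Readable.exists_syllableRun (h : Readable φ Rd T) {x : HNNExtension G A B φ} {ξ η : Ξ}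
    (hx : Reach φ Rd T x ξ η) : ∃ g L, syllableRun Rd T g L ξ η ∧ syllableProd φ g L = x := by
  induction hx with
  | @of g ξ η hg => exact ⟨g, [], hg, rfl⟩
  | @t ξ η ht =>
    exact ⟨1, [(1, 1)], ⟨ξ, η, (h.one_iff _ _).2 rfl, by simpa [unitStep], (h.one_iff _ _).2 rfl⟩,
      by simp [syllableProd]⟩
  | @t_inv ξ η ht =>
    exact ⟨1, [(-1, 1)], ⟨η, ξ, (h.one_iff _ _).2 rfl, by simpa [unitStep],
      (h.one_iff _ _).2 rfl⟩, by simp [syllableProd]⟩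
  | mul _ _ ih1 ih2 =>
    obtain ⟨g, L, h1, rfl⟩ := ih1
    obtain ⟨g', L', h2, rfl⟩ := ih2
    exact h.exists_syllableRun_append h1 h2

/-- An unreduced word contains some `t a t⁻¹` or `t⁻¹ b t`. Replacing it by its value in the vertex
group removes two stable letters, and `pinch` or `pinch_symm` keeps the endpoints. -/
theorem Readable.exists_pinch (h : Readable φ Rd T) {g : G} {L : List (ℤˣ × G)} {ξ η : Ξ}
    (h1 : syllableRun Rd T g L ξ η)
    (hL : ¬ L.IsChain fun a b => a.2 ∈ HNNExtension.toSubgroup A B a.1 → a.1 = b.1) :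
    ∃ g' L', L'.length < L.length ∧ syllableRun Rd T g' L' ξ η ∧
      syllableProd φ g' L' = syllableProd φ g L := by
  induction L generalizing g ξ with
  | nil => simp at hL
  | cons c L ih =>
    obtain ⟨u, k⟩ := c
    obtain ⟨θ, θ', h2, h3, h4⟩ := h1
    by_cases hL' : L.IsChain fun a b => a.2 ∈ HNNExtension.toSubgroup A B a.1 → a.1 = b.1
    · cases L with
      | nil => simp at hL
      | cons d L =>
        obtain ⟨v, l⟩ := d
        obtain ⟨ω, ω', h5, h6, h7⟩ := h4
        simp only [List.isChain_cons_cons, hL', and_true, Classical.not_imp] at hL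
        obtain ⟨hk, huv⟩ := hL
        rcases Int.units_eq_one_or u with rfl | rfl
        · obtain rfl : v = -1 := (Int.units_eq_one_or v).resolve_left (Ne.symm huv)
          simp only [unitStep, if_true, if_neg (show (-1 : ℤˣ) ≠ 1 by decide)] at h3 h6
          have h8 := h.pinch ⟨k, hk⟩ _ _ _ _ h3 h5 h6
          refine ⟨g * (φ ⟨k, hk⟩ * l), L, by simp,
            h.syllableRun_mul h2 (h.syllableRun_mul h8 h7), ?_⟩
          have := HNNExtension.equiv_eq_conj (φ := φ) ⟨k, hk⟩
          rw [syllableProd_mul, syllableProd_mul, this]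
          simp [syllableProd, mul_assoc]
        · obtain rfl : v = 1 := (Int.units_eq_one_or v).resolve_right (Ne.symm huv)
          simp only [unitStep, if_true, if_neg (show (-1 : ℤˣ) ≠ 1 by decide)] at h3 h6
          have h8 := h.pinch_symm ⟨k, hk⟩ _ _ _ _ h3 h5 h6
          refine ⟨g * (φ.symm ⟨k, hk⟩ * l), L, by simp,
            h.syllableRun_mul h2 (h.syllableRun_mul h8 h7), ?_⟩
          have := HNNExtension.equiv_symm_eq_conj (φ := φ) ⟨k, hk⟩
          rw [syllableProd_mul, syllableProd_mul, this]
          simp [syllableProd, mul_assoc]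
    · obtain ⟨g', L', h5, h6, h7⟩ := ih h4 hL'
      exact ⟨g, (u, g') :: L', by simpa using h5, ⟨θ, θ', h2, h3, h6⟩, by
        simp [syllableProd, h7]⟩

/-- Remove pinches until the word is reduced. By Britton's lemma only an element of the vertex group
remains, and it is `1` because the vertex group embeds. -/
theorem Readable.eq_of_syllableProd_eq_one (h : Readable φ Rd T) {g : G} {L : List (ℤˣ × G)}
    {ξ η : Ξ} (h1 : syllableRun Rd T g L ξ η) (h2 : syllableProd φ g L = 1) : ξ = η := by
  induction hn : L.length using Nat.strong_induction_on generalizing g L with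
  | _ n ih =>
    subst hn
    by_cases hL : L.IsChain fun a b => a.2 ∈ HNNExtension.toSubgroup A B a.1 → a.1 = b.1
    · have := HNNExtension.ReducedWord.toList_eq_nil_of_mem_of_range φ
        (⟨g, L, hL⟩ : HNNExtension.NormalWord.ReducedWord G A B)
        ⟨1, by rw [map_one, ← h2, syllableProd_eq]; rfl⟩
      simp only at this
      subst this
      have hg : g = 1 := HNNExtension.of_injective (φ := φ) (by simpa [syllableProd] using h2)
      subst hg
      exact (h.one_iff _ _).1 h1
    · obtain ⟨g', L', h3, h4, h5⟩ := h.exists_pinch h1 hL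
      exact ih _ h3 h4 (h5.trans h2) rfl

/-- **Britton's lemma** for words that can be read along a partial action. -/
theorem Readable.eq_of_reach_one (h : Readable φ Rd T) {ξ η : Ξ} (h1 : Reach φ Rd T 1 ξ η) :
    ξ = η := by
  obtain ⟨g, L, h2, h3⟩ := h.exists_syllableRun h1
  exact h.eq_of_syllableProd_eq_one h2 h3

end Reading

/-! ### Free generation -/

section FreeGeneration

variable {G : Type*} [Group G]

theorem range_lift_eq_gen {n : ℕ} (g : Fin n → G) : (FreeGroup.lift g).range = gen g :=
  FreeGroup.range_lift_eq_closure

/-- The isomorphism between the subgroups generated by two families which freely generate. -/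
noncomputable def closureEquiv {ι : Type*} {g h : ι → G}
    (hg : Function.Injective (FreeGroup.lift g)) (hh : Function.Injective (FreeGroup.lift h)) :
    (FreeGroup.lift g).range ≃* (FreeGroup.lift h).range :=
  (MonoidHom.ofInjective hg).symm.trans (MonoidHom.ofInjective hh)

theorem closureEquiv_apply {ι : Type*} {g h : ι → G}
    (hg : Function.Injective (FreeGroup.lift g)) (hh : Function.Injective (FreeGroup.lift h))
    (v : FreeGroup ι) (x : (FreeGroup.lift g).range) (hx : (x : G) = FreeGroup.lift g v) :
    (closureEquiv hg hh x : G) = FreeGroup.lift h v := by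
  obtain rfl : x = MonoidHom.ofInjective hg v := Subtype.ext hx
  simp only [closureEquiv, MulEquiv.trans_apply, MulEquiv.symm_apply_apply]
  exact MonoidHom.ofInjective_apply hh

theorem closureEquiv_symm {ι : Type*} {g h : ι → G}
    (hg : Function.Injective (FreeGroup.lift g)) (hh : Function.Injective (FreeGroup.lift h)) :
    (closureEquiv hg hh).symm = closureEquiv hh hg := rfl

theorem FreelyGenerate.of_comp {G' : Type*} [Group G'] {n : ℕ} {g : Fin n → G} (f : G →* G')
    (h : FreelyGenerate fun k => f (g k)) : FreelyGenerate g := by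
  have : FreeGroup.lift (fun k => f (g k)) = f.comp (FreeGroup.lift g) := by
    ext; simp
  unfold FreelyGenerate at h
  rw [this, MonoidHom.coe_comp] at h
  exact h.of_comp

theorem FreelyGenerate.map {G' : Type*} [Group G'] {n : ℕ} {g : Fin n → G} {f : G →* G'}
    (hf : Function.Injective f) (h : FreelyGenerate g) : FreelyGenerate fun k => f (g k) := by
  have : FreeGroup.lift (fun k => f (g k)) = f.comp (FreeGroup.lift g) := by
    ext; simp
  unfold FreelyGenerate at h ⊢
  rw [this, MonoidHom.coe_comp]
  exact hf.comp h

theorem FreelyGenerate.exists_mulEquiv {n : ℕ} {g h : Fin n → G} (hg : FreelyGenerate g)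
    (hh : FreelyGenerate h) : ∃ φ : gen g ≃* gen h, ∀ k, φ (genElt g k) = genElt h k := by
  refine ⟨((MulEquiv.subgroupCongr (range_lift_eq_gen g)).symm.trans
    (closureEquiv hg hh)).trans (MulEquiv.subgroupCongr (range_lift_eq_gen h)), fun k => ?_⟩
  apply Subtype.ext
  exact (closureEquiv_apply hg hh (FreeGroup.of k) _ (by simp; rfl)).trans (by simp [genElt])

theorem FreelyGenerate.nonempty_mulEquiv {n : ℕ} {g : Fin n → G} (hg : FreelyGenerate g) :
    Nonempty (gen g ≃* FreeGroup (Fin n)) :=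
  ⟨((MonoidHom.ofInjective hg).trans (MulEquiv.subgroupCongr (range_lift_eq_gen g))).symm⟩

/-- Two families which freely generate become conjugate in a larger group. -/
theorem FreelyGenerate.exists_conj {G : Type} [Group G] {n : ℕ} {g h : Fin n → G}
    (hg : FreelyGenerate g) (hh : FreelyGenerate h) :
    ∃ (G' : Type) (_ : Group G') (f : G →* G') (s : G'), Function.Injective f ∧
      ∀ k, s⁻¹ * f (g k) * s = f (h k) := by
  obtain ⟨φ, hφ⟩ := hh.exists_mulEquiv hg
  refine ⟨HNNExtension G (gen h) (gen g) φ, inferInstance, HNNExtension.of, HNNExtension.t,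
    HNNExtension.of_injective φ, fun k => ?_⟩
  have := HNNExtension.equiv_eq_conj (φ := φ) (genElt h k)
  rw [hφ] at this
  change HNNExtension.of (g k) = _ * HNNExtension.of (h k) * _ at this
  rw [this]
  group

end FreeGeneration

/-! ### The words in the relators -/

section Concrete

variable {p : ℕ}

/-- The places where Rips words stand. -/
abbrev Slot (p : ℕ) := {c : Rel p × Fin 3 // c.1.IsSlot c.2}

/-- The first Rips word of a relator. -/
def slotFirst (ρ : Rel p) : Slot p := ⟨(ρ, 0), fun _ => show (0 : Fin 3) ≠ 1 by decide⟩

/-- The second Rips word of a relator with three of them. -/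
def slotMiddle (ρ : Rel p) (h : ¬ ρ.IsT = true) : Slot p := ⟨(ρ, 1), fun h' => (h h').elim⟩

/-- The last Rips word of a relator. -/
def slotLast (ρ : Rel p) : Slot p := ⟨(ρ, 2), fun _ => show (2 : Fin 3) ≠ 1 by decide⟩

/-- The letters of the Rips word at a place. -/
def RipsWords.noiseList (R : RipsWords p) (s : Slot p) : List Letter :=
  ripsSubword s.1.1.noiseLetters (R.start s.1.1 s.1.2) (R.len s.1.1 s.1.2)

theorem le_length_ripsPrefix {α : Type*} (c : Fin 2 → α) (N : ℕ) :
    N ≤ (ripsPrefix c N).length := by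
  induction N with
  | zero => simp
  | succ N ih =>
    rw [ripsPrefix, List.range_succ, List.flatMap_append, List.length_append]
    change _ ≤ (ripsPrefix c N).length + _
    simp
    omega

theorem length_ripsSubword {α : Type*} (c : Fin 2 → α) (start len : ℕ) :
    (ripsSubword c start len).length = len := by
  have := le_length_ripsPrefix c (start + len)
  simp [ripsSubword]
  omega

theorem mem_ripsSubword {α : Type*} {c : Fin 2 → α} {start len : ℕ} {a : α}
    (h : a ∈ ripsSubword c start len) : ∃ k, a = c k := by
  have h1 := List.mem_of_mem_drop (List.mem_of_mem_take h)
  simp only [ripsPrefix, List.mem_flatMap, List.mem_cons, List.mem_replicate] at h1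
  obtain ⟨m, -, rfl | ⟨-, rfl⟩⟩ := h1
  · exact ⟨0, rfl⟩
  · exact ⟨1, rfl⟩

theorem noiseLetters_apply (ρ : Rel p) (k : Fin 2) :
    ρ.noiseLetters k = if ρ.IsX then .x k else .y k := by
  unfold Rel.noiseLetters
  split <;> rfl

theorem RipsWords.mem_noiseList {R : RipsWords p} {s : Slot p} {l : Letter}
    (h : l ∈ R.noiseList s) : ∃ k, l = if s.1.1.IsX then .x k else .y k := by
  obtain ⟨k, rfl⟩ := mem_ripsSubword h
  exact ⟨k, noiseLetters_apply _ _⟩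

variable {q : ℕ} {R : RipsWords p}

/-- A common initial segment of two distinct Rips words is a piece for `𝒳 ∪ 𝒴`, and common terminal
segments become initial ones on passing to inverses. The condition `C'(1/4)` bounds them even by a
quarter. -/
theorem RipsWords.Admissible.smallNoise (hR : R.Admissible q) : SmallNoise R.noiseList := by
  have hword : ∀ s : Slot p, pos (R.noiseList s) ∈ R.words := fun s => ⟨s.1.1, s.1.2, s.2, rfl⟩
  have hne : ∀ s s' : Slot p, s ≠ s' → pos (R.noiseList s) ≠ pos (R.noiseList s') :=
    fun s s' h h' => h (Subtype.ext (hR.distinct _ _ _ _ s.2 s'.2 h'))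
  have hlen : ∀ s : Slot p, (pos (R.noiseList s)).length = (R.noiseList s).length :=
    fun s => List.length_map _
  refine ⟨fun s h => ?_, fun s s' hs π h h' => ?_, fun s s' hs π h h' => ?_⟩
  · have h1 := hR.long _ _ s.2
    have h2 := length_ripsSubword s.1.1.noiseLetters (R.start s.1.1 s.1.2) (R.len s.1.1 s.1.2)
    rw [RipsWords.noiseList] at h
    simp [h] at h2
    omega
  · have h1 : pos π <+: pos (R.noiseList s) := h.map _
    have h2 : pos π <+: pos (R.noiseList s') := h'.map _
    have := hR.words_C' (pos π) ⟨_, ⟨_, hword s, .inl (List.IsRotated.refl _)⟩, _,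
      ⟨_, hword s', .inl (List.IsRotated.refl _)⟩, hne s s' hs, h1, h2⟩ _
      ⟨_, hword s, .inl (List.IsRotated.refl _)⟩ h1.isInfix
    rw [hlen] at this
    simp [pos] at this
    omega
  · have h1 : pos π <:+ pos (R.noiseList s) := h.map _
    have h2 : pos π <:+ pos (R.noiseList s') := h'.map _
    rw [← prefix_invRev_iff] at h1 h2
    have := hR.words_C' (invRev (pos π)) ⟨_, ⟨_, hword s, .inr (List.IsRotated.refl _)⟩, _,
      ⟨_, hword s', .inr (List.IsRotated.refl _)⟩,
      fun h => hne s s' hs (FreeGroup.invRev_injective h), h1, h2⟩ _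
      ⟨_, hword s, .inr (List.IsRotated.refl _)⟩ h1.isInfix
    rw [FreeGroup.invRev_length, FreeGroup.invRev_length, hlen] at this
    simp [pos] at this
    omega

/-- Words are block words without slots. -/
def ofWord (w : Word) : BlockWord Letter (Slot p) := w.map fun c => (.inl c.1, c.2)

theorem subst_ofWord (w : Word) : subst R.noiseList (ofWord w) = w := by
  induction w with
  | nil => rfl
  | cons c w ih =>
    have : ofWord (p := p) (c :: w) = [(.inl c.1, c.2)] ++ ofWord w := rfl
    rw [this, subst_append, ih, subst_singleton]
    rfl

theorem blockWord_slot (s : Slot p) : blockWord R.noiseList (.inr s, true) = R.word s.1.1 s.1.2 :=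
  rfl

theorem blockWord_slot_false (s : Slot p) :
    blockWord R.noiseList (.inr s, false) = invRev (R.word s.1.1 s.1.2) := rfl

/-- The terminal word of a relator as a block word. -/
def terminalBlocks (q : ℕ) (ρ : Rel p) : BlockWord Letter (Slot p) :=
  ofWord (ρ.head q) ++ if h : ρ.IsT = true then
    [(.inr (slotFirst ρ), true), (.inl .t, true), (.inr (slotLast ρ), true)]
  else [(.inr (slotFirst ρ), true), (.inl .t, false), (.inr (slotMiddle ρ h), true),
    (.inl .t, true), (.inr (slotLast ρ), true)]

theorem subst_terminalBlocks (ρ : Rel p) :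
    subst R.noiseList (terminalBlocks q ρ) = R.terminal q ρ := by
  rw [terminalBlocks, subst_append, subst_ofWord, RipsWords.terminal, RipsWords.noise]
  split
  · simp [subst, blockWord_slot, slotFirst, slotLast]; rfl
  · simp [subst, blockWord_slot, slotFirst, slotLast, slotMiddle]; rfl

/-- The relator `s⁻¹ u s v⁻¹` says that `t` conjugates one of two words to the other one; up to
the letter `s`, for relators with initial word `t`, this is the one on the right-hand side. -/
def outerBlocks (ρ : Rel p) : BlockWord Letter (Slot p) :=
  if h : ρ.IsT = true then [(.inr (slotFirst ρ), true)] else [(.inr (slotMiddle ρ h), true)]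

/-- The left-hand side of the relation `t v t⁻¹ = u`, up to the letter `s`, for relators with
initial word `t`. -/
def innerBlocks (q : ℕ) (ρ : Rel p) : BlockWord Letter (Slot p) :=
  if ρ.IsT = true then [(.inr (slotLast ρ), false)] else
    [(.inr (slotFirst ρ), false)] ++ ofWord (invRev (ρ.head q) ++
      ((ρ.stable, false) :: (ρ.initial ++ [(ρ.stable, true)]))) ++ [(.inr (slotLast ρ), false)]

/-- Families of words, one for each relator, that begin and end with slots of the relator. -/
structure Central (R : RipsWords p) (C : Rel p → BlockWord Letter (Slot p))
    (f l : Rel p → Slot p × Bool) : Prop where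
  chain : ∀ ρ, (C ρ).IsChain (BlockRel R.noiseList)
  head : ∀ ρ, (C ρ).head? = some (.inr (f ρ).1, (f ρ).2)
  getLast : ∀ ρ, (C ρ).getLast? = some (.inr (l ρ).1, (l ρ).2)
  first_rel : ∀ ρ, (f ρ).1.1.1 = ρ
  last_rel : ∀ ρ, (l ρ).1.1.1 = ρ
  sign : ∀ ρ, (l ρ).1 = (f ρ).1 → (l ρ).2 = (f ρ).2

/-- Letters not occurring in Rips words. -/
def Letter.Clean (l : Letter) : Prop := ∀ k, l ≠ Letter.x k ∧ l ≠ Letter.y k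

theorem Letter.Clean.notMem {l : Letter} (h : l.Clean) (s : Slot p) : l ∉ R.noiseList s := by
  intro hl
  obtain ⟨k, hk⟩ := RipsWords.mem_noiseList hl
  split at hk
  · exact (h k).1 hk
  · exact (h k).2 hk

theorem Rel.clean_stable (ρ : Rel p) : ρ.stable.Clean := by
  intro k
  cases ρ <;> simp [Rel.stable]

theorem central_outer : Central R outerBlocks
    (fun ρ => (if h : ρ.IsT = true then slotFirst ρ else slotMiddle ρ h, true))
    (fun ρ => (if h : ρ.IsT = true then slotFirst ρ else slotMiddle ρ h, true)) := by
  refine ⟨fun ρ => ?_, fun ρ => ?_, fun ρ => ?_, fun ρ => ?_, fun ρ => ?_, fun ρ _ => rfl⟩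
  all_goals
    by_cases h : ρ.IsT = true <;> simp [outerBlocks, h, slotFirst, slotMiddle]

theorem blockRel_inl {a b : Letter} {e f : Bool} (h : a = b → e = f) :
    BlockRel R.noiseList (.inl a, e) (.inl b, f) :=
  ⟨fun h' => h (Sum.inl_injective h'), by simp, by simp⟩

theorem blockRel_inl_inr {a : Letter} (ha : a.Clean) (s : Slot p) {e f : Bool} :
    BlockRel R.noiseList (.inl a, e) (.inr s, f) := by
  refine ⟨by simp, ?_, by simp⟩
  rintro _ s' h -
  obtain rfl := Sum.inl_injective h
  exact ha.notMem s'

theorem blockRel_inr_inl {a : Letter} (ha : a.Clean) (s : Slot p) {e f : Bool} :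
    BlockRel R.noiseList (.inr s, e) (.inl a, f) := by
  refine ⟨by simp, by simp, ?_⟩
  rintro _ s' - h
  obtain rfl := Sum.inl_injective h
  exact ha.notMem s'

/-- Both end slots are inverted, so their signs agree also when they coincide, as they do for the
initial word `t`. Otherwise `h⁻¹s⁻¹us` stands between them; it is reduced, and its outermost letters
do not occur in Rips words. -/
theorem central_inner (q : ℕ) : Central R (innerBlocks q)
    (fun ρ => (if ρ.IsT = true then slotLast ρ else slotFirst ρ, false))
    (fun ρ => (slotLast ρ, false)) := by
  refine ⟨fun ρ => ?_, fun ρ => ?_, fun ρ => ?_, fun ρ => ?_, fun ρ => rfl, fun ρ _ => rfl⟩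
  · have ha : ∀ i, (Letter.a i).Clean := fun i k => by simp
    have hb : ∀ j, (Letter.b j).Clean := fun j k => by simp
    cases ρ with
    | r1 j =>
      by_cases h1 : (j : ℕ) = p
      · by_cases h2 : p + 1 = q <;>
          simp [innerBlocks, Rel.IsT, Rel.head, Rel.initial, Rel.stable, ofWord, pos, h1, h2,
            invRev, blockRel_inl, blockRel_inl_inr, blockRel_inr_inl, ha, hb]
      · by_cases h2 : (j : ℕ) + 1 = q <;>
          simp [innerBlocks, Rel.IsT, Rel.head, Rel.initial, Rel.stable, ofWord, pos, h1, h2,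
            invRev, blockRel_inl, blockRel_inl_inr, blockRel_inr_inl, ha, hb]
    | r2 j =>
      simp [innerBlocks, Rel.IsT, Rel.head, Rel.initial, Rel.stable, ofWord, pos, invRev,
          blockRel_inl, blockRel_inl_inr, blockRel_inr_inl, ha, hb]
    | r3t j => simp [innerBlocks, Rel.IsT]
    | r3x j k =>
      simp [innerBlocks, Rel.IsT, Rel.head, Rel.initial, Rel.stable, ofWord, pos, invRev,
          blockRel_inl, blockRel_inl_inr, blockRel_inr_inl, hb]
    | r4t i => simp [innerBlocks, Rel.IsT]
    | r4y i k =>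
      simp [innerBlocks, Rel.IsT, Rel.head, Rel.initial, Rel.stable, ofWord, pos, invRev,
          blockRel_inl, blockRel_inl_inr, blockRel_inr_inl, ha]
  · by_cases h : ρ.IsT = true <;> simp [innerBlocks, h]
  · unfold innerBlocks
    split
    · rfl
    · exact List.getLast?_concat
  · by_cases h : ρ.IsT = true <;> simp [h, slotLast, slotFirst]

/-- The words are completed by the letter `s`, for relators with initial word `t`. -/
def withStable (C : Rel p → BlockWord Letter (Slot p)) (ρ : Rel p) : BlockWord Letter (Slot p) :=
  if ρ.IsT = true then (.inl ρ.stable, true) :: C ρ else C ρ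

theorem Rel.eq_of_stable_eq {ρ ρ' : Rel p} (h : ρ.IsT = true) (h' : ρ'.IsT = true)
    (hs : ρ.stable = ρ'.stable) : ρ = ρ' := by
  cases ρ <;> cases ρ' <;> simp_all [Rel.IsT, Rel.stable, Fin.ext_iff]

variable {C : Rel p → BlockWord Letter (Slot p)} {f l : Rel p → Slot p × Bool}

/-- A slot at the end of a word names its relator. A prefixed letter `s` does so too, since each
letter conjugates `t` in only one relation. -/
theorem Central.noCancel_withStable (h : Central R C f l) :
    NoCancel R.noiseList (withStable C)
      (fun ρ => if ρ.IsT = true then (.inl ρ.stable, true) else (.inr (f ρ).1, (f ρ).2))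
      (fun ρ => (.inr (l ρ).1, (l ρ).2)) := by
  have hinj : ∀ (g g' : Rel p → Slot p × Bool), (∀ ρ, (g ρ).1.1.1 = ρ) → (∀ ρ, (g' ρ).1.1.1 = ρ) →
      ∀ ρ ρ', (g ρ).1 = (g' ρ').1 → ρ = ρ' := fun g g' hg hg' ρ ρ' h => by
    rw [← hg ρ, ← hg' ρ', h]
  refine ⟨fun ρ => ?_, fun ρ => ?_, fun ρ => ?_, fun ρ a => ?_, fun ρ a => ?_, fun ρ ρ' => ?_,
    fun ρ ρ' hρ => hinj l l h.last_rel h.last_rel ρ ρ' (by simpa using hρ), fun ρ ρ' => ?_⟩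
  · unfold withStable
    split
    · refine List.isChain_cons.2 ⟨fun y hy => ?_, h.chain ρ⟩
      rw [h.head] at hy
      obtain rfl := Option.mem_some_iff.1 hy
      exact blockRel_inl_inr ρ.clean_stable _
    · exact h.chain ρ
  · unfold withStable
    split
    · rfl
    · exact h.head ρ
  · unfold withStable
    split
    · rw [List.getLast?_cons, h.getLast]
      rfl
    · exact h.getLast ρ
  · split
    · intro ha
      obtain rfl := Sum.inl_injective ha
      exact ρ.clean_stable.notMem
    · simp
  · simp
  · by_cases h1 : ρ.IsT = true <;> by_cases h2 : ρ'.IsT = true <;>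
      simp only [h1, h2, if_true, Bool.false_eq_true, if_false]
    · exact fun h3 => Rel.eq_of_stable_eq h1 h2 (Sum.inl_injective h3)
    · simp
    · simp
    · exact fun h3 => hinj f f h.first_rel h.first_rel ρ ρ' (by simpa using h3)
  · split
    · simp
    · intro h3
      have h4 : (l ρ).1 = (f ρ').1 := by simpa using h3
      obtain rfl := hinj l f h.last_rel h.first_rel ρ ρ' h4
      exact h.sign ρ h4

/-! ### A common basis for the `b₀`-row and the associated subgroups -/

/-- The relators without the letter `b₀`. -/
abbrev ActiveRel (p : ℕ) := {ρ : Rel p // ρ.stable ≠ .b 0}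

/-- Basis of a free group which contains all words concerned: the letters not in Rips
words, the Rips words in relators with `b₀`, and one element for each of the other relators. -/
abbrev MixedIndex (p : ℕ) :=
  {l : Letter // l.Clean} ⊕ {s : Slot p // s.1.1.stable = .b 0} ⊕ ActiveRel p

/-- The corresponding block words. -/
def mixedBlocks (C : Rel p → BlockWord Letter (Slot p)) : MixedIndex p → BlockWord Letter (Slot p)
  | .inl l => [(.inl l.1, true)]
  | .inr (.inl s) => [(.inr s.1, true)]
  | .inr (.inr ρ) => C ρ.1

/-- The first, or last, blocks of these words. -/
def mixedEnd (f : Rel p → Slot p × Bool) : MixedIndex p → (Letter ⊕ Slot p) × Bool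
  | .inl l => (.inl l.1, true)
  | .inr (.inl s) => (.inr s.1, true)
  | .inr (.inr ρ) => (.inr (f ρ.1).1, (f ρ.1).2)

/-- An end block determines the index: a slot names its relator, and this cannot both contain `b₀`
as conjugating letter and be active. -/
theorem mixedEnd_eq {f f' : Rel p → Slot p × Bool} (hf : ∀ ρ, (f ρ).1.1.1 = ρ)
    (hf' : ∀ ρ, (f' ρ).1.1.1 = ρ) {i j : MixedIndex p}
    (h : (mixedEnd f i).1 = (mixedEnd f' j).1) : i = j := by
  rcases i with l | s | ρ <;> rcases j with l' | s' | ρ' <;>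
    simp only [mixedEnd, reduceCtorEq, Sum.inl.injEq, Sum.inr.injEq] at h ⊢
  · exact Subtype.ext h
  · exact Subtype.ext h
  · refine ρ'.2 ?_
    rw [← hf' ρ'.1, ← h]
    exact s.2
  · refine ρ.2 ?_
    rw [← hf ρ.1, h]
    exact s'.2
  · apply Subtype.ext
    rw [← hf ρ.1, ← hf' ρ'.1, h]

theorem Central.noCancel_mixed (h : Central R C f l) :
    NoCancel R.noiseList (mixedBlocks C) (mixedEnd f) (mixedEnd l) := by
  have hclean : ∀ (g : Rel p → Slot p × Bool) i a, (mixedEnd g i).1 = .inl a →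
      ∀ s, a ∉ R.noiseList s := by
    rintro g (l | s | ρ) a ha s
    · obtain rfl := Sum.inl_injective ha
      exact l.2.notMem s
    · simp [mixedEnd] at ha
    · simp [mixedEnd] at ha
  refine ⟨?_, ?_, ?_, hclean f, hclean l, fun i j => mixedEnd_eq h.first_rel h.first_rel,
    fun i j => mixedEnd_eq h.last_rel h.last_rel, fun i j hij => ?_⟩
  · rintro (l | s | ρ)
    · simp [mixedBlocks]
    · simp [mixedBlocks]
    · exact h.chain ρ.1
  · rintro (l | s | ρ)
    · rfl
    · rfl
    · exact h.head ρ.1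
  · rintro (l | s | ρ)
    · rfl
    · rfl
    · exact h.getLast ρ.1
  · obtain rfl := mixedEnd_eq h.last_rel h.first_rel hij
    rcases i with l | s | ρ
    · rfl
    · rfl
    · exact h.sign ρ.1 (by simpa [mixedEnd] using hij)

theorem NoCancel.comp {α σ ι κ : Type*} {N : σ → List α} {W : ι → BlockWord α σ}
    {f l : ι → (α ⊕ σ) × Bool} (h : NoCancel N W f l) {g : κ → ι} (hg : Function.Injective g) :
    NoCancel N (fun k => W (g k)) (fun k => f (g k)) (fun k => l (g k)) :=
  ⟨fun _ => h.chain _, fun _ => h.head _, fun _ => h.getLast _, fun _ => h.first_clean _,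
    fun _ => h.last_clean _, fun _ _ hij => hg (h.first_inj _ _ hij),
    fun _ _ hij => hg (h.last_inj _ _ hij), fun _ _ => h.sign _ _⟩

/-! ### The HNN-extension with stable letter `t` -/

variable (R) in
/-- The word `u` of the relation `t v t⁻¹ = u`. -/
def outerWord (ρ : Rel p) : Word := subst R.noiseList (withStable outerBlocks ρ)

variable (q R) in
/-- The word `v` of the relation `t v t⁻¹ = u`. -/
def innerWord (ρ : Rel p) : Word := subst R.noiseList (withStable (innerBlocks q) ρ)

variable (R) in
/-- The words `u` as elements of the free group. -/
def outerElt (ρ : ActiveRel p) : FreeGroup Letter := FreeGroup.mk (outerWord R ρ.1)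

variable (q R) in
/-- The words `v` as elements of the free group. -/
def innerElt (ρ : ActiveRel p) : FreeGroup Letter := FreeGroup.mk (innerWord q R ρ.1)

/-- Together with `innerElt_injective` this provides bases of the two associated subgroups; matching
them relator by relator defines the HNN-extension `THnn`. -/
theorem outerElt_injective (hR : R.Admissible q) :
    Function.Injective (FreeGroup.lift (outerElt R)) :=
  (central_outer.noCancel_withStable.comp Subtype.val_injective).injective hR.smallNoise

theorem innerElt_injective (hR : R.Admissible q) :
    Function.Injective (FreeGroup.lift (innerElt q R)) :=
  ((central_inner q).noCancel_withStable.comp Subtype.val_injective).injective hR.smallNoise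

/-- The HNN-extension of the free group on all letters with stable letter `t`. -/
abbrev THnn (hR : R.Admissible q) :=
  HNNExtension (FreeGroup Letter) (FreeGroup.lift (innerElt q R)).range
    (FreeGroup.lift (outerElt R)).range (closureEquiv (innerElt_injective hR)
      (outerElt_injective hR))

/-- The letters as elements of the HNN-extension. -/
noncomputable def tLetter (hR : R.Admissible q) : Letter → THnn hR
  | .t => HNNExtension.t
  | .a i => HNNExtension.of (.of (.a i))
  | .b j => HNNExtension.of (.of (.b j))
  | .x k => HNNExtension.of (.of (.x k))
  | .y k => HNNExtension.of (.of (.y k))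

theorem tLetter_of_ne (hR : R.Admissible q) {l : Letter} (h : l ≠ .t) :
    tLetter hR l = HNNExtension.of (.of l) := by
  cases l <;> first | rfl | exact (h rfl).elim

theorem lift_tLetter (hR : R.Admissible q) {w : Word} (h : ∀ c ∈ w, c.1 ≠ Letter.t) :
    FreeGroup.lift (tLetter hR) (FreeGroup.mk w) = HNNExtension.of (FreeGroup.mk w) := by
  induction w with
  | nil => simp [← FreeGroup.one_eq_mk]
  | cons c w ih =>
    rw [← List.singleton_append, ← FreeGroup.mul_mk, map_mul, map_mul,
      ih fun c hc => h c (by simp [hc]), FreeGroup.lift_mk]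
    congr 1
    have h1 := tLetter_of_ne hR (h c (by simp))
    obtain ⟨l, _ | _⟩ := c
    · simp only [List.map_cons, List.map_nil, List.prod_cons, List.prod_nil, mul_one, cond_false,
        h1, ← map_inv]
      rfl
    · simp only [List.map_cons, List.map_nil, List.prod_cons, List.prod_nil, mul_one, cond_true,
        h1]
      rfl

theorem t_mul_innerElt (hR : R.Admissible q) (ρ : ActiveRel p) :
    (HNNExtension.t : THnn hR) * HNNExtension.of (innerElt q R ρ) =
      HNNExtension.of (outerElt R ρ) * HNNExtension.t := by
  have h : innerElt q R ρ ∈ (FreeGroup.lift (innerElt q R)).range := ⟨.of ρ, by simp⟩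
  have := HNNExtension.t_mul_of (φ := closureEquiv (innerElt_injective hR)
    (outerElt_injective hR)) ⟨_, h⟩
  rw [closureEquiv_apply _ _ (.of ρ) _ (by simp)] at this
  simpa using this

theorem word_ne_t (ρ : Rel p) (s : Fin 3) (h : ρ.IsSlot s) : ∀ c ∈ R.word ρ s, c.1 ≠ .t := by
  intro c hc
  obtain ⟨k, hk⟩ := RipsWords.mem_noiseList (s := ⟨(ρ, s), h⟩) (mem_pos.1 hc).1
  rw [hk]
  split <;> simp

theorem head_ne_t (ρ : Rel p) : ∀ c ∈ ρ.head q, c.1 ≠ .t := by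
  cases ρ <;> simp only [Rel.head] <;> (try split) <;> simp [pos]

theorem initial_ne_t (ρ : Rel p) (h : ¬ ρ.IsT = true) : ∀ c ∈ ρ.initial, c.1 ≠ .t := by
  cases ρ <;> simp only [Rel.initial] <;> (try split) <;> simp_all [pos, Rel.IsT]

theorem stable_ne_t (ρ : Rel p) : ρ.stable ≠ .t := by cases ρ <;> simp [Rel.stable]

theorem initial_of_isT {ρ : Rel p} (h : ρ.IsT = true) : ρ.initial = [(.t, true)] := by
  cases ρ <;> simp_all [Rel.IsT, Rel.initial, pos]

theorem head_of_isT {ρ : Rel p} (h : ρ.IsT = true) : ρ.head q = [] := by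
  cases ρ <;> simp_all [Rel.IsT, Rel.head]

theorem mk_singleton_true {α : Type*} (a : α) : FreeGroup.mk [(a, true)] = FreeGroup.of a := rfl

theorem mk_singleton_false {α : Type*} (a : α) :
    FreeGroup.mk [(a, false)] = (FreeGroup.of a)⁻¹ := rfl

theorem mk_append {α : Type*} (u v : List (α × Bool)) :
    FreeGroup.mk (u ++ v) = FreeGroup.mk u * FreeGroup.mk v := FreeGroup.mul_mk.symm

theorem mk_invRev {α : Type*} (u : List (α × Bool)) :
    FreeGroup.mk (invRev u) = (FreeGroup.mk u)⁻¹ := FreeGroup.inv_mk.symm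

theorem outerWord_of_isT {ρ : Rel p} (h : ρ.IsT = true) :
    outerWord R ρ = [(ρ.stable, true)] ++ R.word ρ 0 := by
  simp [outerWord, withStable, outerBlocks, h, subst, blockWord_slot, slotFirst]; rfl

theorem outerWord_of_not_isT {ρ : Rel p} (h : ¬ ρ.IsT = true) :
    outerWord R ρ = R.word ρ 1 := by
  simp [outerWord, withStable, outerBlocks, h, subst, blockWord_slot, slotMiddle]

theorem innerWord_of_isT {ρ : Rel p} (h : ρ.IsT = true) :
    innerWord q R ρ = [(ρ.stable, true)] ++ invRev (R.word ρ 2) := by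
  simp [innerWord, withStable, innerBlocks, h, subst, blockWord_slot_false, slotLast]; rfl

theorem innerWord_of_not_isT {ρ : Rel p} (h : ¬ ρ.IsT = true) :
    innerWord q R ρ = invRev (R.word ρ 0) ++ invRev (ρ.head q) ++ [(ρ.stable, false)] ++
      ρ.initial ++ [(ρ.stable, true)] ++ invRev (R.word ρ 2) := by
  rw [innerWord, withStable, if_neg h, innerBlocks, if_neg h, subst_append, subst_append,
    subst_ofWord, subst_singleton, subst_singleton, blockWord_slot_false, blockWord_slot_false]
  simp [slotFirst, slotLast]

/-- The relation `s⁻¹us = v`, solved for the part between the occurrences of `t`, is the relation of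
`THnn` that belongs to `ρ`. For `b₀` no relation has been imposed. -/
theorem lift_tLetter_relator (hR : R.Admissible q) (ρ : Rel p) (hρ : ρ.stable ≠ .b 0) :
    FreeGroup.lift (tLetter hR) (FreeGroup.mk (R.relator q ρ)) = 1 := by
  have h := t_mul_innerElt hR ⟨ρ, hρ⟩
  have hs : ∀ e, FreeGroup.lift (tLetter hR) (FreeGroup.mk [(ρ.stable, e)]) =
      HNNExtension.of (FreeGroup.mk [(ρ.stable, e)]) := fun e =>
    lift_tLetter hR (by simpa using stable_ne_t ρ)
  have ht : FreeGroup.lift (tLetter hR) (FreeGroup.mk [(Letter.t, true)]) = HNNExtension.t := by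
    simp [tLetter]
  have ht' : FreeGroup.lift (tLetter hR) (FreeGroup.mk [(Letter.t, false)]) =
      (HNNExtension.t)⁻¹ := by
    simp [tLetter]
  have h0 := lift_tLetter hR (word_ne_t (R := R) ρ 0 (slotFirst ρ).2)
  have h2 := lift_tLetter hR (word_ne_t (R := R) ρ 2 (slotLast ρ).2)
  by_cases hT : ρ.IsT = true
  · simp only [innerElt, outerElt, outerWord_of_isT hT, innerWord_of_isT hT, mk_append,
      mk_invRev, map_mul, map_inv] at h
    simp only [RipsWords.relator, RipsWords.terminal, RipsWords.noise, hT, if_true,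
      initial_of_isT hT, head_of_isT hT, mk_append, mk_invRev, map_mul, map_inv, hs, ht, h0, h2,
      List.nil_append]
    simp only [mk_singleton_true, mk_singleton_false, map_inv] at h ⊢
    generalize (HNNExtension.of (FreeGroup.of ρ.stable) : THnn hR) = s at *
    generalize (HNNExtension.of (FreeGroup.mk (R.word ρ 0)) : THnn hR) = z at *
    generalize (HNNExtension.of (FreeGroup.mk (R.word ρ 2)) : THnn hR) = z' at *
    generalize (HNNExtension.t : THnn hR) = t at *
    have h3 : t * s = s * z * t * z' := by rw [← h]; group
    calc s⁻¹ * t * s * (z * t * z')⁻¹ = s⁻¹ * (t * s) * (z * t * z')⁻¹ := by group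
      _ = 1 := by rw [h3]; group
  · have h1 := lift_tLetter hR (word_ne_t (R := R) ρ 1 (slotMiddle ρ hT).2)
    have hi := lift_tLetter hR (initial_ne_t ρ hT)
    have hh := lift_tLetter hR (head_ne_t (q := q) ρ)
    simp only [innerElt, outerElt, outerWord_of_not_isT hT, innerWord_of_not_isT hT, mk_append,
      mk_invRev, map_mul, map_inv] at h
    simp only [RipsWords.relator, RipsWords.terminal, RipsWords.noise, hT, if_false,
      mk_append, mk_invRev, map_mul, map_inv, hs, ht, ht', h0, h1, h2, hi, hh, Bool.false_eq_true]
    simp only [mk_singleton_true, mk_singleton_false, map_inv] at h ⊢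
    generalize (HNNExtension.of (FreeGroup.of ρ.stable) : THnn hR) = s at *
    generalize (HNNExtension.of (FreeGroup.mk (R.word ρ 0)) : THnn hR) = z at *
    generalize (HNNExtension.of (FreeGroup.mk (R.word ρ 1)) : THnn hR) = z' at *
    generalize (HNNExtension.of (FreeGroup.mk (R.word ρ 2)) : THnn hR) = z'' at *
    generalize (HNNExtension.of (FreeGroup.mk (ρ.head q)) : THnn hR) = d at *
    generalize (HNNExtension.of (FreeGroup.mk ρ.initial) : THnn hR) = u at *
    generalize (HNNExtension.t : THnn hR) = t at *
    have h3 : s⁻¹ * u * s = d * z * t⁻¹ * (z' * t) * z'' := by rw [← h]; group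
    rw [h3]
    group

end Concrete

/-! ### Partial actions of the letters that respect the relators -/

section Local

variable {p q : ℕ} {R : RipsWords p} {Ξ : Type}

/-- If the letters `u` and `v` of two families correspond under `T`, so do the words in them. -/
theorem exists_run_flatMap {ι : Type*} (𝒜 : PartialAction Letter Ξ) {U V : ι → Word}
    {T : Ξ → Ξ → Prop}
    (h : ∀ i ξ η η', T ξ η → 𝒜.run (V i) η η' → ∃ ξ', 𝒜.run (U i) ξ ξ' ∧ T ξ' η')
    (h' : ∀ i ξ η η', T ξ η → 𝒜.run (V i) η' η → ∃ ξ', 𝒜.run (U i) ξ' ξ ∧ T ξ' η')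
    (w : List (ι × Bool)) {ξ η η' : Ξ} (hT : T ξ η)
    (hw : 𝒜.run (w.flatMap (signedWord V)) η η') :
    ∃ ξ', 𝒜.run (w.flatMap (signedWord U)) ξ ξ' ∧ T ξ' η' := by
  induction w generalizing ξ η with
  | nil =>
    obtain rfl : η = η' := hw
    exact ⟨ξ, rfl, hT⟩
  | cons c w ih =>
    rw [List.flatMap_cons, 𝒜.run_append] at hw
    obtain ⟨ζ, h1, h2⟩ := hw
    obtain ⟨θ, h3, h4⟩ : ∃ θ, 𝒜.run (signedWord U c) ξ θ ∧ T θ ζ := by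
      obtain ⟨i, _ | _⟩ := c
      · simp only [signedWord, Bool.false_eq_true, if_false, 𝒜.run_invRev] at h1 ⊢
        exact h' i _ _ _ hT h1
      · exact h i _ _ _ hT h1
    obtain ⟨ξ', h5, h6⟩ := ih h4 h2
    exact ⟨ξ', by rw [List.flatMap_cons, 𝒜.run_append]; exact ⟨θ, h3, h5⟩, h6⟩

variable (q R) in
/-- The relators without `b₀` hold wherever they are defined. -/
structure Respects (𝒜 : PartialAction Letter Ξ) : Prop where
  uniform : 𝒜.Uniform R.noiseList
  inner : ∀ (ρ : ActiveRel p) ξ η η', 𝒜.step .t ξ η → 𝒜.run (innerWord q R ρ.1) η η' →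
    ∃ ξ', 𝒜.run (outerWord R ρ.1) ξ ξ' ∧ 𝒜.step .t ξ' η'
  inner_symm : ∀ (ρ : ActiveRel p) ξ η η', 𝒜.step .t ξ η → 𝒜.run (innerWord q R ρ.1) η' η →
    ∃ ξ', 𝒜.run (outerWord R ρ.1) ξ' ξ ∧ 𝒜.step .t ξ' η'
  outer : ∀ (ρ : ActiveRel p) ξ ξ' η, 𝒜.step .t ξ η → 𝒜.run (outerWord R ρ.1) ξ ξ' →
    ∃ η', 𝒜.run (innerWord q R ρ.1) η η' ∧ 𝒜.step .t ξ' η'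
  outer_symm : ∀ (ρ : ActiveRel p) ξ ξ' η, 𝒜.step .t ξ η → 𝒜.run (outerWord R ρ.1) ξ' ξ →
    ∃ η', 𝒜.run (innerWord q R ρ.1) η' η ∧ 𝒜.step .t ξ' η'

-- Elements of the free group act through their reduced words. In a pinch, the reduced word is
-- expanded to a product of inner words by `NoCancel.run`, each factor is carried across an edge
-- labelled `t` to an outer word, and the product is reduced again; this works likewise in the other
-- direction.
open Classical in
theorem Respects.readable (hR : R.Admissible q) {𝒜 : PartialAction Letter Ξ}
    (h : Respects q R 𝒜) : Readable (closureEquiv (innerElt_injective hR) (outerElt_injective hR))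
      (fun g => 𝒜.run g.toWord) (𝒜.step .t) := by
  refine ⟨fun ξ η => by simp, fun g k ξ η ζ h1 h2 => ?_, ?_, ?_⟩
  · rw [FreeGroup.toWord_mul]
    exact 𝒜.run_reduce ((𝒜.run_append _ _ _ _).2 ⟨η, h1, h2⟩)
  · rintro ⟨_, v, rfl⟩ ξ η ξ' η' h1 h2 h3
    rw [closureEquiv_apply _ _ v _ rfl]
    obtain ⟨w, hw, h4⟩ := ((central_inner q).noCancel_withStable.comp Subtype.val_injective).run
      hR.smallNoise h.uniform v h2
    obtain ⟨ξ'', h5, h6⟩ := exists_run_flatMap 𝒜 (U := fun ρ : ActiveRel p => outerWord R ρ.1)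
      (T := 𝒜.step .t) h.inner h.inner_symm _ h1 h4
    obtain rfl := 𝒜.left_unique h6 h3
    have h7 : FreeGroup.lift (outerElt R) (FreeGroup.mk w) = _ := (mk_signedWord _ _).symm
    rw [← hw, h7, FreeGroup.toWord_mk]
    exact 𝒜.run_reduce h5
  · rintro ⟨_, v, rfl⟩ ξ η ξ' η' h1 h2 h3
    rw [closureEquiv_symm, closureEquiv_apply _ _ v _ rfl]
    obtain ⟨w, hw, h4⟩ := (central_outer.noCancel_withStable.comp Subtype.val_injective).run
      hR.smallNoise h.uniform v h2
    obtain ⟨η'', h5, h6⟩ := exists_run_flatMap 𝒜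
      (U := fun ρ : ActiveRel p => innerWord q R ρ.1) (T := fun η ξ => 𝒜.step .t ξ η)
      (fun ρ η ξ ξ' => h.outer ρ ξ ξ' η) (fun ρ η ξ ξ' => h.outer_symm ρ ξ ξ' η) _ h1 h4
    obtain rfl := 𝒜.right_unique h6 h3
    have h7 : FreeGroup.lift (innerElt q R) (FreeGroup.mk w) = _ := (mk_signedWord _ _).symm
    rw [← hw, h7, FreeGroup.toWord_mk]
    exact 𝒜.run_reduce h5

open Classical in
theorem reach_of_run (hR : R.Admissible q) (𝒜 : PartialAction Letter Ξ) {w : Word} {ξ η : Ξ}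
    (h : 𝒜.run w ξ η) : Reach (closureEquiv (innerElt_injective hR) (outerElt_injective hR))
      (fun g => 𝒜.run g.toWord) (𝒜.step .t)
      (FreeGroup.lift (tLetter hR) (FreeGroup.mk w)) ξ η := by
  induction w generalizing ξ with
  | nil =>
    obtain rfl : ξ = η := h
    rw [← FreeGroup.one_eq_mk, map_one, ← map_one HNNExtension.of]
    exact .of (by simp)
  | cons c w ih =>
    obtain ⟨ζ, h1, h2⟩ := h
    rw [← List.singleton_append, ← FreeGroup.mul_mk, map_mul]
    refine .mul ?_ (ih h2)
    obtain ⟨l, e⟩ := c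
    by_cases hl : l = .t
    · subst hl
      cases e
      · rw [mk_singleton_false, map_inv, FreeGroup.lift_apply_of]
        exact .t_inv (by simpa [PartialAction.signedStep] using h1)
      · rw [mk_singleton_true, FreeGroup.lift_apply_of]
        exact .t (by simpa [PartialAction.signedStep] using h1)
    · rw [lift_tLetter hR (by simpa using hl)]
      refine .of ?_
      rw [FreeGroup.toWord_mk, FreeGroup.reduce_singleton, 𝒜.run_singleton]
      exact h1

/-- Used contrapositively: a word that moves some point is nontrivial in `THnn`. -/
theorem Respects.eq_of_run (hR : R.Admissible q) {𝒜 : PartialAction Letter Ξ}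
    (h : Respects q R 𝒜) {w : Word} {ξ η : Ξ} (hrun : 𝒜.run w ξ η)
    (hw : FreeGroup.lift (tLetter hR) (FreeGroup.mk w) = 1) : ξ = η :=
  (h.readable hR).eq_of_reach_one (hw ▸ reach_of_run hR 𝒜 hrun)

end Local

/-! ### A partial action in which `a₁ b_{j+1}, a₂, t, x₁, x₂` move a point freely -/

section Tree

variable {p : ℕ}

/-- The word in the letters `b_j` spelled by a list of indices. -/
def posWord (s : List (Fin (p + 1))) : FreeGroup (Fin (p + 1)) := FreeGroup.mk (pos s)

theorem toWord_posWord (s : List (Fin (p + 1))) : (posWord s).toWord = pos s := by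
  rw [posWord, FreeGroup.toWord_mk]
  exact (isReduced_of_sign (e := true) fun c hc => (mem_pos.1 hc).2).reduce_eq

theorem posWord_injective : Function.Injective (posWord (p := p)) := fun s s' h =>
  pos_injective ((toWord_posWord s).symm.trans ((congrArg _ h).trans (toWord_posWord s')))

theorem posWord_cons (m : Fin (p + 1)) (s : List (Fin (p + 1))) :
    posWord (m :: s) = FreeGroup.of m * posWord s := rfl

theorem posWord_append (s s' : List (Fin (p + 1))) :
    posWord (s ++ s') = posWord s * posWord s' := by
  simp [posWord, pos]

/-- Conjugation by `a₁` maps `b_m` to `b_{m+1} b_m`, up to noise. -/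
def shiftList : Fin (p + 1) → List (Fin (p + 1)) :=
  Fin.lastCases [Fin.last p] fun i => [i.succ, i.castSucc]

/-- The images of the generators under the inverse of the automorphism
`b_m ↦ b_{m+1} b_m`, `b_p ↦ b_p`. -/
def unshift (m : Fin (p + 1)) : FreeGroup (Fin (p + 1)) :=
  Fin.reverseInduction (motive := fun _ => FreeGroup (Fin (p + 1))) (.of (Fin.last p))
    (fun i x => x⁻¹ * .of i.castSucc) m

/-- The automorphism `b_m ↦ b_{m+1} b_m`, `b_p ↦ b_p`. -/
def shiftHom : FreeGroup (Fin (p + 1)) →* FreeGroup (Fin (p + 1)) :=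
  FreeGroup.lift fun m => posWord (shiftList m)

theorem shiftHom_of (m : Fin (p + 1)) : shiftHom (.of m) = posWord (shiftList m) := by
  simp [shiftHom]

theorem shiftHom_unshift (m : Fin (p + 1)) : shiftHom (unshift m) = .of m := by
  induction m using Fin.reverseInduction with
  | last =>
    simp only [unshift, Fin.reverseInduction_last, shiftHom_of, shiftList, Fin.lastCases_last]
    rfl
  | cast i ih =>
    have : unshift i.castSucc = (unshift i.succ)⁻¹ * .of i.castSucc := by
      simp [unshift, Fin.reverseInduction_castSucc]
    rw [this, map_mul, map_inv, ih, shiftHom_of, shiftList, Fin.lastCases_castSucc,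
      posWord_cons, posWord_cons]
    simp [posWord, pos, ← FreeGroup.one_eq_mk]

theorem unshift_shift (m : Fin (p + 1)) :
    FreeGroup.lift unshift (shiftHom (.of m)) = .of m := by
  rw [shiftHom_of]
  induction m using Fin.lastCases with
  | last =>
    rw [shiftList, Fin.lastCases_last]
    simp [posWord, pos, unshift]
  | cast i =>
    rw [shiftList, Fin.lastCases_castSucc]
    have : unshift i.castSucc = (unshift i.succ)⁻¹ * .of i.castSucc := by
      simp [unshift, Fin.reverseInduction_castSucc]
    simp [posWord, pos, this]

/-- The automorphism `b_m ↦ b_{m+1} b_m`, `b_p ↦ b_p`. -/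
def shift : FreeGroup (Fin (p + 1)) ≃* FreeGroup (Fin (p + 1)) :=
  shiftHom.toMulEquiv (FreeGroup.lift unshift)
    (by ext m; simp only [MonoidHom.comp_apply, unshift_shift]; rfl)
    (by ext m; simp [shiftHom_unshift])

theorem shift_of (m : Fin (p + 1)) : shift (.of m) = posWord (shiftList m) := shiftHom_of m

variable (q : ℕ) (R : RipsWords p)

/-- Conjugation by `b_m` on the letters `a₂, t, x₁, x₂`. -/
def conjHom (m : Fin (p + 1)) : FreeGroup Letter →* FreeGroup Letter :=
  FreeGroup.lift fun l => match l with
    -- The values at `a₁`, `b_j` and `y_k` are defaults: only `a₂, t, x₁, x₂` act through this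
    -- homomorphism.
    | .a _ => .mk (R.terminal q (.r2 m))
    | .t => .mk (R.terminal q (.r3t m))
    | .x k => .mk (R.terminal q (.r3x m k))
    | .b _ => 1
    | .y _ => 1

/-- Conjugation by a product of letters `b_m`. -/
def conjList : List (Fin (p + 1)) → (FreeGroup Letter →* FreeGroup Letter)
  | [] => MonoidHom.id _
  | m :: s => (conjList s).comp (conjHom q R m)

/-- The part of the terminal word of `r_{1,m}` after its first letter `a₁`. -/
def tailWord (m : Fin (p + 1)) : Word :=
  (if (m : ℕ) + 1 = q then pos [.a 1] else []) ++ R.noise (.r1 m)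

/-- The factor by which the action of `a₁` changes along the letter `b_m`. -/
def weightStep (m : Fin (p + 1)) : List (Fin (p + 1)) → FreeGroup Letter :=
  Fin.reverseInduction (motive := fun _ => List (Fin (p + 1)) → FreeGroup Letter)
    (fun s => conjList q R s (.mk (tailWord q R (Fin.last p))))
    (fun i f s => conjList q R s (.mk (tailWord q R i.castSucc)) * (f (i.castSucc :: s))⁻¹) m

/-- The action of `a₁`. -/
def weight : List (Fin (p + 1)) → FreeGroup Letter
  | [] => 1
  | m :: s => weight s * weightStep q R m s

/-- `weightStep` is defined by descending recursion on `m` so as to solve this equation, which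
expresses that `r_{1,m}` holds at the vertex `s`. -/
theorem weight_shiftList (m : Fin (p + 1)) (s : List (Fin (p + 1))) :
    weight q R (shiftList m ++ s) = weight q R s * conjList q R s (.mk (tailWord q R m)) := by
  induction m using Fin.lastCases with
  | last =>
    simp [shiftList, weight, weightStep]
  | cast i =>
    simp [shiftList, weight, weightStep, Fin.reverseInduction_castSucc, mul_assoc]

/-- The graph of `a₂, t, x₁, x₂`. -/
def edgeStep (g : FreeGroup Letter) (ξ η : FreeGroup (Fin (p + 1)) × FreeGroup Letter) : Prop :=
  ∃ s, ξ.1 = posWord s ∧ η.1 = posWord s ∧ η.2 = ξ.2 * conjList q R s g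

/-- The letters act on pairs of a vertex and an element of the free group on all letters. The
letters `b_j` and `a₁` move the vertices; `a₂, t, x₁, x₂` are defined at positive words. The
parameter `d` is a list with at most one element, such that `a₁ b_d` fixes the vertex `1`. -/
def treeStep (d : List (Fin (p + 1))) :
    Letter → FreeGroup (Fin (p + 1)) × FreeGroup Letter →
      FreeGroup (Fin (p + 1)) × FreeGroup Letter → Prop
  | .a i, ξ, η => if i = 0 then
      η.1 = shift ξ.1 * posWord d ∧
        η.2 = ξ.2 * (.of (.a 0) * (weight q R d)⁻¹ * weight q R (η.1.toWord.map Prod.fst))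
    else edgeStep q R (.of (.a 1)) ξ η
  | .b j, ξ, η => ∃ m : Fin (p + 1), j = m ∧ ξ.1 = .of m * η.1 ∧ η.2 = ξ.2
  | .t, ξ, η => edgeStep q R (.of .t) ξ η
  | .x k, ξ, η => edgeStep q R (.of (.x k)) ξ η
  | .y _, _, _ => False

variable {q R}

theorem edgeStep_right_unique {g : FreeGroup Letter}
    {ξ η η' : FreeGroup (Fin (p + 1)) × FreeGroup Letter} (h : edgeStep q R g ξ η)
    (h' : edgeStep q R g ξ η') : η = η' := by
  obtain ⟨s, h1, h2, h3⟩ := h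
  obtain ⟨s', h1', h2', h3'⟩ := h'
  obtain rfl := posWord_injective (h1.symm.trans h1')
  exact Prod.ext (h2.trans h2'.symm) (h3.trans h3'.symm)

theorem edgeStep_left_unique {g : FreeGroup Letter}
    {ξ ξ' η : FreeGroup (Fin (p + 1)) × FreeGroup Letter} (h : edgeStep q R g ξ η)
    (h' : edgeStep q R g ξ' η) : ξ = ξ' := by
  obtain ⟨s, h1, h2, h3⟩ := h
  obtain ⟨s', h1', h2', h3'⟩ := h'
  obtain rfl := posWord_injective (h2.symm.trans h2')
  exact Prod.ext (h1.trans h1'.symm) (mul_right_cancel (h3.symm.trans h3'))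

variable (q R) in
/-- The partial action given by `treeStep`. -/
def treeAction (d : List (Fin (p + 1))) :
    PartialAction Letter (FreeGroup (Fin (p + 1)) × FreeGroup Letter) where
  step := treeStep q R d
  right_unique {l ξ η η'} h h' := by
    cases l with
    | a i =>
      simp only [treeStep] at h h'
      split at h
      · rename_i hi
        rw [if_pos hi] at h'
        have h1 : η.1 = η'.1 := h.1.trans h'.1.symm
        exact Prod.ext h1 (by rw [h.2, h'.2, h1])
      · rename_i hi
        rw [if_neg hi] at h'
        exact edgeStep_right_unique h h'
    | b j =>
      obtain ⟨m, h1, h2, h3⟩ := h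
      obtain ⟨m', h1', h2', h3'⟩ := h'
      obtain rfl : m = m' := Fin.ext (h1.symm.trans h1')
      exact Prod.ext (mul_left_cancel (h2.symm.trans h2')) (h3.trans h3'.symm)
    | t => exact edgeStep_right_unique h h'
    | x k => exact edgeStep_right_unique h h'
    | y k => exact h.elim
  left_unique {l ξ ξ' η} h h' := by
    cases l with
    | a i =>
      simp only [treeStep] at h h'
      split at h
      · rename_i hi
        rw [if_pos hi] at h'
        exact Prod.ext (shift.injective (mul_right_cancel (h.1.symm.trans h'.1)))
          (mul_right_cancel (h.2.symm.trans h'.2))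
      · rename_i hi
        rw [if_neg hi] at h'
        exact edgeStep_left_unique h h'
    | b j =>
      obtain ⟨m, h1, h2, h3⟩ := h
      obtain ⟨m', h1', h2', h3'⟩ := h'
      obtain rfl : m = m' := Fin.ext (h1.symm.trans h1')
      exact Prod.ext (h2.trans h2'.symm) (h3.symm.trans h3')
    | t => exact edgeStep_left_unique h h'
    | x k => exact edgeStep_left_unique h h'
    | y k => exact h.elim

/-- The letters `a₂, t, x₁, x₂`. -/
def Letter.IsEdge : Letter → Prop
  | .a i => i = 1
  | .t => True
  | .x _ => True
  | .b _ => False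
  | .y _ => False

theorem treeAction_step_of_isEdge (d : List (Fin (p + 1))) {l : Letter} (hl : l.IsEdge)
    (ξ η : FreeGroup (Fin (p + 1)) × FreeGroup Letter) :
    (treeAction q R d).step l ξ η ↔ edgeStep q R (.of l) ξ η := by
  cases l with
  | a i =>
    obtain rfl : i = 1 := hl
    simp [treeAction, treeStep]
  | t => rfl
  | x k => rfl
  | b j => exact hl.elim
  | y j => exact hl.elim

theorem signedStep_of_isEdge (d : List (Fin (p + 1))) {c : Letter × Bool} (hc : c.1.IsEdge)
    (ξ η : FreeGroup (Fin (p + 1)) × FreeGroup Letter) :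
    (treeAction q R d).signedStep c ξ η ↔ edgeStep q R (.mk [c]) ξ η := by
  obtain ⟨l, _ | _⟩ := c
  · simp only [PartialAction.signedStep, Bool.false_eq_true, if_false,
      treeAction_step_of_isEdge d hc, edgeStep, mk_singleton_false, map_inv, eq_mul_inv_iff_mul_eq]
    exact exists_congr fun s => ⟨fun h => ⟨h.2.1, h.1, h.2.2.symm⟩,
      fun h => ⟨h.2.1, h.1, h.2.2.symm⟩⟩
  · simp only [PartialAction.signedStep, if_true, treeAction_step_of_isEdge d hc]
    rfl

theorem run_of_isEdge (d : List (Fin (p + 1))) {w : Word} (hw : ∀ c ∈ w, c.1.IsEdge)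
    (s : List (Fin (p + 1))) (f : FreeGroup Letter) :
    (treeAction q R d).run w (posWord s, f) (posWord s, f * conjList q R s (.mk w)) := by
  induction w generalizing f with
  | nil => simp [← FreeGroup.one_eq_mk]
  | cons c w ih =>
    refine ⟨(posWord s, f * conjList q R s (.mk [c])), ?_, ?_⟩
    · rw [signedStep_of_isEdge d (hw c (by simp))]
      exact ⟨s, rfl, rfl, rfl⟩
    · rw [show FreeGroup.mk (c :: w) = FreeGroup.mk [c] * FreeGroup.mk w from mk_append [c] w,
        map_mul, ← mul_assoc]
      exact ih (fun c hc => hw c (by simp [hc])) _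

/-- The word has to be nonempty, since the empty word can be read also at vertices that are not
positive. -/
theorem run_iff_of_isEdge (d : List (Fin (p + 1))) {w : Word} (hw : ∀ c ∈ w, c.1.IsEdge)
    (hne : w ≠ []) (ξ η : FreeGroup (Fin (p + 1)) × FreeGroup Letter) :
    (treeAction q R d).run w ξ η ↔ edgeStep q R (.mk w) ξ η := by
  constructor
  · intro h
    obtain ⟨c, w, rfl⟩ := List.exists_cons_of_ne_nil hne
    obtain ⟨ζ, h', -⟩ := id h
    obtain ⟨s, h1, -, -⟩ := (signedStep_of_isEdge d (hw c (by simp)) _ _).1 h'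
    obtain ⟨v, f⟩ := ξ
    obtain rfl : v = posWord s := h1
    obtain rfl := PartialAction.run_right_unique _ h (run_of_isEdge d hw s f)
    exact ⟨s, rfl, rfl, rfl⟩
  · rintro ⟨s, h1, h2, h3⟩
    obtain ⟨v, f⟩ := ξ
    obtain ⟨v', f'⟩ := η
    obtain rfl : v = posWord s := h1
    obtain rfl : v' = posWord s := h2
    obtain rfl : f' = f * _ := h3
    exact run_of_isEdge d hw s f

/-- Thus the relators with `Y`-words, in particular those of `a₁` and `a₂`, are respected vacuously.
-/
theorem not_run_y (d : List (Fin (p + 1))) {w : Word} (hw : ∀ c ∈ w, ∃ k, c.1 = Letter.y k)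
    (hne : w ≠ []) (ξ η : FreeGroup (Fin (p + 1)) × FreeGroup Letter) :
    ¬ (treeAction q R d).run w ξ η := by
  intro h
  obtain ⟨c, w, rfl⟩ := List.exists_cons_of_ne_nil hne
  obtain ⟨ζ, h, -⟩ := h
  obtain ⟨k, hk⟩ := hw c (by simp)
  obtain ⟨l, _ | _⟩ := c
  · obtain rfl : l = .y k := hk
    exact h
  · obtain rfl : l = .y k := hk
    exact h

end Tree

/-! ### The tree action respects the relators -/

section Tree

variable {p q : ℕ} {R : RipsWords p}

theorem run_b (d : List (Fin (p + 1))) (m : Fin (p + 1)) (v : FreeGroup (Fin (p + 1)))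
    (f : FreeGroup Letter) :
    (treeAction q R d).run [(.b m, true)] (.of m * v, f) (v, f) :=
  (PartialAction.run_singleton _ _ _ _).2 ⟨m, rfl, rfl, rfl⟩

theorem run_b_inv (d : List (Fin (p + 1))) (m : Fin (p + 1)) (v : FreeGroup (Fin (p + 1)))
    (f : FreeGroup Letter) :
    (treeAction q R d).run [(.b m, false)] (v, f) (.of m * v, f) :=
  (PartialAction.run_singleton _ _ _ _).2 ⟨m, rfl, rfl, rfl⟩

theorem map_fst_toWord_posWord (s : List (Fin (p + 1))) :
    (posWord s).toWord.map Prod.fst = s := by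
  rw [toWord_posWord, pos, List.map_map]
  exact List.map_id s

theorem run_a (d : List (Fin (p + 1))) (v : FreeGroup (Fin (p + 1)))
    (s : List (Fin (p + 1))) (hs : shift v * posWord d = posWord s) (f : FreeGroup Letter) :
    (treeAction q R d).run [(.a 0, true)] (v, f)
      (posWord s, f * (.of (.a 0) * (weight q R d)⁻¹ * weight q R s)) := by
  rw [PartialAction.run_singleton]
  refine ⟨hs.symm, ?_⟩
  simp only [map_fst_toWord_posWord]

theorem word_isEdge {ρ : Rel p} (hρ : ρ.IsX = true) (s : Fin 3) :
    ∀ c ∈ R.word ρ s, c.1.IsEdge := by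
  intro c hc
  obtain ⟨k, hk⟩ := mem_ripsSubword (mem_pos.1 hc).1
  rw [hk, noiseLetters_apply, if_pos hρ]
  trivial

theorem word_y {ρ : Rel p} (hρ : ¬ ρ.IsX = true) (s : Fin 3) :
    ∀ c ∈ R.word ρ s, ∃ k, c.1 = .y k := by
  intro c hc
  obtain ⟨k, hk⟩ := mem_ripsSubword (mem_pos.1 hc).1
  rw [hk, noiseLetters_apply, if_neg hρ]
  exact ⟨k, rfl⟩

theorem forall_mem_invRev {α : Type*} {w : List (α × Bool)} {P : α → Prop}
    (h : ∀ c ∈ w, P c.1) : ∀ c ∈ invRev w, P c.1 := by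
  intro c hc
  simp only [invRev, List.mem_reverse, List.mem_map] at hc
  obtain ⟨c', hc', rfl⟩ := hc
  exact h c' hc'

theorem mk_noise_of_not_isT {ρ : Rel p} (h : ¬ ρ.IsT = true) :
    FreeGroup.mk (R.noise ρ) = .mk (R.word ρ 0) * (.of .t)⁻¹ * .mk (R.word ρ 1) * .of .t *
      .mk (R.word ρ 2) := by
  rw [RipsWords.noise, if_neg h]
  simp only [mk_append]
  rfl

theorem mk_noise_of_isT {ρ : Rel p} (h : ρ.IsT = true) :
    FreeGroup.mk (R.noise ρ) = .mk (R.word ρ 0) * .of .t * .mk (R.word ρ 2) := by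
  rw [RipsWords.noise, if_pos h]
  simp only [mk_append]
  rfl

theorem conjHom_t (m : Fin (p + 1)) :
    conjHom q R m (.of .t) = .mk (R.terminal q (.r3t m)) := by
  simp [conjHom]

/-- Reading `b_m⁻¹ u b_m` at the vertex `s` makes a detour to `m :: s`, where `u` acts as its
conjugate by `b_m` acts at `s`. -/
theorem run_conj_of_isEdge (d : List (Fin (p + 1))) (m : Fin (p + 1)) {u v w : Word}
    (hu : ∀ c ∈ u, c.1.IsEdge) (hv : ∀ c ∈ v, c.1.IsEdge)
    (h : conjHom q R m (.mk u) = .mk v * .mk w) (s : List (Fin (p + 1))) (f : FreeGroup Letter) :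
    (treeAction q R d).run (invRev v ++ [(.b m, false)] ++ u ++ [(.b m, true)]) (posWord s, f)
      (posWord s, f * conjList q R s (.mk w)) := by
  simp only [PartialAction.run_append]
  refine ⟨_, ⟨_, ⟨_, run_of_isEdge d (forall_mem_invRev hv) s f, run_b_inv d m _ _⟩,
    run_of_isEdge d hu (m :: s) _⟩, ?_⟩
  have hval : f * conjList q R s (.mk (invRev v)) * conjList q R (m :: s) (.mk u) =
      f * conjList q R s (.mk w) := by
    rw [mk_invRev, conjList, MonoidHom.comp_apply, h, mul_assoc, ← map_mul, inv_mul_cancel_left]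
  rw [hval]
  exact run_b d m (posWord s) _

/-- Up to `ε`, the path goes from `s` by `a₁⁻¹` to some `v`, by `b_m⁻¹` to `b_m v`, by `a₁` to
`b_{m+1} b_m s`, and back to `s` by `b_{m+1}` and `b_m`; for `m = p` the letter `b_{m+1}` is
missing. The contributions of `a₁⁻¹` and `a₁` leave a quotient of weights, which `weight_shiftList`
evaluates. -/
theorem run_r1 (d : List (Fin (p + 1))) (m : Fin (p + 1)) (s : List (Fin (p + 1)))
    (f : FreeGroup Letter) :
    (treeAction q R d).run (invRev ((Rel.r1 m).head q) ++ [(.b m, false)] ++ (Rel.r1 m).initial ++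
      [(.b m, true)]) (posWord s, f) (posWord s, f * conjList q R s (.mk (R.noise (.r1 m)))) := by
  set e : Word := if (m : ℕ) + 1 = q then pos [.a 1] else [] with he
  have he' : ∀ c ∈ e, c.1.IsEdge := by
    rw [he]
    split
    · simp [pos, Letter.IsEdge]
    · simp
  have hhead : (Rel.r1 m).head q = [(.a 0, true)] ++ e := by
    rw [Rel.head, he]
    split <;> rfl
  -- The vertex that `a₁` moves to `s`. It need not be positive, but only `a₁` and letters `b_j` are
  -- read at it.
  obtain ⟨v, hv⟩ : ∃ v, shift v = posWord s * (posWord d)⁻¹ := shift.surjective _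
  have hv1 : shift v * posWord d = posWord s := by rw [hv]; group
  have hv2 : shift (.of m * v) * posWord d = posWord (shiftList m ++ s) := by
    rw [map_mul, mul_assoc, hv1, shift_of, posWord_append]
  set c := FreeGroup.of (Letter.a 0) * (weight q R d)⁻¹ with hc
  have h1 : (treeAction q R d).run (invRev e) (posWord s, f)
    (posWord s, f * conjList q R s (.mk (invRev e))) := run_of_isEdge d (forall_mem_invRev he') s f
  have h2 : (treeAction q R d).run (invRev [(.a 0, true)])
      (posWord s, f * conjList q R s (.mk (invRev e)))
      (v, f * conjList q R s (.mk (invRev e)) * (c * weight q R s)⁻¹) := by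
    rw [PartialAction.run_invRev]
    convert run_a d v s hv1 (f * conjList q R s (.mk (invRev e)) * (c * weight q R s)⁻¹) using 2
    rw [← hc]
    group
  have h3 := run_b_inv (q := q) (R := R) d m v
    (f * conjList q R s (.mk (invRev e)) * (c * weight q R s)⁻¹)
  have h4 := run_a (q := q) (R := R) d (.of m * v) _ hv2 (f * conjList q R s (.mk (invRev e)) *
    (c * weight q R s)⁻¹)
  have hval : f * conjList q R s (.mk (invRev e)) * (c * weight q R s)⁻¹ *
      (c * weight q R (shiftList m ++ s)) = f * conjList q R s (.mk (R.noise (.r1 m))) := by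
    rw [weight_shiftList, tailWord, ← he, mk_append, mk_invRev]
    simp only [map_mul, map_inv]
    group
  rw [← hc, hval] at h4
  generalize f * conjList q R s (.mk (R.noise (.r1 m))) = g at h4 ⊢
  rw [hhead, FreeGroup.invRev_append]
  simp only [PartialAction.run_append]
  refine ⟨_, ⟨_, ⟨_, ⟨_, h1, h2⟩, h3⟩, ?_⟩, run_b d m (posWord s) g⟩
  clear h1 h2 h3
  induction m using Fin.lastCases with
  | last =>
    have : (Rel.r1 (Fin.last p)).initial = [(.a 0, true)] := by simp [Rel.initial, pos]
    rw [this]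
    simpa [shiftList, posWord_cons] using h4
  | cast i =>
    have : (Rel.r1 i.castSucc).initial = [(.a 0, true)] ++ [(.b i.succ, true)] := by
      simp [Rel.initial, pos, i.2.ne]
    rw [this, PartialAction.run_append]
    refine ⟨_, h4, ?_⟩
    simp only [shiftList, Fin.lastCases_castSucc]
    exact run_b d i.succ (.of i.castSucc * posWord s) g

theorem run_inner_middle (d : List (Fin (p + 1))) {ρ : Rel p} (hX : ρ.IsX = true)
    (hT : ¬ ρ.IsT = true) (s : List (Fin (p + 1))) (f : FreeGroup Letter) :
    (treeAction q R d).run (invRev (ρ.head q) ++ [(ρ.stable, false)] ++ ρ.initial ++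
      [(ρ.stable, true)]) (posWord s, f) (posWord s, f * conjList q R s (.mk (R.noise ρ))) := by
  cases ρ with
  | r1 m => exact run_r1 d m s f
  | r2 m =>
    refine run_conj_of_isEdge d m ?_ ?_ ?_ s f
    · simp [Rel.initial, pos, Letter.IsEdge]
    · simp [Rel.head, pos, Letter.IsEdge]
    · rw [← mk_append]
      simp [Rel.initial, pos, conjHom, RipsWords.terminal]
  | r3x m k =>
    refine run_conj_of_isEdge d m ?_ ?_ ?_ s f
    · simp [Rel.initial, pos, Letter.IsEdge]
    · simp [Rel.head]
    · rw [← mk_append]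
      simp [Rel.initial, pos, conjHom, RipsWords.terminal]
  | r3t m => exact (hT rfl).elim
  | r4t i => exact (hT rfl).elim
  | r4y i k => simp [Rel.IsX] at hX

/-- The graph of a word that moves certain positive words, and multiplies by given factors. -/
def graphOf (D : List (Fin (p + 1)) → List (Fin (p + 1)) → FreeGroup Letter → Prop)
    (ξ η : FreeGroup (Fin (p + 1)) × FreeGroup Letter) : Prop :=
  ∃ s s' g, D s s' g ∧ ξ.1 = posWord s ∧ η.1 = posWord s' ∧ η.2 = ξ.2 * g

/-- The outer and the inner word of a relator move the same vertices in the same way, and `D` pairs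
their factors `g`, `h`, which are intertwined by the action of `t`. The words are defined at all
positive vertices, or, if the initial word is `t`, at those beginning with `b_m`; with `Y`-words
they are defined nowhere. -/
theorem exists_graph (hR : R.Admissible q) (d : List (Fin (p + 1))) (ρ : Rel p) :
    ∃ D : List (Fin (p + 1)) → List (Fin (p + 1)) → FreeGroup Letter → FreeGroup Letter → Prop,
      (∀ s s' g h, D s s' g h → conjList q R s (.of .t) * h = g * conjList q R s' (.of .t)) ∧
      (∀ ξ ξ', (treeAction q R d).run (outerWord R ρ) ξ ξ' ↔
        graphOf (fun s s' g => ∃ h, D s s' g h) ξ ξ') ∧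
      ∀ η η', (treeAction q R d).run (innerWord q R ρ) η η' ↔
        graphOf (fun s s' h => ∃ g, D s s' g h) η η' := by
  have hne : ∀ s : Slot p, R.word s.1.1 s.1.2 ≠ [] := fun s h =>
    hR.smallNoise.ne_nil s (List.map_eq_nil_iff.1 h)
  have hne' : ∀ s : Slot p, invRev (R.word s.1.1 s.1.2) ≠ [] := fun s h =>
    hne s (invRev_eq_nil.1 h)
  by_cases hX : ρ.IsX = true
  · by_cases hT : ρ.IsT = true
    · obtain ⟨m, rfl⟩ : ∃ m, ρ = .r3t m := by
        cases ρ <;> simp_all [Rel.IsT, Rel.IsX]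
      have hb : ∀ {w : Word}, (∀ c ∈ w, c.1.IsEdge) → w ≠ [] → ∀ ξ ξ',
          (treeAction q R d).run ([(.b m, true)] ++ w) ξ ξ' ↔ graphOf (fun s s' g =>
            s = m :: s' ∧ g = conjList q R s' (.mk w)) ξ ξ' := by
        intro w hw hw' ξ ξ'
        rw [PartialAction.run_append]
        constructor
        · rintro ⟨ζ, h1, h2⟩
          obtain ⟨m', h3, h4, h5⟩ := (PartialAction.run_singleton _ _ _ _).1 h1
          obtain rfl : m = m' := Fin.ext h3
          obtain ⟨s, h6, h7, h8⟩ := (run_iff_of_isEdge d hw hw' _ _).1 h2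
          refine ⟨m :: s, s, _, ⟨rfl, rfl⟩, ?_, h7, ?_⟩
          · rw [h4, h6]; rfl
          · rw [h8, h5]
        · rintro ⟨s, s', g, ⟨rfl, rfl⟩, h1, h2, h3⟩
          obtain ⟨v, f⟩ := ξ
          obtain ⟨v', f'⟩ := ξ'
          obtain rfl : v = posWord (m :: s') := h1
          obtain rfl : v' = posWord s' := h2
          obtain rfl : f' = f * _ := h3
          exact ⟨_, run_b d m (posWord s') f, run_of_isEdge d hw s' f⟩
      refine ⟨fun s s' g h => s = m :: s' ∧ g = conjList q R s' (.mk (R.word (.r3t m) 0)) ∧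
        h = conjList q R s' (.mk (invRev (R.word (.r3t m) 2))), ?_, fun ξ ξ' => ?_,
        fun ξ ξ' => ?_⟩
      -- At the vertex `b_m s` the letter `t` acts as its terminal word `ZtZ''` does at `s`.
      · rintro _ s g h ⟨rfl, rfl, rfl⟩
        rw [conjList, MonoidHom.comp_apply, conjHom_t, RipsWords.terminal,
          mk_append, mk_noise_of_isT (ρ := .r3t m) rfl, mk_invRev]
        simp only [Rel.head, ← FreeGroup.one_eq_mk, one_mul, map_mul, map_inv, mul_assoc,
          mul_inv_cancel, mul_one]
      · rw [outerWord_of_isT hT]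
        refine (hb (word_isEdge hX 0) (hne (slotFirst _)) ξ ξ').trans ?_
        simp [graphOf, and_assoc]
      · rw [innerWord_of_isT hT]
        refine (hb (forall_mem_invRev (word_isEdge hX 2)) (hne' (slotLast _)) ξ ξ').trans ?_
        simp [graphOf, and_assoc]
    · refine ⟨fun s s' g h => s = s' ∧ g = conjList q R s (.mk (R.word ρ 1)) ∧
        h = conjList q R s ((.of .t)⁻¹ * .mk (R.word ρ 1) * .of .t), ?_, fun ξ ξ' => ?_,
        fun ξ ξ' => ?_⟩
      · rintro _ s g h ⟨rfl, rfl, rfl⟩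
        simp only [map_mul, map_inv]
        group
      · rw [outerWord_of_not_isT hT]
        refine (run_iff_of_isEdge d (word_isEdge hX 1) (hne (slotMiddle ρ hT)) ξ ξ').trans ?_
        simp [graphOf, edgeStep]
      · have hrun : ∀ s f, (treeAction q R d).run (innerWord q R ρ) (posWord s, f)
            (posWord s, f * conjList q R s ((.of .t)⁻¹ * .mk (R.word ρ 1) * .of .t)) := by
          intro s f
          have h1 := run_of_isEdge (q := q) (R := R) d
            (forall_mem_invRev (word_isEdge (R := R) hX 0)) s f
          have h2 := run_inner_middle (q := q) (R := R) d hX hT s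
            (f * conjList q R s (.mk (invRev (R.word ρ 0))))
          have h3 := run_of_isEdge (q := q) (R := R) d
            (forall_mem_invRev (word_isEdge (R := R) hX 2)) s
            (f * conjList q R s (.mk (invRev (R.word ρ 0))) * conjList q R s (.mk (R.noise ρ)))
          have h4 : f * conjList q R s (.mk (invRev (R.word ρ 0))) *
              conjList q R s (.mk (R.noise ρ)) * conjList q R s (.mk (invRev (R.word ρ 2))) =
              f * conjList q R s ((.of .t)⁻¹ * .mk (R.word ρ 1) * .of .t) := by
            rw [mk_noise_of_not_isT hT, mk_invRev, mk_invRev]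
            simp only [map_mul, map_inv]
            group
          rw [h4] at h3
          rw [innerWord_of_not_isT hT]
          have h5 := (PartialAction.run_append _ _ _ _ _).2 ⟨_, h1,
            (PartialAction.run_append _ _ _ _ _).2 ⟨_, h2, h3⟩⟩
          simpa only [List.append_assoc] using h5
        constructor
        -- The first Rips word already forces the starting vertex to be positive; uniqueness of runs
        -- does the rest.
        · intro h
          have h' := h
          rw [innerWord_of_not_isT hT] at h'
          simp only [List.append_assoc] at h'
          obtain ⟨ζ, h1, -⟩ := (PartialAction.run_append _ _ _ _ _).1 h'
          obtain ⟨s, h2, -, -⟩ := (run_iff_of_isEdge d (forall_mem_invRev (word_isEdge hX 0))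
            (hne' (slotFirst ρ)) _ _).1 h1
          obtain ⟨v, f⟩ := ξ
          obtain rfl : v = posWord s := h2
          obtain rfl := PartialAction.run_right_unique _ h (hrun s f)
          exact ⟨s, s, _, ⟨_, rfl, rfl, rfl⟩, rfl, rfl, rfl⟩
        · rintro ⟨s, _, g, ⟨_, rfl, rfl, rfl⟩, h1, h2, h3⟩
          obtain ⟨v, f⟩ := ξ
          obtain ⟨v', f'⟩ := ξ'
          obtain rfl : v = posWord s := h1
          obtain rfl : v' = posWord s := h2
          obtain rfl : f' = f * _ := h3
          exact hrun s f
  · have hno : ∀ (u w v : Word) ξ ξ', (∀ c ∈ w, ∃ k, c.1 = .y k) → w ≠ [] →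
        ¬ (treeAction q R d).run (u ++ (w ++ v)) ξ ξ' := by
      intro u w v ξ ξ' h1 h2 h3
      obtain ⟨ζ, -, h4⟩ := (PartialAction.run_append _ _ _ _ _).1 h3
      obtain ⟨ζ', h5, -⟩ := (PartialAction.run_append _ _ _ _ _).1 h4
      exact not_run_y d h1 h2 _ _ h5
    refine ⟨fun _ _ _ _ => False, fun _ _ _ _ h => h.elim, fun ξ ξ' => ?_, fun ξ ξ' => ?_⟩
    · have : ¬ (treeAction q R d).run (outerWord R ρ) ξ ξ' := by
        by_cases hT : ρ.IsT = true
        · rw [outerWord_of_isT hT]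
          simpa using hno [(ρ.stable, true)] (R.word ρ 0) [] ξ ξ' (word_y hX 0) (hne (slotFirst ρ))
        · rw [outerWord_of_not_isT hT]
          simpa using hno [] (R.word ρ 1) [] ξ ξ' (word_y hX 1) (hne (slotMiddle ρ hT))
      simp [this, graphOf]
    · have : ¬ (treeAction q R d).run (innerWord q R ρ) ξ ξ' := by
        by_cases hT : ρ.IsT = true
        · rw [innerWord_of_isT hT]
          simpa using hno [(ρ.stable, true)] (invRev (R.word ρ 2)) [] ξ ξ'
            (forall_mem_invRev (P := fun l : Letter => ∃ k, l = Letter.y k) (word_y hX 2))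
            (hne' (slotLast ρ))
        · rw [innerWord_of_not_isT hT]
          simp only [List.append_assoc]
          exact hno [] (invRev (R.word ρ 0)) _ ξ ξ'
            (forall_mem_invRev (P := fun l : Letter => ∃ k, l = Letter.y k) (word_y hX 0))
            (hne' (slotFirst ρ))
      simp [this, graphOf]

/-- `x₁` and `x₂` are both defined exactly at the positive vertices, and fix these; `y₁` and `y₂`
are defined nowhere. -/
theorem treeAction_uniform (d : List (Fin (p + 1))) : (treeAction q R d).Uniform R.noiseList := by
  intro s a ha a' ha' e e' ξ η h
  obtain ⟨k, hk⟩ := RipsWords.mem_noiseList ha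
  obtain ⟨k', hk'⟩ := RipsWords.mem_noiseList ha'
  by_cases hX : s.1.1.IsX = true
  · rw [if_pos hX] at hk hk'
    subst hk hk'
    obtain ⟨r, h1, h2, h3⟩ := (signedStep_of_isEdge d (c := (.x k, e)) trivial _ _).1 h
    exact ⟨(posWord r, η.2 * conjList q R r (.mk [(.x k', e')])),
      (signedStep_of_isEdge d (c := (.x k', e')) trivial _ _).2 ⟨r, h2, rfl, rfl⟩⟩
  · rw [if_neg hX] at hk
    exact (not_run_y d (w := [(a, e)])
      (fun c hc => ⟨k, by rw [List.mem_singleton.1 hc, hk]⟩) (by simp) ξ η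
      ((PartialAction.run_singleton _ _ _ _).2 h)).elim

theorem respects_treeAction (hR : R.Admissible q) (d : List (Fin (p + 1))) :
    Respects q R (treeAction q R d) := by
  refine ⟨treeAction_uniform d, ?_, ?_, ?_, ?_⟩
  · rintro ⟨ρ, hρ⟩ ⟨v, f⟩ ⟨w, g⟩ ⟨w', g'⟩ ⟨s, h1, h2, h3⟩ h4
    obtain ⟨D, hD, ho, hi⟩ := exists_graph hR d ρ
    obtain ⟨s₁, s₂, y, ⟨x, hxy⟩, h5, h6, h7⟩ := (hi _ _).1 h4
    simp only at h1 h2 h3 h5 h6 h7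
    obtain rfl := posWord_injective (h2.symm.trans h5)
    refine ⟨(posWord s₂, f * x), (ho _ _).2 ⟨s, s₂, x, ⟨y, hxy⟩, h1, rfl, rfl⟩,
      s₂, rfl, h6, ?_⟩
    simp only [h7, h3, mul_assoc, hD _ _ _ _ hxy]
  · rintro ⟨ρ, hρ⟩ ⟨v, f⟩ ⟨w, g⟩ ⟨w', g'⟩ ⟨s, h1, h2, h3⟩ h4
    obtain ⟨D, hD, ho, hi⟩ := exists_graph hR d ρ
    obtain ⟨s₁, s₂, y, ⟨x, hxy⟩, h5, h6, h7⟩ := (hi _ _).1 h4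
    simp only at h1 h2 h3 h5 h6 h7
    obtain rfl := posWord_injective (h2.symm.trans h6)
    refine ⟨(posWord s₁, f * x⁻¹), (ho _ _).2 ⟨s₁, s, x, ⟨y, hxy⟩, rfl, h1, by simp⟩,
      s₁, rfl, h5, ?_⟩
    simp only
    have := hD _ _ _ _ hxy
    rw [← mul_left_inj y, ← h7, h3, mul_assoc, mul_assoc, this]
    simp
  · rintro ⟨ρ, hρ⟩ ⟨v, f⟩ ⟨v', f'⟩ ⟨w, g⟩ ⟨s, h1, h2, h3⟩ h4
    obtain ⟨D, hD, ho, hi⟩ := exists_graph hR d ρ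
    obtain ⟨s₁, s₂, x, ⟨y, hxy⟩, h5, h6, h7⟩ := (ho _ _).1 h4
    simp only at h1 h2 h3 h5 h6 h7
    obtain rfl := posWord_injective (h1.symm.trans h5)
    refine ⟨(posWord s₂, g * y), (hi _ _).2 ⟨s, s₂, y, ⟨x, hxy⟩, h2, rfl, rfl⟩,
      s₂, h6, rfl, ?_⟩
    simp only [h7, h3, mul_assoc, hD _ _ _ _ hxy]
  · rintro ⟨ρ, hρ⟩ ⟨v, f⟩ ⟨v', f'⟩ ⟨w, g⟩ ⟨s, h1, h2, h3⟩ h4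
    obtain ⟨D, hD, ho, hi⟩ := exists_graph hR d ρ
    obtain ⟨s₁, s₂, x, ⟨y, hxy⟩, h5, h6, h7⟩ := (ho _ _).1 h4
    simp only at h1 h2 h3 h5 h6 h7
    obtain rfl := posWord_injective (h1.symm.trans h6)
    refine ⟨(posWord s₁, g * y⁻¹), (hi _ _).2 ⟨s₁, s, y, ⟨x, hxy⟩, rfl, h2, by simp⟩,
      s₁, h5, rfl, ?_⟩
    simp only
    have := hD _ _ _ _ hxy
    rw [← mul_left_inj y, inv_mul_cancel_right, mul_assoc f', this, h3, h7, mul_assoc]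

theorem run_a_nil (f : FreeGroup Letter) :
    (treeAction q R []).run [(.a 0, true)] (1, f) (1, f * .of (.a 0)) := by
  simpa [posWord, pos, ← FreeGroup.one_eq_mk, weight] using
    run_a (q := q) (R := R) [] 1 [] (by simp) f

-- For `d = [m+1]` the letter `a₁` moves the vertex `1` to `b_{m+1}`, from which `b_{m+1}` leads
-- back; the weight of `d` cancels by the normalization in `treeStep`. For `m = p` take `d = []`.
variable (q R) in
theorem exists_run_initial (m : Fin (p + 1)) : ∃ d, ∀ f : FreeGroup Letter,
    (treeAction q R d).run (Rel.r1 m).initial (1, f) (1, f * .of (.a 0)) := by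
  induction m using Fin.lastCases with
  | last =>
    refine ⟨[], fun f => ?_⟩
    have : (Rel.r1 (Fin.last p)).initial = [(.a 0, true)] := by simp [Rel.initial, pos]
    rw [this]
    exact run_a_nil f
  | cast i =>
    refine ⟨[i.succ], fun f => ?_⟩
    have : (Rel.r1 i.castSucc).initial = [(.a 0, true)] ++ [(.b i.succ, true)] := by
      simp [Rel.initial, pos, i.2.ne]
    rw [this, PartialAction.run_append]
    have h := run_a (q := q) (R := R) [i.succ] 1 [i.succ] (by simp) f
    rw [mul_assoc, inv_mul_cancel, mul_one] at h
    exact ⟨_, h, run_b [i.succ] i.succ 1 _⟩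

end Tree

/-! ### Initial and terminal words of the letters `b_j` -/

section Rows

variable {p q : ℕ} {R : RipsWords p}

theorem clean_a (i : Fin 2) : (Letter.a i).Clean := fun k => by simp

theorem clean_t : Letter.t.Clean := fun k => by simp

theorem slotFirst_injective : Function.Injective (slotFirst (p := p)) := fun _ _ h =>
  congrArg (fun s : Slot p => s.1.1) h

theorem slotLast_injective : Function.Injective (slotLast (p := p)) := fun _ _ h =>
  congrArg (fun s : Slot p => s.1.1) h

theorem slotFirst_ne_slotLast (ρ ρ' : Rel p) : slotFirst ρ ≠ slotLast ρ' := fun h =>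
  absurd (congrArg (fun s : Slot p => s.1.2) h) (show (0 : Fin 3) ≠ 2 by decide)

/-- The first block of a terminal word. -/
def terminalFirst : Rel p → (Letter ⊕ Slot p)
  | .r1 _ => .inl (.a 0)
  | .r2 _ => .inl (.a 1)
  | .r3t m => .inr (slotFirst (.r3t m))
  | .r3x m k => .inr (slotFirst (.r3x m k))
  | .r4t i => .inr (slotFirst (.r4t i))
  | .r4y i k => .inr (slotFirst (.r4y i k))

theorem eq_of_terminalFirst_eq {ρ ρ' : Rel p} (hs : ρ.stable = ρ'.stable)
    (h : terminalFirst ρ = terminalFirst ρ') : ρ = ρ' := by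
  cases ρ <;> cases ρ' <;>
    simp_all [terminalFirst, Rel.stable, slotFirst_injective.eq_iff, Fin.ext_iff]

/-- Within a row the first blocks are `a₁`, `a₂` and different slots. The last blocks are slots at
place `2`, which never stand at the beginning. -/
theorem noCancel_terminal (s : Letter) :
    NoCancel R.noiseList (fun ρ : {ρ : Rel p // ρ.stable = s} => terminalBlocks q ρ.1)
      (fun ρ => (terminalFirst ρ.1, true)) (fun ρ => (.inr (slotLast ρ.1), true)) := by
  have hclean : ∀ (ρ : Rel p) a, terminalFirst ρ = .inl a → a.Clean := by
    intro ρ a h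
    cases ρ <;> simp only [terminalFirst, reduceCtorEq, Sum.inl.injEq] at h
    all_goals subst h; exact clean_a _
  have hslot : ∀ ρ ρ' : Rel p, terminalFirst ρ ≠ .inr (slotLast ρ') := by
    intro ρ ρ' h
    cases ρ <;> simp [terminalFirst, slotFirst_ne_slotLast] at h
  refine ⟨?_, ?_, ?_, fun ρ a h s => (hclean _ _ h).notMem s, fun ρ a h => by simp at h, ?_, ?_,
    fun ρ ρ' h => (hslot _ _ h.symm).elim⟩
  · rintro ⟨ρ, -⟩
    cases ρ with
    | r1 m =>
      by_cases h2 : (m : ℕ) + 1 = q <;>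
        simp [terminalBlocks, Rel.IsT, Rel.head, ofWord, pos, h2, blockRel_inl, blockRel_inl_inr,
          blockRel_inr_inl, clean_a, clean_t]
    | _ =>
      simp [terminalBlocks, Rel.IsT, Rel.head, ofWord, pos, blockRel_inl_inr, blockRel_inr_inl,
        clean_a, clean_t]
  · rintro ⟨ρ, -⟩
    cases ρ with
    | r1 m =>
      by_cases h2 : (m : ℕ) + 1 = q <;>
        simp [terminalBlocks, Rel.head, ofWord, pos, h2, terminalFirst]
    | _ => simp [terminalBlocks, Rel.IsT, Rel.head, ofWord, pos, terminalFirst]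
  · rintro ⟨ρ, -⟩
    by_cases h : ρ.IsT = true <;> simp [terminalBlocks, h]
  · rintro ⟨ρ, hρ⟩ ⟨ρ', hρ'⟩ h
    subst hρ
    exact Subtype.ext (eq_of_terminalFirst_eq hρ'.symm h)
  · rintro ⟨ρ, hρ⟩ ⟨ρ', hρ'⟩ h
    exact Subtype.ext (slotLast_injective (Sum.inr_injective h))

theorem terminal_injective_of_stable (hR : R.Admissible q) {ι : Type*} {ρ : ι → Rel p} {s : Letter}
    (hρ : Function.Injective ρ) (hs : ∀ i, (ρ i).stable = s) :
    Function.Injective (FreeGroup.lift fun i => FreeGroup.mk (R.terminal q (ρ i))) := by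
  have := ((noCancel_terminal (R := R) (q := q) s).comp (g := fun i => ⟨ρ i, hs i⟩)
    fun i j h => hρ (congrArg Subtype.val h)).injective hR.smallNoise
  simpa only [subst_terminalBlocks] using this

theorem Rel.bRow_injective (m : Fin (p + 1)) : Function.Injective (Rel.bRow m) := by
  intro k l h
  fin_cases k <;> fin_cases l <;> simp_all [Rel.bRow]

theorem Rel.aRow_injective (i : Fin 2) : Function.Injective (Rel.aRow (p := p) i) := by
  intro k l h
  fin_cases k <;> fin_cases l <;> simp_all [Rel.aRow]

theorem Rel.stable_bRow (m : Fin (p + 1)) (k : Fin 5) : (Rel.bRow m k).stable = .b m := by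
  fin_cases k <;> rfl

theorem Rel.stable_aRow (i : Fin 2) (k : Fin 3) : (Rel.aRow (p := p) i k).stable = .a i := by
  fin_cases k <;> rfl

/-! ### Freeness in `THnn` from the tree action -/

/-- Words that move a vertex freely freely generate a subgroup. -/
theorem Respects.injective (hR : R.Admissible q) {Ξ : Type} {𝒜 : PartialAction Letter Ξ}
    (h : Respects q R 𝒜) {ι : Type*} {W : ι → Word} {G : Type*} [Group G] {g : ι → G}
    (hg : Function.Injective (FreeGroup.lift g)) {e : G → Ξ} (he : Function.Injective e)
    (hW : ∀ i f, 𝒜.run (W i) (e f) (e (f * g i))) :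
    Function.Injective (FreeGroup.lift fun i => FreeGroup.lift (tLetter hR) (.mk (W i))) := by
  rw [injective_iff_map_eq_one]
  intro v hv
  obtain ⟨w, rfl⟩ : ∃ w, FreeGroup.mk w = v := Quot.exists_rep v
  have hlift : FreeGroup.lift (fun i => FreeGroup.lift (tLetter hR) (.mk (W i))) (.mk w) =
      FreeGroup.lift (tLetter hR) (.mk (w.flatMap (signedWord W))) := by
    rw [mk_signedWord, ← MonoidHom.comp_apply]
    congr 1
    ext i
    simp
  have hrun : ∀ f, 𝒜.run (w.flatMap (signedWord W)) (e f) (e (f * FreeGroup.lift g (.mk w))) := by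
    clear hv hlift
    induction w with
    | nil => intro f; simp [← FreeGroup.one_eq_mk]
    | cons c w ih =>
      intro f
      rw [List.flatMap_cons, 𝒜.run_append]
      refine ⟨e (f * FreeGroup.lift g (.mk [c])), ?_, ?_⟩
      · obtain ⟨i, _ | _⟩ := c
        · simp only [signedWord, Bool.false_eq_true, if_false, 𝒜.run_invRev]
          simpa [mk_singleton_false] using hW i (f * (g i)⁻¹)
        · simpa [signedWord, mk_singleton_true] using hW i f
      · rw [show FreeGroup.mk (c :: w) = FreeGroup.mk [c] * FreeGroup.mk w from mk_append [c] w,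
          map_mul, ← mul_assoc]
        exact ih _
  rw [hlift] at hv
  have h1 := he (h.eq_of_run hR (hrun 1) hv)
  rw [one_mul] at h1
  exact (injective_iff_map_eq_one _).1 hg _ h1.symm

/-- For suitable `d` the five words fix the vertex `1` and multiply the second coordinate by `a₁,
a₂, t, x₁, x₂`. -/
theorem initial_injective (hR : R.Admissible q) (m : Fin (p + 1)) :
    Function.Injective (FreeGroup.lift fun k =>
      FreeGroup.lift (tLetter hR) (.mk (Rel.bRow m k).initial)) := by
  obtain ⟨d, hd⟩ := exists_run_initial q R m
  have h1 : Function.Injective (![.a 0, .a 1, .t, .x 0, .x 1] : Fin 5 → Letter) := by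
    intro k l h
    fin_cases k <;> fin_cases l <;> simp_all
  refine (respects_treeAction hR d).injective hR
    (g := fun k => FreeGroup.of ((![.a 0, .a 1, .t, .x 0, .x 1] : Fin 5 → Letter) k))
    (e := fun f => (1, f)) ?_ (fun f g h => (Prod.ext_iff.1 h).2) ?_
  · convert FreeGroup.map_injective h1 using 2
    ext k
    simp
  · have h2 : ∀ l : Letter, l.IsEdge → ∀ f : FreeGroup Letter,
        (treeAction q R d).run (pos [l]) (1, f) (1, f * .of l) := fun l hl f =>
      run_of_isEdge d (w := pos [l]) (by simpa [pos]) [] f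
    intro k f
    fin_cases k
    · exact hd f
    · exact h2 (.a 1) rfl f
    · exact h2 .t trivial f
    · exact h2 (.x 0) trivial f
    · exact h2 (.x 1) trivial f

/-- For `d = []` also `a₁` fixes the vertex `1`, with weight `1`, so all these letters act there as
right multiplication by themselves. -/
theorem run_nil_of_notMem {w : Word} (hw : ∀ c ∈ w, (∀ j, c.1 ≠ .b j) ∧ ∀ k, c.1 ≠ .y k)
    (f : FreeGroup Letter) : (treeAction q R []).run w (1, f) (1, f * .mk w) := by
  have h1 : ∀ l : Letter, (∀ j, l ≠ .b j) → (∀ k, l ≠ .y k) → ∀ f : FreeGroup Letter,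
      (treeAction q R []).run [(l, true)] (1, f) (1, f * .of l) := by
    intro l hb hy f
    cases l with
    | a i =>
      fin_cases i
      · exact run_a_nil f
      · exact run_of_isEdge [] (w := [(.a 1, true)]) (by simp [Letter.IsEdge]) [] f
    | b j => exact (hb j rfl).elim
    | y k => exact (hy k rfl).elim
    | t => exact run_of_isEdge [] (w := [(.t, true)]) (by simp [Letter.IsEdge]) [] f
    | x k => exact run_of_isEdge [] (w := [(.x k, true)]) (by simp [Letter.IsEdge]) [] f
  induction w generalizing f with
  | nil => simp [← FreeGroup.one_eq_mk]
  | cons c w ih =>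
    have hc := hw c (by simp)
    rw [← List.singleton_append, PartialAction.run_append]
    refine ⟨(1, f * .mk [c]), ?_, ?_⟩
    · obtain ⟨l, _ | _⟩ := c
      · have h2 := h1 l hc.1 hc.2 (f * (.of l)⁻¹)
        rw [inv_mul_cancel_right] at h2
        rw [← PartialAction.run_invRev] at h2
        exact h2
      · exact h1 l hc.1 hc.2 f
    · rw [mk_append, ← mul_assoc]
      exact ih (fun c hc => hw c (by simp [hc])) _

theorem mem_head {ρ : Rel p} {c : Letter × Bool} (hc : c ∈ ρ.head q) :
    (∃ i, c.1 = .a i) ∧ c.1 ≠ ρ.stable := by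
  cases ρ <;> simp only [Rel.head] at hc <;> (try split at hc) <;>
    simp [pos] at hc <;> simp only [Rel.stable] <;> aesop

theorem mem_terminal {ρ : Rel p} {c : Letter × Bool} (hc : c ∈ R.terminal q ρ) :
    c ∈ ρ.head q ∨ c.1 = .t ∨ ∃ k, c.1 = if ρ.IsX then .x k else .y k := by
  have hword : ∀ s, c ∈ R.word ρ s → ∃ k, c.1 = if ρ.IsX then .x k else .y k := by
    intro s hs
    obtain ⟨k, hk⟩ := mem_ripsSubword (mem_pos.1 hs).1
    exact ⟨k, hk.trans (noiseLetters_apply _ _)⟩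
  rw [RipsWords.terminal, List.mem_append] at hc
  rcases hc with hc | hc
  · exact .inl hc
  · right
    unfold RipsWords.noise at hc
    split at hc <;> simp only [List.mem_append, List.mem_singleton] at hc
    · rcases hc with (hc | rfl) | hc
      · exact .inr (hword _ hc)
      · exact .inl rfl
      · exact .inr (hword _ hc)
    · rcases hc with (((hc | rfl) | hc) | rfl) | hc
      · exact .inr (hword _ hc)
      · exact .inl rfl
      · exact .inr (hword _ hc)
      · exact .inl rfl
      · exact .inr (hword _ hc)

theorem Rel.isX_bRow {m : Fin (p + 1)} (hm : (m : ℕ) ≠ 0) (k : Fin 5) :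
    (Rel.bRow m k).IsX = true := by
  fin_cases k <;> simp [Rel.bRow, Rel.IsX, hm]

/-- The terminal words act at the vertex `1` by multiplication with their values in the free group
on all letters, where they are free. For `m = 0` they would contain the undefined `y`s. -/
theorem terminal_injective_of_ne_zero (hR : R.Admissible q) {m : Fin (p + 1)} (hm : (m : ℕ) ≠ 0) :
    Function.Injective (FreeGroup.lift fun k =>
      FreeGroup.lift (tLetter hR) (.mk (R.terminal q (Rel.bRow m k)))) := by
  refine (respects_treeAction hR []).injective hR (e := fun f => (1, f))
    (terminal_injective_of_stable hR (Rel.bRow_injective m) (Rel.stable_bRow m))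
    (fun f g h => (Prod.ext_iff.1 h).2) fun k f => run_nil_of_notMem (fun c hc => ?_) f
  have := mem_terminal hc
  simp only [if_pos (Rel.isX_bRow hm k)] at this
  obtain h | h | ⟨k, h⟩ := this
  · obtain ⟨i, h⟩ := (mem_head h).1
    simp [h]
  · simp [h]
  · simp [h]

end Rows

/-! ### A free subgroup which contains the terminal words of `b₀` -/

section FirstRow

/-- Elements of the vertex group that freely generate a subgroup which has trivial intersection
with the associated subgroups generate, together with the stable letter, a free group. -/
theorem hnnExtension_lift_injective {G : Type*} [Group G] {A B : Subgroup G} {φ : A ≃* B}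
    {ι : Type*} {g : ι → G} (hg : Function.Injective (FreeGroup.lift g))
    (hA : ∀ u, FreeGroup.lift g u ∈ A → u = 1) (hB : ∀ u, FreeGroup.lift g u ∈ B → u = 1) :
    Function.Injective (FreeGroup.lift (Sum.elim (fun i => HNNExtension.of (g i))
      (fun _ : Unit => (HNNExtension.t : HNNExtension G A B φ)))) := by
  -- The free group acts on itself by right translation; elements of `G` outside the free subgroup
  -- act nowhere.
  set Rd : G → FreeGroup (ι ⊕ Unit) → FreeGroup (ι ⊕ Unit) → Prop :=
    fun x ξ η => ∃ u, FreeGroup.lift g u = x ∧ η = ξ * FreeGroup.map Sum.inl u with hRd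
  set T : FreeGroup (ι ⊕ Unit) → FreeGroup (ι ⊕ Unit) → Prop :=
    fun ξ η => η = ξ * .of (.inr ()) with hT
  have hread : Readable φ Rd T := by
    refine ⟨fun ξ η => ⟨?_, ?_⟩, ?_, ?_, ?_⟩
    · rintro ⟨u, hu, rfl⟩
      simp [(injective_iff_map_eq_one _).1 hg u hu]
    · rintro rfl
      exact ⟨1, by simp, by simp⟩
    · rintro _ _ ξ η ζ ⟨u, rfl, rfl⟩ ⟨v, rfl, rfl⟩
      exact ⟨u * v, by simp, by simp [mul_assoc]⟩
    · rintro ⟨a, ha⟩ ξ η ξ' η' h1 ⟨u, rfl, rfl⟩ h3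
      -- A pinched element lies both in `A` and in the free subgroup, so all pinches are trivial.
      obtain rfl := hA u ha
      obtain rfl : ξ' = ξ := mul_right_cancel (h3.symm.trans (by simpa using h1))
      refine ⟨1, ?_, by simp⟩
      have : (⟨FreeGroup.lift g 1, ha⟩ : A) = 1 := Subtype.ext (by simp)
      rw [this, map_one, map_one]
      rfl
    · rintro ⟨a, ha⟩ ξ η ξ' η' h1 ⟨u, rfl, rfl⟩ h3
      obtain rfl := hB u ha
      obtain rfl : η' = η := h3.trans (by rw [h1]; simp)
      refine ⟨1, ?_, by simp⟩
      have : (⟨FreeGroup.lift g 1, ha⟩ : B) = 1 := Subtype.ext (by simp)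
      rw [this, map_one, map_one]
      rfl
  have hreach : ∀ v ξ, Reach φ Rd T (FreeGroup.lift (Sum.elim (fun i => HNNExtension.of (g i))
      (fun _ : Unit => (HNNExtension.t : HNNExtension G A B φ))) v) ξ (ξ * v) := by
    intro v
    induction v using FreeGroup.induction_on with
    | C1 =>
      intro ξ
      rw [map_one, ← map_one HNNExtension.of]
      exact .of ⟨1, by simp, by simp⟩
    | of c =>
      intro ξ
      rcases c with i | _
      · simp only [FreeGroup.lift_apply_of, Sum.elim_inl]
        exact .of ⟨.of i, by simp, by simp⟩
      · simp only [FreeGroup.lift_apply_of, Sum.elim_inr]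
        exact .t rfl
    | inv_of c _ =>
      intro ξ
      rcases c with i | _
      · simp only [map_inv, FreeGroup.lift_apply_of, Sum.elim_inl]
        rw [← map_inv]
        exact .of ⟨(.of i)⁻¹, by simp, by simp⟩
      · simp only [map_inv, FreeGroup.lift_apply_of, Sum.elim_inr]
        exact .t_inv (by simp [T])
    | mul u v hu hv =>
      intro ξ
      rw [map_mul, ← mul_assoc]
      exact .mul (hu ξ) (hv _)
  rw [injective_iff_map_eq_one]
  intro v hv
  have h1 := hread.eq_of_reach_one (hv ▸ hreach v 1)
  rw [one_mul] at h1
  exact h1.symm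

variable {p q : ℕ} {R : RipsWords p}

/-- Letters not in Rips words, and the Rips words in the relators with `b₀`. -/
abbrev RowIndex (p : ℕ) := {l : Letter // l.Clean} ⊕ {s : Slot p // s.1.1.stable = .b 0}

/-- They belong to a larger basis. -/
def RowIndex.toMixed : RowIndex p → MixedIndex p := Sum.map id Sum.inl

variable (R) in
/-- The corresponding elements of the free group. -/
def rowElt : RowIndex p → FreeGroup Letter :=
  Sum.elim (fun l => .of l.1) fun s => .mk (R.word s.1.1.1 s.1.1.2)

theorem lift_rowElt (C : Rel p → BlockWord Letter (Slot p)) (u : FreeGroup (RowIndex p)) :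
    FreeGroup.lift (rowElt R) u =
      FreeGroup.lift (fun i => .mk (subst R.noiseList (mixedBlocks C i)))
        (FreeGroup.map RowIndex.toMixed u) := by
  rw [← MonoidHom.comp_apply]
  congr 1
  ext i
  rcases i with l | s
  · simp [rowElt, RowIndex.toMixed, mixedBlocks, subst_singleton, blockWord]; rfl
  · simp [rowElt, RowIndex.toMixed, mixedBlocks, subst_singleton, blockWord_slot]

theorem RowIndex.toMixed_injective : Function.Injective (RowIndex.toMixed (p := p)) :=
  Sum.map_injective.2 ⟨Function.injective_id, Sum.inl_injective⟩

theorem Central.rowElt_injective (hR : R.Admissible q) {C : Rel p → BlockWord Letter (Slot p)}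
    {f l : Rel p → Slot p × Bool} (h : Central R C f l) :
    Function.Injective (FreeGroup.lift (rowElt R)) := by
  intro u v huv
  rw [lift_rowElt C, lift_rowElt C] at huv
  exact FreeGroup.map_injective RowIndex.toMixed_injective
    (h.noCancel_mixed.injective hR.smallNoise huv)

/-- In the mixed basis every generator of the associated subgroup contains a basis element of its
own, `C ρ`, and row elements contain none of these. Projection to these basis elements is thus
injective on the associated subgroup and trivial on the row elements. -/
theorem Central.rowElt_eq_one (hR : R.Admissible q) {C : Rel p → BlockWord Letter (Slot p)}
    {f l : Rel p → Slot p × Bool} (h : Central R C f l) (u : FreeGroup (RowIndex p))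
    (hu : FreeGroup.lift (rowElt R) u ∈ (FreeGroup.lift fun ρ : ActiveRel p =>
      FreeGroup.mk (subst R.noiseList (withStable C ρ.1))).range) : u = 1 := by
  obtain ⟨v, hv⟩ := hu
  -- A prefixed letter `s` is split off, being a basis element itself.
  set b : ActiveRel p → FreeGroup (MixedIndex p) := fun ρ =>
    if ρ.1.IsT = true then .of (.inl ⟨ρ.1.stable, ρ.1.clean_stable⟩) * .of (.inr (.inr ρ))
    else .of (.inr (.inr ρ)) with hb
  have h1 : FreeGroup.lift (fun ρ : ActiveRel p =>
      FreeGroup.mk (subst R.noiseList (withStable C ρ.1))) v =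
      FreeGroup.lift (fun i => .mk (subst R.noiseList (mixedBlocks C i))) (FreeGroup.lift b v) := by
    rw [← MonoidHom.comp_apply]
    congr 1
    ext ρ
    simp only [FreeGroup.lift_apply_of, MonoidHom.comp_apply, hb, withStable]
    split
    · rw [← List.singleton_append, subst_append, mk_append]
      simp [mixedBlocks, subst_singleton, blockWord]
    · simp [mixedBlocks]
  rw [h1, lift_rowElt C] at hv
  have h2 := h.noCancel_mixed.injective hR.smallNoise hv
  set κ : FreeGroup (MixedIndex p) →* FreeGroup (ActiveRel p) :=
    FreeGroup.lift (Sum.elim (fun _ => 1) (Sum.elim (fun _ => 1) .of)) with hκ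
  have h3 : κ (FreeGroup.lift b v) = v := by
    have : κ.comp (FreeGroup.lift b) = MonoidHom.id _ := by
      ext ρ
      simp only [FreeGroup.lift_apply_of, MonoidHom.comp_apply, hb, hκ]
      split <;> simp
    exact DFunLike.congr_fun this v
  have h4 : κ (FreeGroup.map RowIndex.toMixed u) = 1 := by
    have : κ.comp (FreeGroup.map RowIndex.toMixed) = 1 := by
      ext i
      rcases i with l | s <;> simp [hκ, RowIndex.toMixed]
    exact DFunLike.congr_fun this u
  have h5 : v = 1 := by rw [← h3, h2, h4]
  rw [h5, map_one] at h2
  exact FreeGroup.map_injective RowIndex.toMixed_injective (h2.symm.trans (map_one _).symm)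

/-- The terminal words of `b₀` are products of `a₁, a₂`, their Rips words and `t^{±1}`, which freely
generate a subgroup of `THnn`. -/
theorem terminal_injective_of_zero (hR : R.Admissible q) :
    Function.Injective (FreeGroup.lift fun ρ : {ρ : Rel p // ρ.stable = .b 0} =>
      FreeGroup.lift (tLetter hR) (.mk (R.terminal q ρ.1))) := by
  set Ψ := FreeGroup.lift (Sum.elim (fun i => HNNExtension.of (rowElt R i))
      (fun _ : Unit => (HNNExtension.t : THnn hR))) with hΨ
  have hinj : Function.Injective Ψ :=
    hnnExtension_lift_injective (central_outer.rowElt_injective hR)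
      (fun u => (central_inner q).rowElt_eq_one hR u) (fun u => central_outer.rowElt_eq_one hR u)
  -- Keep the first Rips word of each relator and kill all other basis elements. Each terminal word
  -- contains just one first Rips word, its own.
  set r : FreeGroup (RowIndex p ⊕ Unit) →* FreeGroup {ρ : Rel p // ρ.stable = .b 0} :=
    FreeGroup.lift (Sum.elim (Sum.elim (fun _ => 1)
      (fun s => if s.1.1.2 = 0 then .of ⟨s.1.1.1, s.2⟩ else 1)) fun _ => 1) with hr
  have hmul : ∀ {x y : THnn hR} {e f}, (∃ u, Ψ u = x ∧ r u = e) → (∃ u, Ψ u = y ∧ r u = f) →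
      ∃ u, Ψ u = x * y ∧ r u = e * f := by
    rintro _ _ _ _ ⟨u, rfl, rfl⟩ ⟨v, rfl, rfl⟩
    exact ⟨u * v, map_mul _ _ _, map_mul _ _ _⟩
  have hword : ∀ (ρ : Rel p) (hρ : ρ.stable = .b 0) (s : Fin 3) (hs : ρ.IsSlot s),
      ∃ u, Ψ u = FreeGroup.lift (tLetter hR) (.mk (R.word ρ s)) ∧
        r u = if s = 0 then .of ⟨ρ, hρ⟩ else 1 := by
    intro ρ hρ s hs
    refine ⟨.of (.inl (.inr ⟨⟨(ρ, s), hs⟩, hρ⟩)), ?_, by simp [hr]⟩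
    rw [lift_tLetter hR (word_ne_t ρ s hs)]
    simp [hΨ, rowElt]
  have ha : ∀ i, ∃ u, Ψ u = FreeGroup.lift (tLetter hR) (.of (.a i)) ∧ r u = 1 := by
    intro i
    refine ⟨.of (.inl (.inl ⟨.a i, clean_a i⟩)), ?_, by simp [hr]⟩
    simp [hΨ, rowElt, tLetter]
  have hhead : ∀ ρ : Rel p, ∃ u, Ψ u = FreeGroup.lift (tLetter hR) (.mk (ρ.head q)) ∧ r u = 1 := by
    have h0 : ∃ u, Ψ u = FreeGroup.lift (tLetter hR) (.mk []) ∧ r u = 1 :=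
      ⟨1, by simp [← FreeGroup.one_eq_mk], map_one _⟩
    intro ρ
    cases ρ with
    | r1 m =>
      simp only [Rel.head]
      split
      · have := hmul (ha 0) (ha 1)
        rw [← map_mul, mul_one] at this
        exact this
      · exact ha 0
    | r2 m => exact ha 1
    | _ => exact h0
  have hterm : ∀ ρ : {ρ : Rel p // ρ.stable = .b 0}, ∃ u,
      Ψ u = FreeGroup.lift (tLetter hR) (.mk (R.terminal q ρ.1)) ∧ r u = .of ρ := by
    rintro ⟨ρ, hρ⟩
    have ht : ∃ u, Ψ u = FreeGroup.lift (tLetter hR) (.of .t) ∧ r u = 1 :=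
      ⟨.of (.inr ()), by simp [hΨ, tLetter], by simp [hr]⟩
    have ht' : ∃ u, Ψ u = (FreeGroup.lift (tLetter hR) (.of .t))⁻¹ ∧ r u = 1 :=
      ⟨(.of (.inr ()))⁻¹, by simp [hΨ, tLetter], by simp [hr]⟩
    have h0 := hword ρ hρ 0 (slotFirst ρ).2
    have h2 := hword ρ hρ 2 (slotLast ρ).2
    rw [if_neg (by decide)] at h2
    rw [if_pos rfl] at h0
    by_cases hT : ρ.IsT = true
    · have := hmul (hhead ρ) (hmul (hmul h0 ht) h2)
      rw [RipsWords.terminal, mk_append, mk_noise_of_isT hT]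
      simpa only [map_mul, map_inv, one_mul, mul_one, mul_assoc] using this
    · have h1 := hword ρ hρ 1 (slotMiddle ρ hT).2
      rw [if_neg (by decide)] at h1
      have := hmul (hhead ρ) (hmul (hmul (hmul (hmul h0 ht') h1) ht) h2)
      rw [RipsWords.terminal, mk_append, mk_noise_of_not_isT hT]
      simpa only [map_mul, map_inv, one_mul, mul_one, mul_assoc] using this
  choose τ h1 h2 using hterm
  have h3 : FreeGroup.lift (fun ρ : {ρ : Rel p // ρ.stable = .b 0} =>
      FreeGroup.lift (tLetter hR) (.mk (R.terminal q ρ.1))) = Ψ.comp (FreeGroup.lift τ) := by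
    ext ρ
    simp [h1]
  have h4 : r.comp (FreeGroup.lift τ) = MonoidHom.id _ := by
    ext ρ
    simp [h2]
  rw [h3, MonoidHom.coe_comp]
  exact hinj.comp (Function.LeftInverse.injective (DFunLike.congr_fun h4))

theorem terminal_injective (hR : R.Admissible q) (m : Fin (p + 1)) :
    Function.Injective (FreeGroup.lift fun k =>
      FreeGroup.lift (tLetter hR) (.mk (R.terminal q (Rel.bRow m k)))) := by
  by_cases hm : (m : ℕ) = 0
  · have h1 : ∀ k, (Rel.bRow m k).stable = .b 0 := fun k => by rw [Rel.stable_bRow, hm]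
    have h2 : Function.Injective
        (fun k => (⟨Rel.bRow m k, h1 k⟩ : {ρ : Rel p // ρ.stable = .b 0})) :=
      fun k l h => Rel.bRow_injective m (congrArg Subtype.val h)
    have h3 := (terminal_injective_of_zero hR).comp (FreeGroup.map_injective h2)
    convert h3 using 1
    rw [← MonoidHom.coe_comp]
    congr 1
    ext k
    simp
  · exact terminal_injective_of_ne_zero hR hm

end FirstRow

/-! ### The presentations -/

section Presentations

theorem gen_hom_ext {G H : Type*} [Group G] [Group H] {n : ℕ} {g : Fin n → G} {f f' : gen g →* H}
    (h : ∀ k, f (genElt g k) = f' (genElt g k)) : f = f' := by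
  refine MonoidHom.eq_of_eqOn_dense (Subgroup.closure_closure_coe_preimage (k := Set.range g)) ?_
  rintro ⟨_, hx⟩ ⟨k, rfl⟩
  exact h k

theorem exists_map_val_eq {A : Set Letter} {w : Word} (hw : ∀ c ∈ w, c.1 ∈ A) :
    ∃ r : FreeGroup A, FreeGroup.map Subtype.val r = .mk w := by
  induction w with
  | nil => exact ⟨1, by simp [← FreeGroup.one_eq_mk]⟩
  | cons c w ih =>
    obtain ⟨r, hr⟩ := ih fun c hc => hw c (by simp [hc])
    exact ⟨.mk [(⟨c.1, hw c (by simp)⟩, c.2)] * r, by rw [map_mul, hr]; rfl⟩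

/-- The interpretation of the letters, where those outside the alphabet are ignored. -/
noncomputable def extend {G : Type*} [Group G] {A : Set Letter} (f : A → G) (l : Letter) : G :=
  evalOn f (pos [l])

theorem evalOn_eq {G : Type*} [Group G] {A : Set Letter} (f : A → G) (w : Word) :
    evalOn f w = FreeGroup.lift (extend f) (.mk w) := by
  unfold evalOn
  congr 2
  ext l
  simp [extend, evalOn, pos]

theorem extend_of_mem {G : Type*} [Group G] {A : Set Letter} (f : A → G) {l : Letter} (hl : l ∈ A) :
    extend f l = f ⟨l, hl⟩ := by
  simp [extend, evalOn, pos, hl]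

theorem lift_congr {G : Type*} [Group G] {f f' : Letter → G} {w : Word}
    (h : ∀ c ∈ w, f c.1 = f' c.1) :
    FreeGroup.lift f (.mk w) = FreeGroup.lift f' (.mk w) := by
  rw [FreeGroup.lift_mk, FreeGroup.lift_mk]
  congr 1
  refine List.map_congr_left fun c hc => ?_
  rw [h c hc]

theorem lift_extend_map {G : Type*} [Group G] {A : Set Letter} (f : A → G) (r : FreeGroup A) :
    FreeGroup.lift (extend f) (.map Subtype.val r) = FreeGroup.lift f r := by
  rw [← MonoidHom.comp_apply]
  congr 1
  ext l
  simp [extend_of_mem f l.2]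

theorem map_evalOn {G H : Type*} [Group G] [Group H] {A : Set Letter} (f : A → G) (θ : G →* H)
    {g : Letter → H} (h : ∀ l : A, θ (f l) = g l) {w : Word} (hw : ∀ c ∈ w, c.1 ∈ A) :
    θ (evalOn f w) = FreeGroup.lift g (.mk w) := by
  have h1 : θ (evalOn f w) = FreeGroup.lift (fun l => θ (extend f l)) (.mk w) := by
    rw [evalOn_eq, ← MonoidHom.comp_apply]
    congr 1
    ext l
    simp
  rw [h1]
  exact lift_congr fun c hc => by rw [extend_of_mem f (hw c hc), h]

/-! ### Relators, alphabets and homomorphisms of the stages -/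

variable {p q : ℕ} {R : RipsWords p}

theorem lift_relator_eq_one_iff {G : Type*} [Group G] (f : Letter → G) (ρ : Rel p) :
    FreeGroup.lift f (.mk (R.relator q ρ)) = 1 ↔
      (f ρ.stable)⁻¹ * FreeGroup.lift f (.mk ρ.initial) * f ρ.stable =
        FreeGroup.lift f (.mk (R.terminal q ρ)) := by
  rw [RipsWords.relator, mk_append, mk_append, mk_append, mk_invRev, mk_singleton_true,
    mk_singleton_false]
  simp only [map_mul, map_inv, FreeGroup.lift_apply_of]
  rw [mul_inv_eq_one]

/-- The first letter of the initial word. -/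
def initialLetter : Rel p → Letter
  | .r1 _ => .a 0
  | .r2 _ => .a 1
  | .r3t _ => .t
  | .r3x _ k => .x k
  | .r4t _ => .t
  | .r4y _ k => .y k

theorem initialLetter_ne_stable (ρ : Rel p) : initialLetter ρ ≠ ρ.stable := by
  cases ρ <;> simp [initialLetter, Rel.stable]

theorem stable_notMem_terminal (ρ : Rel p) : ∀ c ∈ R.terminal q ρ, c.1 ≠ ρ.stable := by
  intro c hc
  obtain h | h | ⟨k, h⟩ := mem_terminal hc
  · exact (mem_head h).2
  · exact h ▸ (stable_ne_t ρ).symm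
  · have h1 := ρ.clean_stable k
    rw [h]
    split
    · exact h1.1.symm
    · exact h1.2.symm

/-- Relators on an alphabet contain their conjugating letter. -/
theorem stable_mem_of_map_eq {A : Set Letter} {r : FreeGroup A} {ρ : Rel p}
    (h : FreeGroup.map Subtype.val r = .mk (R.relator q ρ)) : ρ.stable ∈ A := by
  classical
  by_contra hA
  -- A test in the symmetric group, which avoids any discussion of reduced forms. If `s` were
  -- outside the alphabet, the value of the relator could not depend on the image `σ` of `s`; but
  -- the conjugate of `(0 1)` by `σ` does.
  set f : Equiv.Perm (Fin 3) → Letter → Equiv.Perm (Fin 3) := fun σ l =>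
    if l = ρ.stable then σ else if l = initialLetter ρ then Equiv.swap 0 1 else 1 with hf
  have h1 : ∀ σ, FreeGroup.lift (f σ) (.mk ρ.initial) = Equiv.swap 0 1 := by
    intro σ
    have h2 := initialLetter_ne_stable ρ
    cases ρ with
    | r1 m =>
      simp only [Rel.initial]
      split <;> simp [pos, hf, initialLetter, Rel.stable]
    | _ => simp [Rel.initial, pos, hf, initialLetter, Rel.stable]
  have h2 : ∀ σ, FreeGroup.lift (f σ) (.mk (R.terminal q ρ)) =
      FreeGroup.lift (f 1) (.mk (R.terminal q ρ)) := fun σ => lift_congr fun c hc => by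
    simp only [hf, if_neg (stable_notMem_terminal ρ c hc)]
  have h3 : ∀ σ, FreeGroup.lift (f σ) (.mk (R.relator q ρ)) =
      FreeGroup.lift (f 1) (.mk (R.relator q ρ)) := by
    intro σ
    rw [← h, ← MonoidHom.comp_apply, ← MonoidHom.comp_apply]
    congr 1
    ext1 l
    have : l.1 ≠ ρ.stable := fun h => hA (h ▸ l.2)
    simp [hf, this]
  have h4 := h3 (Equiv.swap 1 2)
  simp only [RipsWords.relator, mk_append, mk_invRev, mk_singleton_true, mk_singleton_false,
    map_mul, map_inv, FreeGroup.lift_apply_of, h1, h2 (Equiv.swap 1 2)] at h4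
  have h5 := mul_right_cancel h4
  simp only [hf, if_true] at h5
  revert h5
  decide

theorem mem_alphabet_of_mem_terminal {n : ℕ} {ρ : Rel p} {c : Letter × Bool}
    (hc : c ∈ R.terminal q ρ) : c.1 ∈ alphabet p n := by
  intro j hj
  obtain h | h | ⟨k, h⟩ := mem_terminal hc
  · obtain ⟨i, h⟩ := (mem_head h).1
    simp [h] at hj
  · simp [h] at hj
  · split at h <;> simp [h] at hj

/-- The initial word may contain `b_{j+1}` but not `b_j`, so the bound is weaker by one than
membership of `b_j`. Thus initial words for a new stable letter are words on the old alphabet. -/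
theorem mem_alphabet_of_mem_initial {n : ℕ} {ρ : Rel p}
    (hρ : ∀ j : ℕ, ρ.stable = .b j → p < j + 1 + n) {c : Letter × Bool}
    (hc : c ∈ ρ.initial) : c.1 ∈ alphabet p n := by
  intro j hj
  cases ρ with
  | r1 m =>
    have h1 := hρ m rfl
    simp only [Rel.initial] at hc
    split at hc
    · simp [pos] at hc
      simp [hc] at hj
    · simp [pos] at hc
      rcases hc with rfl | rfl
      · simp at hj
      · simp at hj
        omega
  | _ =>
    simp [Rel.initial, pos] at hc
    simp [hc] at hj

theorem mem_alphabet_of_mem_relator {n : ℕ} {ρ : Rel p} (hρ : ρ.stable ∈ alphabet p n) :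
    ∀ c ∈ R.relator q ρ, c.1 ∈ alphabet p n := by
  intro c hc
  have h1 : ∀ c ∈ invRev (R.terminal q ρ), c.1 ∈ alphabet p n :=
    forall_mem_invRev fun c hc => mem_alphabet_of_mem_terminal hc
  simp only [RipsWords.relator, List.mem_append, List.mem_singleton] at hc
  rcases hc with ((rfl | hc) | rfl) | hc
  · exact hρ
  · exact mem_alphabet_of_mem_initial (fun j hj => by have := hρ j hj; omega) hc
  · exact hρ
  · exact h1 c hc

variable (q R) in
/-- The letters as elements of a stage. -/
noncomputable def stageLetter (n : ℕ) : Letter → Stage q R n := extend PresentedGroup.of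

theorem stageElt_eq (n : ℕ) (w : Word) :
    stageElt q R n w = FreeGroup.lift (stageLetter q R n) (.mk w) := evalOn_eq _ w

theorem stageLetter_relator {n : ℕ} {ρ : Rel p} (hρ : ρ.stable ∈ alphabet p n) :
    FreeGroup.lift (stageLetter q R n) (.mk (R.relator q ρ)) = 1 := by
  obtain ⟨r, hr⟩ := exists_map_val_eq (mem_alphabet_of_mem_relator (R := R) (q := q) hρ)
  rw [← hr, stageLetter, lift_extend_map]
  have : FreeGroup.lift (PresentedGroup.of (rels := {r : FreeGroup (alphabet p n) |
      ∃ ρ : Rel p, FreeGroup.map Subtype.val r = FreeGroup.mk (R.relator q ρ)})) =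
      PresentedGroup.mk _ := by
    ext l
    simp [PresentedGroup.of]
  rw [this]
  exact PresentedGroup.one_of_mem ⟨ρ, hr⟩

/-- The homomorphism of a stage given by an interpretation of the letters. -/
def stageLift {G : Type*} [Group G] (n : ℕ) (f : Letter → G) (h : ∀ ρ : Rel p,
    ρ.stable ∈ alphabet p n → FreeGroup.lift f (.mk (R.relator q ρ)) = 1) : Stage q R n →* G :=
  PresentedGroup.toGroup (f := fun l => f l.1) (by
    rintro r ⟨ρ, hr⟩
    rw [← h ρ (stable_mem_of_map_eq hr), ← hr, ← MonoidHom.comp_apply]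
    congr 1
    ext l
    simp)

theorem stageLift_stageElt {G : Type*} [Group G] {n : ℕ} {f : Letter → G} (h : ∀ ρ : Rel p,
    ρ.stable ∈ alphabet p n → FreeGroup.lift f (.mk (R.relator q ρ)) = 1) {w : Word}
    (hw : ∀ c ∈ w, c.1 ∈ alphabet p n) :
    stageLift n f h (stageElt q R n w) = FreeGroup.lift f (.mk w) :=
  map_evalOn _ _ (fun l => by simp [stageLift]) hw

theorem stage_hom_ext {G : Type*} [Group G] {n : ℕ} {f g : Stage q R n →* G}
    (h : ∀ l ∈ alphabet p n, f (stageElt q R n (pos [l])) = g (stageElt q R n (pos [l]))) :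
    f = g := by
  refine PresentedGroup.ext fun l => ?_
  have h1 : stageElt q R n (pos [l.1]) = PresentedGroup.of l := extend_of_mem _ l.2
  rw [← h1]
  exact h l l.2

theorem mem_alphabet_succ {i : ℕ} (hi : i ≤ p) {l : Letter} :
    l ∈ alphabet p (i + 1) ↔ l ∈ alphabet p i ∨ l = .b (p - i) := by
  constructor
  · intro h
    by_cases hl : l = .b (p - i)
    · exact .inr hl
    · refine .inl fun j hj => ?_
      have h1 := h j hj
      have h2 : j ≠ p - i := by
        rintro rfl
        exact hl hj
      omega
  · rintro (h | rfl) j hj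
    · have := h j hj
      omega
    · simp at hj
      omega

theorem b_notMem_alphabet {i : ℕ} (hi : i ≤ p) : Letter.b (p - i) ∉ alphabet p i := by
  intro h
  have := h _ rfl
  omega

theorem Rel.exists_bRow {ρ : Rel p} {m : Fin (p + 1)} (h : ρ.stable = .b m) :
    ∃ k, ρ = Rel.bRow m k := by
  cases ρ <;> simp [Rel.stable, Fin.val_inj] at h <;> subst h
  · exact ⟨0, rfl⟩
  · exact ⟨1, rfl⟩
  · exact ⟨2, rfl⟩
  · rename_i k
    fin_cases k
    · exact ⟨3, rfl⟩
    · exact ⟨4, rfl⟩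

theorem Rel.exists_aRow {ρ : Rel p} {i : Fin 2} (h : ρ.stable = .a i) :
    ∃ k, ρ = Rel.aRow i k := by
  cases ρ <;> simp [Rel.stable] at h <;> subst h
  · exact ⟨0, rfl⟩
  · rename_i k
    fin_cases k
    · exact ⟨1, rfl⟩
    · exact ⟨2, rfl⟩

/-! ### The stages as HNN-extensions -/

/-- The homomorphism to the HNN-extension with stable letter `t`. -/
noncomputable def stageToTHnn (hR : R.Admissible q) {i : ℕ} (hi : i ≤ p) :
    Stage q R i →* THnn hR :=
  -- Only the last `i ≤ p` of the `p + 1` letters `b_j` are present, so `b₀` is not.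
  stageLift i (tLetter hR) fun ρ hρ => lift_tLetter_relator hR ρ fun h0 => by
    have := hρ 0 h0
    omega

theorem initial_bRow_mem (i : Fin (p + 1)) (k : Fin 5) :
    ∀ c ∈ (Rel.bRow i.rev k).initial, c.1 ∈ alphabet p i := by
  refine fun c hc => mem_alphabet_of_mem_initial (fun j hj => ?_) hc
  rw [Rel.stable_bRow] at hj
  simp [Fin.val_rev] at hj
  omega

theorem freelyGenerate_genK (hR : R.Admissible q) (i : Fin (p + 1)) :
    FreelyGenerate (genK q R i) := by
  refine FreelyGenerate.of_comp (stageToTHnn hR (Nat.lt_succ_iff.1 i.2)) ?_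
  unfold FreelyGenerate genK stageToTHnn
  simp only [stageLift_stageElt _ (initial_bRow_mem i _)]
  exact initial_injective hR i.rev

theorem freelyGenerate_genL (hR : R.Admissible q) (i : Fin (p + 1)) :
    FreelyGenerate (genL q R i) := by
  refine FreelyGenerate.of_comp (stageToTHnn hR (Nat.lt_succ_iff.1 i.2)) ?_
  unfold FreelyGenerate genL stageToTHnn
  simp only [stageLift_stageElt _ fun c hc => mem_alphabet_of_mem_terminal hc]
  exact terminal_injective hR i.rev

/-- The new relators are the five with conjugating letter `b_{p-i}`, and they are the relations of
the HNN-extension for the generators of `K_i`. The universal properties of both sides give mutually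
inverse homomorphisms. -/
theorem exists_stage_succ_equiv (i : Fin (p + 1)) (φ : gen (genK q R i) ≃* gen (genL q R i))
    (hφ : ∀ k, φ (genElt (genK q R i) k) = genElt (genL q R i) k) :
    ∃ Φ : HNNExtension (Stage q R i) (gen (genL q R i)) (gen (genK q R i)) φ.symm ≃*
        Stage q R (i + 1),
      (∀ l ∈ alphabet p i,
        Φ (HNNExtension.of (stageElt q R i (pos [l]))) = stageElt q R (i + 1) (pos [l])) ∧
      Φ HNNExtension.t = stageElt q R (i + 1) (pos [.b (p - i)]) := by
  classical
  have hi : (i : ℕ) ≤ p := Nat.lt_succ_iff.1 i.2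
  have hrev : ((i.rev : Fin (p + 1)) : ℕ) = p - i := by simp [Fin.val_rev]
  have hpos : ∀ {n : ℕ} {l : Letter}, l ∈ alphabet p n → ∀ c ∈ pos [l], c.1 ∈ alphabet p n := by
    intro n l hl c hc
    simp only [pos, List.map_cons, List.map_nil, List.mem_singleton] at hc
    rwa [hc]
  have hlift : ∀ {G : Type} [Group G] (f : Letter → G) (l : Letter),
      FreeGroup.lift f (.mk (pos [l])) = f l := by
    intro G _ f l
    simp [pos]
  have hstable : ∀ k, (Rel.bRow i.rev k).stable = .b (p - i) := fun k => by
    rw [Rel.stable_bRow, hrev]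
  -- the inclusion of the vertex group
  have hf : ∀ ρ : Rel p, ρ.stable ∈ alphabet p i →
      FreeGroup.lift (stageLetter q R (i + 1)) (.mk (R.relator q ρ)) = 1 := fun ρ hρ =>
    stageLetter_relator ((mem_alphabet_succ hi).2 (.inl hρ))
  set f : Stage q R i →* Stage q R (i + 1) := stageLift i (stageLetter q R (i + 1)) hf with hf'
  set x := stageLetter q R (i + 1) (.b (p - i)) with hx
  have hx' : ∀ a : gen (genL q R i), x * f a = f (φ.symm a : gen (genK q R i)) * x := by
    -- Two homomorphisms on `L_i` are compared on the generators, where their equality is a defining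
    -- relation.
    have h1 : (MulAut.conj x).toMonoidHom.comp (f.comp (gen (genL q R i)).subtype) =
        (f.comp (gen (genK q R i)).subtype).comp φ.symm.toMonoidHom := by
      refine gen_hom_ext fun k => ?_
      have h2 : φ.symm (genElt (genL q R i) k) = genElt (genK q R i) k := by
        rw [← hφ, MulEquiv.symm_apply_apply]
      have h3 := (lift_relator_eq_one_iff _ _).1 (stageLetter_relator (R := R) (q := q)
        (n := i + 1) (ρ := Rel.bRow i.rev k)
        ((mem_alphabet_succ hi).2 (.inr (hstable k))))
      rw [hstable, ← hx] at h3
      simp only [MonoidHom.comp_apply, MulEquiv.coe_toMonoidHom, Subgroup.coe_subtype, h2,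
        MulAut.conj_apply]
      change x * f (genL q R i k) * x⁻¹ = f (genK q R i k)
      rw [genL, genK, hf', stageLift_stageElt _ (initial_bRow_mem i k),
        stageLift_stageElt _ fun c hc => mem_alphabet_of_mem_terminal hc, ← h3]
      group
    intro a
    have h4 := DFunLike.congr_fun h1 a
    simp only [MonoidHom.comp_apply, MulEquiv.coe_toMonoidHom, Subgroup.coe_subtype,
        MulAut.conj_apply] at h4
    rw [← h4]
    group
  set F : HNNExtension (Stage q R i) (gen (genL q R i)) (gen (genK q R i)) φ.symm →*
      Stage q R (i + 1) := HNNExtension.lift f x hx' with hF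
  -- the inverse
  set g : Letter → HNNExtension (Stage q R i) (gen (genL q R i)) (gen (genK q R i)) φ.symm :=
    fun l => if l = .b (p - i) then HNNExtension.t else HNNExtension.of (stageLetter q R i l)
    with hg
  have hgw : ∀ w : Word, (∀ c ∈ w, c.1 ∈ alphabet p i) →
      FreeGroup.lift g (.mk w) = HNNExtension.of (stageElt q R i w) := by
    intro w hw
    symm
    refine map_evalOn _ _ (fun l => ?_) hw
    have h1 : l.1 ≠ .b (p - i) := fun h => b_notMem_alphabet hi (h ▸ l.2)
    rw [hg]
    simp only [h1, if_false]
    rw [stageLetter, extend_of_mem _ l.2]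
  have hgR : ∀ ρ : Rel p, ρ.stable ∈ alphabet p (i + 1) →
      FreeGroup.lift g (.mk (R.relator q ρ)) = 1 := by
    intro ρ hρ
    rcases (mem_alphabet_succ hi).1 hρ with h1 | h1
    · rw [hgw _ (mem_alphabet_of_mem_relator h1), stageElt_eq, stageLetter_relator h1, map_one]
    · rw [← hrev] at h1
      obtain ⟨k, rfl⟩ := Rel.exists_bRow h1
      rw [lift_relator_eq_one_iff, hgw _ (initial_bRow_mem i k),
        hgw _ fun c hc => mem_alphabet_of_mem_terminal hc, hstable]
      have h2 : φ.symm (genElt (genL q R i) k) = genElt (genK q R i) k := by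
        rw [← hφ, MulEquiv.symm_apply_apply]
      have h3 := HNNExtension.t_mul_of (φ := φ.symm) (genElt (genL q R i) k)
      rw [h2] at h3
      change HNNExtension.t * HNNExtension.of (genL q R i k) =
        HNNExtension.of (genK q R i k) * HNNExtension.t at h3
      simp only [hg, if_true]
      change _ * HNNExtension.of (genK q R i k) * _ = HNNExtension.of (genL q R i k)
      rw [mul_assoc, ← h3, inv_mul_cancel_left]
  have hFof : ∀ l ∈ alphabet p i, F (HNNExtension.of (stageElt q R i (pos [l]))) =
      stageElt q R (i + 1) (pos [l]) := by
    intro l hl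
    rw [hF, HNNExtension.lift_of, hf', stageLift_stageElt _ (hpos hl), stageElt_eq]
  have hFt : F HNNExtension.t = stageElt q R (i + 1) (pos [.b (p - i)]) := by
    rw [hF, HNNExtension.lift_t]
    rfl
  have hgS : ∀ l ∈ alphabet p (i + 1), stageLift (i + 1) g hgR (stageElt q R (i + 1) (pos [l])) =
      g l := fun l hl => by rw [stageLift_stageElt _ (hpos hl), hlift]
  have hgl : ∀ l ∈ alphabet p i, g l = HNNExtension.of (stageElt q R i (pos [l])) := fun l hl => by
    rw [← hgw _ (hpos hl), hlift]
  refine ⟨F.toMulEquiv (stageLift (i + 1) g hgR) ?_ ?_, hFof, hFt⟩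
  · refine HNNExtension.hom_ext ?_ ?_
    · refine stage_hom_ext fun l hl => ?_
      simp only [MonoidHom.comp_apply, hFof l hl, MonoidHom.id_apply,
        hgS l ((mem_alphabet_succ hi).2 (.inl hl)), hgl l hl]
    · simp only [MonoidHom.comp_apply, hFt, MonoidHom.id_apply,
        hgS _ ((mem_alphabet_succ hi).2 (.inr rfl))]
      simp [hg]
  · refine stage_hom_ext fun l hl => ?_
    rw [MonoidHom.comp_apply, hgS l hl, MonoidHom.id_apply]
    rcases (mem_alphabet_succ hi).1 hl with h1 | rfl
    · rw [hgl l h1, hFof l h1]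
    · rw [← hFt]
      simp [hg]

/-! ### The first stage as a double HNN-extension -/

theorem forall_mem_pos {l : Letter} {P : Letter → Prop} (hl : P l) : ∀ c ∈ pos [l], P c.1 := by
  intro c hc
  simp only [pos, List.map_cons, List.map_nil, List.mem_singleton] at hc
  rwa [hc]

theorem map_baseElt {w : Word} (hw : ∀ c ∈ w, c.1 ∈ baseAlphabet) :
    FreeGroup.map Subtype.val (baseElt w) = .mk w := by
  rw [baseElt, map_evalOn _ _ (g := FreeGroup.of) (fun l => by simp) hw,
    FreeGroup.lift_of_eq_id, MonoidHom.id_apply]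

/-- The letters `t, y₁, y₂`. -/
def rowLetter : Fin 3 → Letter := ![.t, .y 0, .y 1]

theorem rowLetter_mem (k : Fin 3) : rowLetter k ∈ baseAlphabet := by
  fin_cases k <;> simp [rowLetter, baseAlphabet]

theorem freelyGenerate_rowLetter : FreelyGenerate fun k => FreeGroup.of (rowLetter k) := by
  have h1 : Function.Injective rowLetter := by
    intro k l h
    fin_cases k <;> fin_cases l <;> simp_all [rowLetter]
  unfold FreelyGenerate
  convert FreeGroup.map_injective h1 using 2
  ext k
  simp

theorem freelyGenerate_baseInitial : FreelyGenerate baseInitial := by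
  refine FreelyGenerate.of_comp (FreeGroup.map Subtype.val) ?_
  convert freelyGenerate_rowLetter using 2 with k
  exact map_baseElt (forall_mem_pos (rowLetter_mem k))

theorem terminal_aRow_mem (i : Fin 2) (k : Fin 3) :
    ∀ c ∈ R.terminal q (Rel.aRow i k), c.1 ∈ baseAlphabet := by
  intro c hc
  have h1 : (Rel.aRow (p := p) i k).IsX = false := by fin_cases k <;> rfl
  have h2 : (Rel.aRow (p := p) i k).head q = [] := by fin_cases k <;> rfl
  obtain h | h | ⟨l, h⟩ := mem_terminal hc
  · simp [h2] at h
  · simp [h, baseAlphabet]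
  · rw [h, h1]
    fin_cases l <;> simp [baseAlphabet]

theorem freelyGenerate_terminal_aRow (hR : R.Admissible q) (i : Fin 2) :
    FreelyGenerate fun k => FreeGroup.mk (R.terminal q (Rel.aRow i k)) :=
  terminal_injective_of_stable hR (Rel.aRow_injective i) (Rel.stable_aRow i)

theorem freelyGenerate_baseTerminal (hR : R.Admissible q) (i : Fin 2) :
    FreelyGenerate (baseTerminal q R i) := by
  refine FreelyGenerate.of_comp (FreeGroup.map Subtype.val) ?_
  convert freelyGenerate_terminal_aRow hR i using 2 with k
  exact map_baseElt (terminal_aRow_mem i k)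

theorem Rel.initial_aRow (i : Fin 2) (k : Fin 3) :
    (Rel.aRow (p := p) i k).initial = pos [rowLetter k] := by
  fin_cases k <;> rfl

theorem mem_alphabet_of_mem_base {l : Letter} (hl : l ∈ baseAlphabet) (n : ℕ) :
    l ∈ alphabet p n := by
  intro j hj
  simp [hj, baseAlphabet] at hl

theorem a_mem_alphabet (i : Fin 2) (n : ℕ) : Letter.a i ∈ alphabet p n := by
  intro j hj
  simp at hj

theorem mem_alphabet_zero {l : Letter} :
    l ∈ alphabet p 0 ↔ l ∈ baseAlphabet ∨ ∃ i, l = .a i := by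
  constructor
  · intro h
    cases l with
    | a i => exact .inr ⟨i, rfl⟩
    | b j =>
      have := h j rfl
      omega
    | t => simp [baseAlphabet]
    | x k => fin_cases k <;> simp [baseAlphabet]
    | y k => fin_cases k <;> simp [baseAlphabet]
  · rintro (h | ⟨i, rfl⟩)
    · exact mem_alphabet_of_mem_base h 0
    · exact a_mem_alphabet i 0

theorem exists_aRow_of_mem {ρ : Rel p} (h : ρ.stable ∈ alphabet p 0) :
    ∃ i k, ρ = Rel.aRow i k := by
  rcases mem_alphabet_zero.1 h with h | ⟨i, h⟩
  · cases ρ <;> simp [Rel.stable, baseAlphabet] at h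
  · exact ⟨i, Rel.exists_aRow h⟩

theorem MultiHNN.relation {ι K : Type*} [Group K] {I T : ι → Subgroup K} (φ : ∀ i, I i ≃* T i)
    (i : ι) (g : I i) : (MultiHNN.stable I T φ i)⁻¹ * MultiHNN.of I T φ g *
      MultiHNN.stable I T φ i = MultiHNN.of I T φ (φ i g) := by
  rw [← mul_inv_eq_one]
  exact (QuotientGroup.eq_one_iff _).2 (Subgroup.subset_normalClosure ⟨i, g, rfl⟩)

theorem lift_pos_singleton {G : Type*} [Group G] (f : Letter → G) (l : Letter) :
    FreeGroup.lift f (.mk (pos [l])) = f l := by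
  simp [pos]

/-- Given the isomorphisms `φ i`, this is again a comparison of universal properties: relations for
all elements of the initial groups follow from those for `t, y₁, y₂`. -/
theorem exists_first_stage_equiv
    (φ : ∀ i : Fin 2, gen baseInitial ≃* gen (baseTerminal q R i))
    (hφ : ∀ i k, φ i (genElt baseInitial k) = genElt (baseTerminal q R i) k) :
    ∃ Φ : MultiHNN (fun _ : Fin 2 => gen baseInitial) (fun i => gen (baseTerminal q R i)) φ ≃*
        Stage q R 0,
      (∀ l ∈ baseAlphabet,
        Φ (MultiHNN.of _ _ φ (baseElt (pos [l]))) = stageElt q R 0 (pos [l])) ∧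
      ∀ i, Φ (MultiHNN.stable _ _ φ i) = stageElt q R 0 (pos [.a i]) := by
  set f : BaseGroup →* Stage q R 0 := FreeGroup.lift fun l => stageLetter q R 0 l.1 with hf
  set s : FreeGroup (Fin 2) →* Stage q R 0 :=
    FreeGroup.lift fun i => stageLetter q R 0 (.a i) with hs
  have hfw : ∀ w : Word, (∀ c ∈ w, c.1 ∈ baseAlphabet) → f (baseElt w) = stageElt q R 0 w :=
    fun w hw => by rw [stageElt_eq]; exact map_evalOn _ _ (fun l => by simp [hf]) hw
  have hrel : ∀ (i : Fin 2) (g : gen baseInitial),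
      (s (.of i))⁻¹ * f g * s (.of i) = f (φ i g : gen (baseTerminal q R i)) := by
    intro i
    have h1 : (MulAut.conj (s (.of i))⁻¹).toMonoidHom.comp (f.comp (gen baseInitial).subtype) =
        (f.comp (gen (baseTerminal q R i)).subtype).comp (φ i).toMonoidHom := by
      refine gen_hom_ext fun k => ?_
      have h2 := (lift_relator_eq_one_iff _ _).1 (stageLetter_relator (R := R) (q := q)
        (n := 0) (ρ := Rel.aRow i k) (by rw [Rel.stable_aRow]; exact a_mem_alphabet i 0))
      rw [Rel.initial_aRow, Rel.stable_aRow, ← stageElt_eq, ← stageElt_eq,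
        ← hfw _ (terminal_aRow_mem i k), ← hfw _ (forall_mem_pos (rowLetter_mem k))] at h2
      simp only [MonoidHom.comp_apply, MulEquiv.coe_toMonoidHom, Subgroup.coe_subtype, hφ,
        MulAut.conj_apply, inv_inv, hs, FreeGroup.lift_apply_of]
      exact h2
    intro g
    have h3 := DFunLike.congr_fun h1 g
    simp only [MonoidHom.comp_apply, MulEquiv.coe_toMonoidHom, Subgroup.coe_subtype,
      MulAut.conj_apply, inv_inv] at h3
    exact h3
  set F : MultiHNN (fun _ : Fin 2 => gen baseInitial) (fun i => gen (baseTerminal q R i)) φ →*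
      Stage q R 0 := QuotientGroup.lift _ (Monoid.Coprod.lift f s) (by
    refine Subgroup.normalClosure_le_normal ?_
    rintro _ ⟨i, g, rfl⟩
    rw [SetLike.mem_coe, MonoidHom.mem_ker]
    simp only [map_mul, map_inv, Monoid.Coprod.lift_apply_inl, Monoid.Coprod.lift_apply_inr,
      hrel, mul_inv_cancel]) with hF
  have hFof : ∀ x, F (MultiHNN.of _ _ φ x) = f x := fun x => by
    simp [hF, MultiHNN.of]
  have hFs : ∀ i, F (MultiHNN.stable _ _ φ i) = stageElt q R 0 (pos [.a i]) := fun i => by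
    rw [stageElt_eq, lift_pos_singleton]
    simp [hF, MultiHNN.stable, hs]
  set g : Letter → MultiHNN (fun _ : Fin 2 => gen baseInitial)
      (fun i => gen (baseTerminal q R i)) φ := fun l => match l with
    | .a i => MultiHNN.stable _ _ φ i
    | l => MultiHNN.of _ _ φ (baseElt (pos [l])) with hg
  have hga : ∀ i, g (.a i) = MultiHNN.stable _ _ φ i := fun i => rfl
  have hgb : ∀ l ∈ baseAlphabet, g l = MultiHNN.of _ _ φ (baseElt (pos [l])) := by
    intro l hl
    cases l with
    | a i => simp [baseAlphabet] at hl
    | _ => rfl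
  have hgw : ∀ w : Word, (∀ c ∈ w, c.1 ∈ baseAlphabet) →
      FreeGroup.lift g (.mk w) = MultiHNN.of _ _ φ (baseElt w) := by
    intro w hw
    symm
    refine map_evalOn _ _ (fun l => ?_) hw
    rw [hgb _ l.2]
    congr 1
    exact (extend_of_mem _ l.2).symm
  have hgR : ∀ ρ : Rel p, ρ.stable ∈ alphabet p 0 →
      FreeGroup.lift g (.mk (R.relator q ρ)) = 1 := by
    intro ρ hρ
    obtain ⟨i, k, rfl⟩ := exists_aRow_of_mem hρ
    rw [lift_relator_eq_one_iff, Rel.stable_aRow, Rel.initial_aRow, hgw _ (terminal_aRow_mem i k),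
      hgw _ (forall_mem_pos (rowLetter_mem k)), hga]
    have := MultiHNN.relation φ i (genElt baseInitial k)
    rw [hφ] at this
    exact this
  have hgS : ∀ l ∈ alphabet p 0, stageLift 0 g hgR (stageElt q R 0 (pos [l])) = g l :=
    fun l hl => by rw [stageLift_stageElt _ (forall_mem_pos hl), lift_pos_singleton]
  have hFb : ∀ l ∈ baseAlphabet,
      F (MultiHNN.of _ _ φ (baseElt (pos [l]))) = stageElt q R 0 (pos [l]) :=
    fun l hl => by rw [hFof, hfw _ (forall_mem_pos hl)]
  refine ⟨F.toMulEquiv (stageLift 0 g hgR) ?_ ?_, hFb, hFs⟩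
  · refine QuotientGroup.monoidHom_ext _ (Monoid.Coprod.hom_ext ?_ ?_)
    · ext l
      have h1 : (FreeGroup.of l : BaseGroup) = baseElt (pos [l.1]) := (extend_of_mem _ l.2).symm
      simp only [MonoidHom.comp_apply, h1, MonoidHom.id_apply]
      change stageLift 0 g hgR (F (MultiHNN.of _ _ φ (baseElt (pos [l.1])))) =
        MultiHNN.of _ _ φ (baseElt (pos [l.1]))
      rw [hFb _ l.2, hgS _ (mem_alphabet_of_mem_base l.2 0), hgb _ l.2]
    · ext i
      change stageLift 0 g hgR (F (MultiHNN.stable _ _ φ i)) = MultiHNN.stable _ _ φ i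
      rw [hFs, hgS _ (a_mem_alphabet i 0)]
  · refine stage_hom_ext fun l hl => ?_
    rw [MonoidHom.comp_apply, hgS l hl, MonoidHom.id_apply]
    rcases mem_alphabet_zero.1 hl with h1 | ⟨i, rfl⟩
    · rw [hgb l h1, hFb l h1]
    · exact hFs i

/-! ### The subgroup generated by `t, y₁, y₂` -/

-- Two successive ordinary HNN-extensions embed the free group on all letters into a group with
-- elements `s`, `s'` that satisfy the relations of `a₁` and `a₂`. It receives a homomorphism from
-- `G_{-1}` under which `t, y₁, y₂` stay free, and no normal forms for double HNN-extensions are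
-- needed.
variable (q R) in
theorem freelyGenerate_first_stage (hR : R.Admissible q) :
    FreelyGenerate fun k => stageElt q R 0 (pos [rowLetter k]) := by
  obtain ⟨G, _, f, s, hf, hs⟩ := freelyGenerate_rowLetter.exists_conj
    (freelyGenerate_terminal_aRow hR 0)
  obtain ⟨G', _, f', s', hf', hs'⟩ := (freelyGenerate_rowLetter.map hf).exists_conj
    ((freelyGenerate_terminal_aRow hR 1).map hf)
  set g : Letter → G' := fun l => match l with
    | .a i => if i = 0 then f' s else s'
    | l => f' (f (.of l)) with hg
  have hgw : ∀ w : Word, (∀ c ∈ w, c.1 ∈ baseAlphabet) →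
      FreeGroup.lift g (.mk w) = f' (f (.mk w)) := by
    intro w hw
    have h1 : FreeGroup.lift g (.mk w) = FreeGroup.lift (fun l => f' (f (.of l))) (.mk w) := by
      refine lift_congr fun c hc => ?_
      obtain ⟨l, e⟩ := c
      cases l with
      | a i => simpa [baseAlphabet] using hw _ hc
      | _ => rfl
    rw [h1]
    refine DFunLike.congr_fun (f := FreeGroup.lift _) (g := f'.comp f) ?_ _
    ext l
    simp
  have hgR : ∀ ρ : Rel p, ρ.stable ∈ alphabet p 0 →
      FreeGroup.lift g (.mk (R.relator q ρ)) = 1 := by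
    intro ρ hρ
    obtain ⟨i, k, rfl⟩ := exists_aRow_of_mem hρ
    rw [lift_relator_eq_one_iff, Rel.stable_aRow, Rel.initial_aRow, hgw _ (terminal_aRow_mem i k),
      hgw _ (forall_mem_pos (rowLetter_mem k))]
    fin_cases i
    · have := congrArg f' (hs k)
      rw [map_mul, map_mul, map_inv] at this
      exact this
    · exact hs' k
  refine FreelyGenerate.of_comp (stageLift 0 g hgR) ?_
  convert (freelyGenerate_rowLetter.map hf).map hf' using 2 with k
  rw [stageLift_stageElt _ (forall_mem_pos (mem_alphabet_of_mem_base (rowLetter_mem k) 0)),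
    hgw _ (forall_mem_pos (rowLetter_mem k))]
  rfl

/-- Freeness ascends from `G_{-1}`, since every stage is the vertex group of the next and embeds in
it. -/
theorem freelyGenerate_stage (hR : R.Admissible q) {n : ℕ} (hn : n ≤ p + 1) :
    FreelyGenerate fun k => stageElt q R n (pos [rowLetter k]) := by
  induction n with
  | zero => exact freelyGenerate_first_stage q R hR
  | succ n ih =>
    have hn' : n < p + 1 := hn
    obtain ⟨φ, hφ⟩ := (freelyGenerate_genK hR ⟨n, hn'⟩).exists_mulEquiv
      (freelyGenerate_genL hR ⟨n, hn'⟩)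
    obtain ⟨Φ, hΦ, -⟩ := exists_stage_succ_equiv ⟨n, hn'⟩ φ hφ
    have h1 : Function.Injective (Φ.toMonoidHom.comp HNNExtension.of) :=
      Φ.injective.comp (HNNExtension.of_injective _)
    convert (ih hn'.le).map h1 using 2 with k
    exact (hΦ _ (mem_alphabet_of_mem_base (rowLetter_mem k) n)).symm

end Presentations

end NoisyHNN

theorem proposition7p3 (p q : ℕ) (hq : 0 < q) (hqp : q < p)
    (R : NoisyHNN.RipsWords p) (hR : R.Admissible q) :
    -- `G_{-1}` is a double HNN-extension of `F` with stable letters `a₁, a₂`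
    (FreelyGenerate baseInitial ∧ (∀ i, FreelyGenerate (baseTerminal q R i)) ∧
      ∃ φ : ∀ i : Fin 2, gen baseInitial ≃* gen (baseTerminal q R i),
        (∀ i k, φ i (genElt baseInitial k) = genElt (baseTerminal q R i) k) ∧
        ∃ Φ : MultiHNN (fun _ : Fin 2 => gen baseInitial) (fun i => gen (baseTerminal q R i)) φ ≃*
            Stage q R 0,
          (∀ l ∈ baseAlphabet,
            Φ (MultiHNN.of _ _ φ (baseElt (pos [l]))) = stageElt q R 0 (pos [l])) ∧
          ∀ i, Φ (MultiHNN.stable _ _ φ i) = stageElt q R 0 (pos [.a i])) ∧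
    -- `G_i` is an HNN-extension of `G_{i-1}` with stable letter `b_{p-i}`, `0 ≤ i ≤ p`
    (∀ i : Fin (p + 1),
      FreelyGenerate (genK q R i) ∧ FreelyGenerate (genL q R i) ∧
      ∃ φ : gen (genK q R i) ≃* gen (genL q R i),
        (∀ k, φ (genElt (genK q R i) k) = genElt (genL q R i) k) ∧
        -- `HNNExtension.t` satisfies `t * l * t⁻¹ = φ.symm l`, that is, `t⁻¹ * k * t = φ k`
        ∃ Φ : HNNExtension (Stage q R i) (gen (genL q R i)) (gen (genK q R i)) φ.symm ≃*
            Stage q R (i + 1),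
          (∀ l ∈ alphabet p i,
            Φ (HNNExtension.of (stageElt q R i (pos [l]))) = stageElt q R (i + 1) (pos [l])) ∧
          Φ HNNExtension.t = stageElt q R (i + 1) (pos [.b (p - i)])) ∧
    -- `H = ⟨t, y₁, y₂⟩` is a free subgroup of rank 3 in `G`
    (FreelyGenerate (genH q R) ∧ Nonempty (gen (genH q R) ≃* FreeGroup (Fin 3))) := by
  have hbase := freelyGenerate_baseInitial
  have hterm : ∀ i, FreelyGenerate (baseTerminal q R i) := freelyGenerate_baseTerminal hR
  have hH : FreelyGenerate (genH q R) := freelyGenerate_stage hR le_rfl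
  choose φ hφ using fun i => hbase.exists_mulEquiv (hterm i)
  refine ⟨⟨hbase, hterm, φ, hφ, exists_first_stage_equiv φ hφ⟩, fun i => ?_,
    hH, hH.nonempty_mulEquiv⟩
  obtain ⟨ψ, hψ⟩ := (freelyGenerate_genK hR i).exists_mulEquiv (freelyGenerate_genL hR i)
  exact ⟨freelyGenerate_genK hR i, freelyGenerate_genL hR i, ψ, hψ,
    exists_stage_succ_equiv i ψ hψ⟩
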